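/- **Setting.** Let $\mathcal A,\mathcal A'$ be finite alphabets, and let $X\subseteq\mathcal A^{\mathbb N}$, $Y\subseteq\mathcal A'^{\mathbb N}$ be one-sided subshifts (closed sets mapped into themselves by the left shift), with shift maps $\sigma_X,\sigma_Y$. Let $\mathcal L(X)$ be the set of words $x_1\cdots x_n$ with $x\in X$, $n\ge1$, together with the empty word $\varepsilon$; let $\mathcal L_n(X)$ be the set of those of length $n\ge 0$. Let $\pi:X\to Y$ be a one-block factor map, i.e. a continuous surjection with $\pi\sigma_X=\sigma_Y\pi$ given by $\pi(x)=(\pi(x_i))_{i\ge1}$ for a map of letters $\pi:\mathcal A\to\mathcal A'$; write $\pi I=\pi(x_1)\cdots\pi(x_n)$ for $I=x_1\cdots x_n$. For a word $I$ and a measure $\mu$ on $X$ write $\mu(I)=\mu(\{x\in X: x_1\cdots x_{|I|}=I\})$. Let $\mathcal M(X,\sigma_X)$ be the set of $\sigma_X$-invariant Borel probability measures on $X$. For $\mu\in\mathcal M(X,\sigma_X)$ put $h_\mu(\sigma_X)=-\lim_n\frac1n\sum_{I\in\mathcal L_n(X)}\mu(I)\log\mu(I)$ (with $0\log 0=0$),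 and similarly on $Y$. Let $p\ge 0$ be an integer. $\mathcal D_w(X,p)$ is the set of functions $\phi:\mathcal L(X)\to[0,\infty)$, positive at some nonempty word, for which there is $c\in(0,1]$ such that (1) $\phi(IJ)\le c^{-1}\phi(I)\phi(J)$ whenever $IJ\in\mathcal L(X)$; (2) for all $I,J\in\mathcal L(X)$ there is $K\in\bigcup_{i=0}^p\mathcal L_i(X)$ with $IKJ\in\mathcal L(X)$ and $\phi(IKJ)\ge c\,\phi(I)\phi(J)$. $\mathcal D(X,p)$ is defined in the same way, with $K\in\mathcal L_p(X)$ in (2). Let $a_1>0$, $a_2\ge0$ and $\phi\in\mathcal D_w(X,p)$. Let $\Phi=(\log\phi_n)_{n\ge1}$ with $\phi_n(x)=\phi(x_1\cdots x_n)$ for $x\in X$, and let $\Phi_*(\mu)=\lim_n\frac1n\int\log\phi_n\,d\mu\in\mathbb R\cup\{-\infty\}$ for $\mu\in\mathcal M(X,\sigma_X)$. A measure $\mu\in\mathcal M(X,\sigma_X)$ is an $\mathbf a$-weighted equilibrium state of $\Phi$, $\mathbf a=(a_1,a_2)$, if $$\Phi_*(\mu)+a_1h_\mu(\sigma_X)+a_2h_{\mu\circ\pi^{-1}}(\sigma_Y)=\sup_{\eta\in\mathcal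 M(X,\sigma_X)}\left(\Phi_*(\eta)+a_1h_\eta(\sigma_X)+a_2h_{\eta\circ\pi^{-1}}(\sigma_Y)\right).$$ For $n\ge0$ define $$\phi^{(2)}(J)=\Big(\sum_{I\in\mathcal L_n(X):\,\pi I=J}\phi(I)^{1/a_1}\Big)^{a_1}\ (J\in\mathcal L_n(Y)),\qquad \phi^{(3)}(n)=\sum_{J\in\mathcal L_n(Y)}\phi^{(2)}(J)^{1/(a_1+a_2)},$$ $$\widetilde\phi(I)=\frac{\phi(I)^{1/a_1}}{\phi^{(2)}(\pi I)^{1/a_1}}\cdot\frac{\phi^{(2)}(\pi I)^{1/(a_1+a_2)}}{\phi^{(3)}(n)}\quad (I\in\mathcal L_n(X),\ 0/0:=0),$$ $$\widetilde\phi^*(I)=\sup_{m,n\ge0}\ \sum_{\substack{I_1\in\mathcal L_m(X),\,I_2\in\mathcal L_n(X)\\ I_1II_2\in\mathcal L(X)}}\widetilde\phi(I_1II_2)\quad (I\in\mathcal L(X)).$$ **Theorem.** $\Phi$ has a unique $\mathbf a$-weighted equilibrium state $\mu$. The measure $\mu$ is ergodic, and: (i) $\widetilde\phi^*(I)<\infty$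 for all $I\in\mathcal L(X)$, and there is $c>0$ with $c^{-1}\widetilde\phi^*(I)\le\mu(I)\le c\,\widetilde\phi^*(I)$ and $\widetilde\phi^*(I)\ge c^{-1}\widetilde\phi(I)$ for all $I\in\mathcal L(X)$. (ii) There is $c>0$ with $\liminf_{n\to\infty}\sum_{i=0}^p\mu(A\cap\sigma_X^{-n-i}(B))\ge c\,\mu(A)\mu(B)$ for all Borel sets $A,B\subseteq X$. (iii) If $\mu(I)>0$ then $\phi(I)>0$ and $\widetilde\phi(I)>0$; $\Phi_*(\mu)$ is finite; and, with error terms bounded uniformly in $n\ge0$ (and $0\log0=0$), $$\sum_{I\in\mathcal L_n(X)}\mu(I)\log\mu(I)=\sum_{I\in\mathcal L_n(X)}\mu(I)\log\widetilde\phi(I)+O(1)=-nh_\mu(\sigma_X)+O(1),$$ $$\sum_{I\in\mathcal L_n(X)}\mu(I)\log\phi(I)=n\Phi_*(\mu)+O(1).$$ (iv) If moreover $\phi\in\mathcal D(X,p)$, then there is $c>0$ with $\liminf_{n\to\infty}\mu(A\cap\sigma_X^{-n}(B))\ge c\,\mu(A)\mu(B)$ for all Borel sets $A,B\subseteq X$.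 -/

import Mathlib

open MeasureTheory Filter SymbolicDynamics.FullShift
open scoped NNReal ENNReal

namespace WeightedEquilibrium

noncomputable section

variable {A B : Type*} [TopologicalSpace A] [TopologicalSpace B]

/-- The left shift `σ_X : X → X` on a one-sided subshift `X ⊆ A^ℕ`. Sequences are indexed from `0`,
so the letter `x_i` of the one-based notation is `x (i - 1)`. -/
def shiftMap (X : Subshift A ℕ) : X.carrier → X.carrier :=
  (X.mapsTo 1).restrict

/-- The word `x_1 ⋯ x_n` formed by the first `n` letters of `x`. -/
def initialWord (x : ℕ → A) (n : ℕ) : List A :=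
  List.ofFn fun i : Fin n => x i

/-- The language of `X`: the initial words of elements of `X` (since `X` is shift invariant, these
are all the words occurring in elements of `X`), together with the empty word. -/
def language (X : Subshift A ℕ) : Set (List A) :=
  {I | I = [] ∨ ∃ x ∈ X.carrier, initialWord x I.length = I}

/-- There are finitely many legal words of length `n`. -/
theorem finite_words [Finite A] (X : Subshift A ℕ) (n : ℕ) :
    {I : List A | I ∈ language X ∧ I.length = n}.Finite :=
  (List.finite_length_eq A n).subset fun _ h => h.2

/-- `L_n(X)`: the finite set of legal words of length `n`. -/
def words [Finite A] (X : Subshift A ℕ) (n : ℕ) : Finset (List A) :=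
  (finite_words X n).toFinset

/-- The part `[I] ∩ X` of the cylinder of the word `I` that lies in `X`. -/
def cyl (X : Subshift A ℕ) (I : List A) : Set X.carrier :=
  {x | initialWord x.1 I.length = I}

/-- `M(X, σ_X)`: the shift invariant Borel probability measures on `X`. -/
def invariantMeasures [MeasurableSpace A] (X : Subshift A ℕ) : Set (Measure X.carrier) :=
  {μ | IsProbabilityMeasure μ ∧ MeasurePreserving (shiftMap X) μ μ}

/-- `π : X → Y` is a factor map (continuous, onto, commuting with the shifts), and it is the
one-block map given by the map of letters `b`. -/
structure IsOneBlockFactorMap (X : Subshift A ℕ) (Y : Subshift B ℕ)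
    (π : X.carrier → Y.carrier) (b : A → B) : Prop where
  continuous : Continuous π
  surjective : Function.Surjective π
  semiconj : Function.Semiconj π (shiftMap X) (shiftMap Y)
  oneBlock : ∀ (x : X.carrier) (i : ℕ), (π x).1 i = b (x.1 i)

/-! ### The classes of functions on words -/

/-- The class `D_w(X, p)`. Only the values of `φ` on the language of `X` matter. -/
def MemDw (X : Subshift A ℕ) (p : ℕ) (φ : List A → ℝ) : Prop :=
  (∀ I ∈ language X, 0 ≤ φ I) ∧
  (∃ I ∈ language X, I ≠ [] ∧ 0 < φ I) ∧
  ∃ c : ℝ, 0 < c ∧ c ≤ 1 ∧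
    (∀ I J : List A, I ++ J ∈ language X → φ (I ++ J) ≤ c⁻¹ * φ I * φ J) ∧
    (∀ I ∈ language X, ∀ J ∈ language X, ∃ K ∈ language X, K.length ≤ p ∧
      I ++ K ++ J ∈ language X ∧ c * φ I * φ J ≤ φ (I ++ K ++ J))

/-- The class `D(X, p)`: the connecting word has length exactly `p`. -/
def MemD (X : Subshift A ℕ) (p : ℕ) (φ : List A → ℝ) : Prop :=
  (∀ I ∈ language X, 0 ≤ φ I) ∧
  (∃ I ∈ language X, I ≠ [] ∧ 0 < φ I) ∧
  ∃ c : ℝ, 0 < c ∧ c ≤ 1 ∧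
    (∀ I J : List A, I ++ J ∈ language X → φ (I ++ J) ≤ c⁻¹ * φ I * φ J) ∧
    (∀ I ∈ language X, ∀ J ∈ language X, ∃ K ∈ language X, K.length = p ∧
      I ++ K ++ J ∈ language X ∧ c * φ I * φ J ≤ φ (I ++ K ++ J))

/-! ### Entropy, potentials and weighted equilibrium states -/

/-- The measure theoretic entropy
`h_μ(σ_X) = - lim (1/n) ∑_{I ∈ L_n(X)} μ(I) log μ(I)` of an invariant measure. The sequence is
bounded, and for invariant `μ` it converges, so that the limit is its upper limit. -/
def entropy [Finite A] [MeasurableSpace A] (X : Subshift A ℕ) (μ : Measure X.carrier) : ℝ :=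
  limsup (fun n : ℕ =>
    -((n : ℝ)⁻¹ * ∑ I ∈ words X n, μ.real (cyl X I) * Real.log (μ.real (cyl X I)))) atTop

/-- The integral of an extended real valued function, as the difference of the integrals of its
positive part and of its negative part. -/
def erealIntegral {Ω : Type*} [MeasurableSpace Ω] (μ : Measure Ω) (f : Ω → EReal) : EReal :=
  ((∫⁻ x, (f x).toENNReal ∂μ : ℝ≥0∞) : EReal) - ((∫⁻ x, (-f x).toENNReal ∂μ : ℝ≥0∞) : EReal)

/-- For a potential `Φ = (log φ_n)` on `X`, given by the nonnegative functions `φ_n`,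
`Φ_*(μ) = lim (1/n) ∫ log φ_n dμ`, an extended real number (`log 0 = -∞`). For a subadditive
potential and an invariant `μ` the limit exists, and is then the upper limit. -/
def potentialLimit [MeasurableSpace A] (X : Subshift A ℕ) (Φ : ℕ → X.carrier → ℝ)
    (μ : Measure X.carrier) : EReal :=
  limsup (fun n : ℕ => (((n : ℝ)⁻¹ : ℝ) : EReal) *
    erealIntegral μ (fun x => ENNReal.log (ENNReal.ofReal (Φ n x)))) atTop

/-- The potential generated by a function `φ` on words: `φ_n(x) = φ(x_1 ⋯ x_n)`. -/
def generatedPotential (X : Subshift A ℕ) (φ : List A → ℝ) : ℕ → X.carrier → ℝ :=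
  fun n x => φ (initialWord x.1 n)

section Factor

variable [Finite A] [Finite B] [MeasurableSpace A] [MeasurableSpace B]

/-- `Φ_*(μ) + a₁ h_μ(σ_X) + a₂ h_{μ ∘ π⁻¹}(σ_Y)`. -/
def weightedFreeEnergy (X : Subshift A ℕ) (Y : Subshift B ℕ) (π : X.carrier → Y.carrier)
    (a₁ a₂ : ℝ) (Φ : ℕ → X.carrier → ℝ) (μ : Measure X.carrier) : EReal :=
  potentialLimit X Φ μ + ((a₁ * entropy X μ + a₂ * entropy Y (μ.map π) : ℝ) : EReal)

/-- `μ` is an `(a₁, a₂)`-weighted equilibrium state of `Φ` for the factor map `π`. -/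
def IsWeightedEquilibriumState (X : Subshift A ℕ) (Y : Subshift B ℕ) (π : X.carrier → Y.carrier)
    (a₁ a₂ : ℝ) (Φ : ℕ → X.carrier → ℝ) (μ : Measure X.carrier) : Prop :=
  μ ∈ invariantMeasures X ∧
    weightedFreeEnergy X Y π a₁ a₂ Φ μ =
      ⨆ η ∈ invariantMeasures X, weightedFreeEnergy X Y π a₁ a₂ Φ η

end Factor

/-! ### The functions `φ^{(2)}`, `φ^{(3)}`, `φ̃`, `φ̃*` -/

section Tilde

variable [Finite A] [Finite B]

open Classical in
/-- `φ^{(2)}(J) = (∑_{I ∈ L_n(X), π I = J} φ(I)^{1/a₁})^{a₁}` for `J` of length `n`. -/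
def phi2 (X : Subshift A ℕ) (b : A → B) (a₁ : ℝ) (φ : List A → ℝ) (J : List B) : ℝ :=
  (∑ I ∈ (words X J.length).filter (fun I => I.map b = J), φ I ^ (1 / a₁)) ^ a₁

/-- `φ^{(3)}(n) = ∑_{J ∈ L_n(Y)} φ^{(2)}(J)^{1/(a₁+a₂)}`. -/
def phi3 (X : Subshift A ℕ) (Y : Subshift B ℕ) (b : A → B) (a₁ a₂ : ℝ) (φ : List A → ℝ)
    (n : ℕ) : ℝ :=
  ∑ J ∈ words Y n, phi2 X b a₁ φ J ^ (1 / (a₁ + a₂))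

/-- `φ̃(I) = φ(I)^{1/a₁} / φ^{(2)}(π I)^{1/a₁} · φ^{(2)}(π I)^{1/(a₁+a₂)} / φ^{(3)}(n)` for
`I ∈ L_n(X)`, with the convention `0/0 = 0`. -/
def phiTilde (X : Subshift A ℕ) (Y : Subshift B ℕ) (b : A → B) (a₁ a₂ : ℝ) (φ : List A → ℝ)
    (I : List A) : ℝ :=
  φ I ^ (1 / a₁) / phi2 X b a₁ φ (I.map b) ^ (1 / a₁) *
    (phi2 X b a₁ φ (I.map b) ^ (1 / (a₁ + a₂)) / phi3 X Y b a₁ a₂ φ I.length)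

open Classical in
/-- `∑ ψ(I₁ I I₂)` over `I₁ ∈ L_m(X)`, `I₂ ∈ L_n(X)` with `I₁ I I₂` legal. -/
def extensionSum (X : Subshift A ℕ) (ψ : List A → ℝ) (m n : ℕ) (I : List A) : ℝ :=
  ∑ P ∈ (words X m ×ˢ words X n).filter (fun P => P.1 ++ I ++ P.2 ∈ language X),
    ψ (P.1 ++ I ++ P.2)

/-- `ψ*(I) = sup_{m, n ≥ 0} ∑ ψ(I₁ I I₂)`. -/
def starSup (X : Subshift A ℕ) (ψ : List A → ℝ) (I : List A) : ℝ :=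
  ⨆ q : ℕ × ℕ, extensionSum X ψ q.1 q.2 I

end Tilde

end

end WeightedEquilibrium

/-!
The statement is about a potential `φ` on the words of `X` that is submultiplicative and can be glued
along short words. All words are handled as plain lists: `ψ = φ ^ (1 / a₁)`, extended by `0` outside
the language, is a `GluingWeight`, and the potential is carried by `ψ` together with the letter map
`b`.

**The word probabilities.** With `β = a₂ / a₁` and `κ = 1 / (1 + β)`, let `F J` be the sum of `ψ` over
the words above `J`, and `R n = ∑ F J ^ κ` over the words of length `n`. The function `φ̃` is
`wordProb`, `f I = ψ I / F (b I) * F (b I) ^ κ / R n`, a probability on the words of each length `n`.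
Gibbs' inequality identifies it as the maximizer of the functional `energy`
(entropy of `ν` plus mean of `log ψ` plus `β` times the entropy of the push-forward of `ν`):
the energy of `ν` is `(1 + β) log R n` minus the entropy of `ν` relative to `f`, minus `β` times the
entropy of the push-forward of `ν` relative to that of `f`. As `log R n` is `n P + O(1)`
(`GluingWeight.exists_log_partitionSum`), the free energy of an invariant measure is at most
`(a₁ + a₂) P` (`weightedFreeEnergy_le`).

**Existence.** The probabilities for different lengths are not consistent, but the sum of `f` over the
extensions `I₁ I I₂` with `I₁`, `I₂` of given lengths `m`, `n` (`paddedSum`) drops by at most a bounded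
factor when `n` becomes larger by any sufficiently large amount, and, averaged over a few lengths,
when `m` becomes larger. Gluing controls the lengths only up to the length of the connecting word; the
hard point is to reach every length exactly (`GluingWeight.sum_wordProb_append_ge`). Glued words are
truncated to this end, which may increase `F` and so make the factor `F ^ (κ - 1)` small, but the
words for which this happens carry little weight. Hence a limit of averages of `f` over the starting
position is an invariant measure `μ` comparable to `φ̃*` (`GluingWeight.exists_gibbs_measure`). The
comparison and the gluing of `f` yield the lower bounds for correlations, first for cylinders and then
for Borel sets (`le_liminf_correlation`), and ergodicity follows (`ergodic_of_correlation`). Energy is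
subadditive in the word length up to a constant, and the telescoped form of this
(`GluingWeight.mul_log_partitionSum_le`) shows that the averages, and so `μ`, have energy at least
`q (1 + β) P - O(1)` at every length `q`. Thus `μ` has the maximal free energy.

**Uniqueness and the `O(1)` estimates.** Let `η` have the maximal free energy. Entropy and mean
potential are each subadditive up to a constant, so by Fekete's lemma each exceeds `n` times its limit
minus a constant; as the sum is at most `n (1 + β) P + O(1)`, every one of them is `n` times its limit
up to `O(1)`, and the entropy of `η` relative to `f` on the words of length `n` is bounded in `n`.
Applied to `μ`, this is the set of `O(1)` estimates. As `f` is at most a multiple of `μ`,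
the entropy of `η` relative to `μ` is bounded too, so `η` is absolutely continuous with respect to `μ`
(`absolutelyContinuous_of_relEntropy_le`), and `η = μ` because `μ` is ergodic.
-/

namespace WeightedEquilibrium

noncomputable section

set_option linter.unusedSectionVars false

/-! ### Sums over words and push-forwards of word functions -/

section Words

variable {A B : Type*} [Finite A] [Finite B]

/-- All words of length `n` over the alphabet `A`. Functions on a language are extended by zero to
all words, so that sums over legal words become sums over `allWords`. -/
def allWords (A : Type*) [Finite A] (n : ℕ) : Finset (List A) :=
  (List.finite_length_eq A n).toFinset

@[simp] theorem mem_allWords {n : ℕ} {I : List A} : I ∈ allWords A n ↔ I.length = n := by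
  simp [allWords]

@[simp] theorem allWords_zero : allWords A 0 = {[]} := by
  ext I; simp

theorem sum_allWords_add {M : Type*} [AddCommMonoid M] (m n : ℕ) (F : List A → M) :
    ∑ W ∈ allWords A (m + n), F W = ∑ U ∈ allWords A m, ∑ V ∈ allWords A n, F (U ++ V) := by
  rw [← Finset.sum_product']
  refine Finset.sum_nbij' (fun W => (W.take m, W.drop m)) (fun P => P.1 ++ P.2) ?_ ?_ ?_ ?_ ?_
  · intro W hW
    simp only [mem_allWords] at hW
    simp [hW]
  · rintro ⟨U, V⟩ h
    simp only [Finset.mem_product, mem_allWords] at h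
    simp [h]
  · intro W _; simp
  · rintro ⟨U, V⟩ h
    simp only [Finset.mem_product, mem_allWords] at h
    simp [← h.1]
  · intro W _; simp

open Classical in
/-- The fibre of the word `J` under the map of letters `b`. -/
def fiber (b : A → B) (J : List B) : Finset (List A) :=
  (allWords A J.length).filter fun I => I.map b = J

@[simp] theorem mem_fiber {b : A → B} {J : List B} {I : List A} :
    I ∈ fiber b J ↔ I.map b = J := by
  simp only [fiber, Finset.mem_filter, mem_allWords, and_iff_right_iff_imp]
  rintro rfl
  simp

/-- The push-forward of a function on words under the map of letters `b`: the sum over the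
fibre. -/
def push (b : A → B) (g : List A → ℝ) (J : List B) : ℝ := ∑ I ∈ fiber b J, g I

theorem sum_fiber_allWords {M : Type*} [AddCommMonoid M] (b : A → B) (n : ℕ) (F : List A → M) :
    ∑ J ∈ allWords B n, ∑ I ∈ fiber b J, F I = ∑ I ∈ allWords A n, F I := by
  classical
  rw [← Finset.sum_fiberwise_of_maps_to (s := allWords A n) (t := allWords B n)
    (g := List.map b) (fun I hI => by simpa using hI)]
  refine Finset.sum_congr rfl fun J hJ => Finset.sum_congr ?_ fun _ _ => rfl
  ext I
  simp only [mem_fiber, Finset.mem_filter, mem_allWords, iff_and_self]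
  simp only [mem_allWords] at hJ
  rintro rfl
  simpa using hJ

theorem sum_mul_push (b : A → B) (n : ℕ) (G : List B → ℝ) (g : List A → ℝ) :
    ∑ J ∈ allWords B n, G J * push b g J = ∑ I ∈ allWords A n, G (I.map b) * g I := by
  rw [← sum_fiber_allWords b]
  refine Finset.sum_congr rfl fun J _ => ?_
  rw [push, Finset.mul_sum]
  refine Finset.sum_congr rfl fun I hI => ?_
  rw [mem_fiber.1 hI]

theorem sum_push (b : A → B) (n : ℕ) (g : List A → ℝ) :
    ∑ J ∈ allWords B n, push b g J = ∑ I ∈ allWords A n, g I := by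
  simpa using sum_mul_push b n (fun _ => 1) g

theorem sum_fiber_append {M : Type*} [AddCommMonoid M] (b : A → B) (J₁ J₂ : List B)
    (F : List A → M) :
    ∑ I ∈ fiber b (J₁ ++ J₂), F I = ∑ I₁ ∈ fiber b J₁, ∑ I₂ ∈ fiber b J₂, F (I₁ ++ I₂) := by
  rw [← Finset.sum_product']
  refine Finset.sum_nbij' (fun W => (W.take J₁.length, W.drop J₁.length)) (fun P => P.1 ++ P.2)
    ?_ ?_ ?_ ?_ ?_
  · intro W hW
    simp only [mem_fiber] at hW
    simp [List.map_take, List.map_drop, hW]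
  · rintro ⟨U, V⟩ h
    simp only [Finset.mem_product, mem_fiber] at h
    simp [h]
  · intro W _; simp
  · rintro ⟨U, V⟩ h
    simp only [Finset.mem_product, mem_fiber] at h
    simp [← h.1]
  · intro W _; simp

theorem push_append (b : A → B) (g : List A → ℝ) (J₁ J₂ : List B) :
    push b g (J₁ ++ J₂) = ∑ I₁ ∈ fiber b J₁, ∑ I₂ ∈ fiber b J₂, g (I₁ ++ I₂) :=
  sum_fiber_append b J₁ J₂ g

theorem push_nonneg (b : A → B) {g : List A → ℝ} (hg : ∀ I, 0 ≤ g I) (J : List B) :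
    0 ≤ push b g J := Finset.sum_nonneg fun I _ => hg I

theorem le_push_map (b : A → B) {g : List A → ℝ} (hg : ∀ I, 0 ≤ g I) (I : List A) :
    g I ≤ push b g (I.map b) :=
  Finset.single_le_sum (f := g) (fun I _ => hg I) (by simp)

/-- Summing a function of `U ++ V` over `V` commutes with pushing forward. -/
theorem sum_push_append_right (b : A → B) (g : List A → ℝ) (J : List B) (n : ℕ) :
    ∑ J' ∈ allWords B n, push b g (J ++ J') =
      push b (fun I => ∑ V ∈ allWords A n, g (I ++ V)) J := by
  simp_rw [push_append]
  rw [Finset.sum_comm, push]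
  exact Finset.sum_congr rfl fun I _ => sum_fiber_allWords b n fun V => g (I ++ V)

theorem sum_push_append_left (b : A → B) (g : List A → ℝ) (J : List B) (n : ℕ) :
    ∑ J' ∈ allWords B n, push b g (J' ++ J) =
      push b (fun I => ∑ U ∈ allWords A n, g (U ++ I)) J := by
  simp_rw [push_append]
  rw [sum_fiber_allWords b n fun U => ∑ I ∈ fiber b J, g (U ++ I), Finset.sum_comm]
  rfl

/-- Subadditivity of the power `κ ≤ 1`. -/
theorem rpow_sum_le {ι : Type*} (s : Finset ι) (F : ι → ℝ) (hF : ∀ i ∈ s, 0 ≤ F i) {κ : ℝ}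
    (h0 : 0 < κ) (h1 : κ ≤ 1) : (∑ i ∈ s, F i) ^ κ ≤ ∑ i ∈ s, F i ^ κ := by
  classical
  induction s using Finset.induction_on with
  | empty => simp [Real.zero_rpow h0.ne']
  | insert a s ha ih =>
    rw [Finset.sum_insert ha, Finset.sum_insert ha]
    have h2 := ih fun i hi => hF i (Finset.mem_insert_of_mem hi)
    have h3 := Real.rpow_add_le_add_rpow (hF a (Finset.mem_insert_self a s))
      (Finset.sum_nonneg fun i hi => hF i (Finset.mem_insert_of_mem hi)) h0.le h1
    linarith

end Words

/-! ### Quasi-multiplicative weights and their fibre sums -/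

/-- A nonnegative function on all words over `A` (zero outside some language) that is
quasi-multiplicative with constant `c`: submultiplicative up to `c`, and supermultiplicative up to
`c` after the insertion of a connecting word whose length lies in `S`. -/
structure GluingWeight {A : Type*} (S : Finset ℕ) (c : ℝ) (ψ : List A → ℝ) : Prop where
  nonneg : ∀ I, 0 ≤ ψ I
  exists_pos : ∃ I, I ≠ [] ∧ 0 < ψ I
  pos : 0 < c
  le_one : c ≤ 1
  submul : ∀ I J, c * ψ (I ++ J) ≤ ψ I * ψ J
  glue : ∀ I J, ∃ K : List A, K.length ∈ S ∧ c * (ψ I * ψ J) ≤ ψ (I ++ K ++ J)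

section Weights

variable {A B : Type*} [Finite A] [Finite B]

/-- `∑_J (∑_{π I = J} ψ(I))^κ` over the words `J` of length `n`. -/
def partitionSum (b : A → B) (κ : ℝ) (ψ : List A → ℝ) (n : ℕ) : ℝ :=
  ∑ J ∈ allWords B n, push b ψ J ^ κ

/-- The weight of `I` in the partition sum: the weights of the words in a fibre sum up to
`(∑_{π I = J} ψ(I))^κ`. -/
def fiberWeight (b : A → B) (κ : ℝ) (ψ : List A → ℝ) (I : List A) : ℝ :=
  ψ I * push b ψ (I.map b) ^ (κ - 1)

/-- The fibre weight, normalised to a probability on the words of each length. -/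
def wordProb (b : A → B) (κ : ℝ) (ψ : List A → ℝ) (I : List A) : ℝ :=
  fiberWeight b κ ψ I / partitionSum b κ ψ I.length

namespace GluingWeight

variable {S : Finset ℕ} {c : ℝ} {ψ : List A → ℝ}

theorem pos_of_append (h : GluingWeight S c ψ) {I J : List A} (hIJ : 0 < ψ (I ++ J)) :
    0 < ψ I ∧ 0 < ψ J := by
  have h1 := h.submul I J
  have h2 : 0 < ψ I * ψ J := lt_of_lt_of_le (mul_pos h.pos hIJ) h1
  exact ⟨(pos_iff_pos_of_mul_pos h2).2 (lt_of_le_of_ne (h.nonneg J) fun h0 => by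
      rw [← h0] at h2; simp at h2),
    (lt_of_le_of_ne (h.nonneg J) fun h0 => by rw [← h0] at h2; simp at h2)⟩

/-- Positive words of every length: glue copies of a positive word and take a prefix. -/
theorem exists_pos_length (h : GluingWeight S c ψ) (n : ℕ) :
    ∃ I : List A, I.length = n ∧ 0 < ψ I := by
  obtain ⟨I₀, hne, hpos⟩ := h.exists_pos
  have key : ∀ n : ℕ, ∃ I : List A, n ≤ I.length ∧ 0 < ψ I := by
    intro n
    induction n with
    | zero => exact ⟨I₀, Nat.zero_le _, hpos⟩
    | succ n ih =>
      obtain ⟨I, hI, hIp⟩ := ih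
      obtain ⟨K, _, hK⟩ := h.glue I₀ I
      refine ⟨I₀ ++ K ++ I, ?_, lt_of_lt_of_le (mul_pos h.pos (mul_pos hpos hIp)) hK⟩
      have := List.length_pos_of_ne_nil hne
      simp only [List.length_append]
      omega
  obtain ⟨I, hI, hIp⟩ := key n
  refine ⟨I.take n, by simp [hI], ?_⟩
  rw [← List.take_append_drop n I] at hIp
  exact (h.pos_of_append hIp).1

theorem nonempty_lengths (h : GluingWeight S c ψ) : S.Nonempty := by
  obtain ⟨K, hK, _⟩ := h.glue [] []
  exact ⟨_, hK⟩

theorem push_pos (h : GluingWeight S c ψ) (b : A → B) {I : List A} (hI : 0 < ψ I) :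
    0 < push b ψ (I.map b) := hI.trans_le (le_push_map b h.nonneg I)

/-- Fibre sums are submultiplicative, like the weight itself. -/
theorem push_submul (h : GluingWeight S c ψ) (b : A → B) (J₁ J₂ : List B) :
    c * push b ψ (J₁ ++ J₂) ≤ push b ψ J₁ * push b ψ J₂ := by
  rw [push_append, push, push, Finset.sum_mul_sum, Finset.mul_sum]
  refine Finset.sum_le_sum fun I₁ _ => ?_
  rw [Finset.mul_sum]
  exact Finset.sum_le_sum fun I₂ _ => h.submul I₁ I₂

/-- Gluing passes to the fibre sums, but the connecting word depends on the pair of words in the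
fibres, so all connecting words enter. -/
theorem push_glue (h : GluingWeight S c ψ) (b : A → B) (J₁ J₂ : List B) :
    c * (push b ψ J₁ * push b ψ J₂) ≤
      ∑ i ∈ S, ∑ K ∈ allWords A i, push b ψ (J₁ ++ K.map b ++ J₂) := by
  have h1 : ∀ I₁ I₂, c * (ψ I₁ * ψ I₂) ≤ ∑ i ∈ S, ∑ K ∈ allWords A i, ψ (I₁ ++ K ++ I₂) := by
    intro I₁ I₂
    obtain ⟨K, hK, hle⟩ := h.glue I₁ I₂
    refine hle.trans ?_
    refine le_trans ?_ (Finset.single_le_sum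
      (f := fun i => ∑ K ∈ allWords A i, ψ (I₁ ++ K ++ I₂))
      (fun i _ => Finset.sum_nonneg fun K _ => h.nonneg _) hK)
    exact Finset.single_le_sum (f := fun K => ψ (I₁ ++ K ++ I₂)) (fun K _ => h.nonneg _)
      (by simp)
  have h2 : ∀ K : List A, ∑ I₁ ∈ fiber b J₁, ∑ I₂ ∈ fiber b J₂, ψ (I₁ ++ K ++ I₂) ≤
      push b ψ (J₁ ++ K.map b ++ J₂) := by
    intro K
    rw [push_append, sum_fiber_append]
    refine Finset.sum_le_sum fun I₁ _ => ?_
    exact Finset.single_le_sum (f := fun K => ∑ I₂ ∈ fiber b J₂, ψ (I₁ ++ K ++ I₂))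
      (fun K _ => Finset.sum_nonneg fun _ _ => h.nonneg _) (by simp)
  calc c * (push b ψ J₁ * push b ψ J₂)
      = ∑ I₁ ∈ fiber b J₁, ∑ I₂ ∈ fiber b J₂, c * (ψ I₁ * ψ I₂) := by
        rw [push, push, Finset.sum_mul_sum]; simp_rw [Finset.mul_sum]
    _ ≤ ∑ I₁ ∈ fiber b J₁, ∑ I₂ ∈ fiber b J₂,
          ∑ i ∈ S, ∑ K ∈ allWords A i, ψ (I₁ ++ K ++ I₂) :=
        Finset.sum_le_sum fun I₁ _ => Finset.sum_le_sum fun I₂ _ => h1 I₁ I₂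
    _ = ∑ i ∈ S, ∑ K ∈ allWords A i,
          ∑ I₁ ∈ fiber b J₁, ∑ I₂ ∈ fiber b J₂, ψ (I₁ ++ K ++ I₂) := by
        rw [Finset.sum_congr rfl fun I₁ _ => Finset.sum_comm, Finset.sum_comm]
        refine Finset.sum_congr rfl fun i _ => ?_
        rw [Finset.sum_congr rfl fun I₁ _ => Finset.sum_comm, Finset.sum_comm]
    _ ≤ _ := Finset.sum_le_sum fun i _ => Finset.sum_le_sum fun K _ => h2 K

variable {κ : ℝ}

theorem partitionSum_pos (h : GluingWeight S c ψ) (b : A → B) (n : ℕ) :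
    0 < partitionSum b κ ψ n := by
  obtain ⟨I, hI, hpos⟩ := h.exists_pos_length n
  refine Finset.sum_pos' (fun J _ => Real.rpow_nonneg (push_nonneg b h.nonneg J) _)
    ⟨I.map b, by simp [hI], Real.rpow_pos_of_pos (h.push_pos b hpos) _⟩

/-- As `κ ≤ 1` and `c ≤ 1`, the constant `c ^ κ` can be replaced by the smaller `c`. -/
theorem partitionSum_submul (h : GluingWeight S c ψ) (b : A → B) (h0 : 0 < κ) (h1 : κ ≤ 1)
    (m n : ℕ) :
    c * partitionSum b κ ψ (m + n) ≤ partitionSum b κ ψ m * partitionSum b κ ψ n := by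
  rw [partitionSum, sum_allWords_add, partitionSum, partitionSum, Finset.sum_mul_sum,
    Finset.mul_sum]
  refine Finset.sum_le_sum fun J₁ _ => ?_
  rw [Finset.mul_sum]
  refine Finset.sum_le_sum fun J₂ _ => ?_
  rw [← Real.mul_rpow (push_nonneg b h.nonneg _) (push_nonneg b h.nonneg _)]
  have hc : c ≤ c ^ κ := by
    simpa using Real.rpow_le_rpow_of_exponent_ge h.pos h.le_one h1
  calc c * push b ψ (J₁ ++ J₂) ^ κ ≤ c ^ κ * push b ψ (J₁ ++ J₂) ^ κ :=
        mul_le_mul_of_nonneg_right hc (Real.rpow_nonneg (push_nonneg b h.nonneg _) _)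
    _ = (c * push b ψ (J₁ ++ J₂)) ^ κ := by
        rw [Real.mul_rpow h.pos.le (push_nonneg b h.nonneg _)]
    _ ≤ _ := Real.rpow_le_rpow (mul_nonneg h.pos.le (push_nonneg b h.nonneg _))
        (h.push_submul b J₁ J₂) h0.le

theorem sum_partitionSum_insert_le (h : GluingWeight S c ψ) (b : A → B) (m n i : ℕ)
    (K : List B) (hK : K.length = i) :
    ∑ J₁ ∈ allWords B m, ∑ J₂ ∈ allWords B n, push b ψ (J₁ ++ K ++ J₂) ^ κ ≤
      partitionSum b κ ψ (m + i + n) := by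
  rw [partitionSum, sum_allWords_add, sum_allWords_add]
  refine Finset.sum_le_sum fun J₁ _ => ?_
  exact Finset.single_le_sum
    (f := fun K => ∑ J₂ ∈ allWords B n, push b ψ (J₁ ++ K ++ J₂) ^ κ)
    (fun K _ => Finset.sum_nonneg fun _ _ => Real.rpow_nonneg (push_nonneg b h.nonneg _) _)
    (by simp [hK])

/-- Gluing gives `R m * R n` as a bound for the partition sums at the lengths `m + i + n`, `i ∈ S`;
submultiplicativity brings these back to the exact length `m + n`. -/
theorem partitionSum_supermul (h : GluingWeight S c ψ) (b : A → B) (h0 : 0 < κ) (h1 : κ ≤ 1) :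
    ∃ d : ℝ, 0 < d ∧ ∀ m n,
      d * (partitionSum b κ ψ m * partitionSum b κ ψ n) ≤ partitionSum b κ ψ (m + n) := by
  set R := partitionSum b κ ψ with hR
  have hRpos : ∀ n, 0 < R n := h.partitionSum_pos b
  set M := ∑ i ∈ S, ((allWords A i).card : ℝ) * (c⁻¹ * R i) with hM
  have hM0 : 0 ≤ M := Finset.sum_nonneg fun i _ =>
    mul_nonneg (Nat.cast_nonneg _) (mul_nonneg (inv_nonneg.2 h.pos.le) (hRpos i).le)
  have hZ := fun J => push_nonneg b h.nonneg J
  have main : ∀ m n, c ^ κ * (R m * R n) ≤ M * R (m + n) := by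
    intro m n
    calc c ^ κ * (R m * R n)
        = ∑ J₁ ∈ allWords B m, ∑ J₂ ∈ allWords B n,
            (c * (push b ψ J₁ * push b ψ J₂)) ^ κ := by
          rw [hR, partitionSum, partitionSum, Finset.sum_mul_sum, Finset.mul_sum]
          refine Finset.sum_congr rfl fun J₁ _ => ?_
          rw [Finset.mul_sum]
          refine Finset.sum_congr rfl fun J₂ _ => ?_
          rw [Real.mul_rpow h.pos.le (mul_nonneg (hZ _) (hZ _)), Real.mul_rpow (hZ _) (hZ _)]
      _ ≤ ∑ J₁ ∈ allWords B m, ∑ J₂ ∈ allWords B n, ∑ i ∈ S, ∑ K ∈ allWords A i,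
            push b ψ (J₁ ++ K.map b ++ J₂) ^ κ := by
          refine Finset.sum_le_sum fun J₁ _ => Finset.sum_le_sum fun J₂ _ => ?_
          refine (Real.rpow_le_rpow (mul_nonneg h.pos.le (mul_nonneg (hZ _) (hZ _)))
            (h.push_glue b J₁ J₂) h0.le).trans ?_
          refine (rpow_sum_le _ _ (fun i _ => Finset.sum_nonneg fun _ _ => hZ _) h0 h1).trans ?_
          exact Finset.sum_le_sum fun i _ => rpow_sum_le _ _ (fun _ _ => hZ _) h0 h1
      _ = ∑ i ∈ S, ∑ K ∈ allWords A i, ∑ J₁ ∈ allWords B m, ∑ J₂ ∈ allWords B n,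
            push b ψ (J₁ ++ K.map b ++ J₂) ^ κ := by
          rw [Finset.sum_congr rfl fun I₁ _ => Finset.sum_comm, Finset.sum_comm]
          refine Finset.sum_congr rfl fun i _ => ?_
          rw [Finset.sum_congr rfl fun I₁ _ => Finset.sum_comm, Finset.sum_comm]
      _ ≤ ∑ i ∈ S, ∑ K ∈ allWords A i, c⁻¹ * R i * R (m + n) := by
          refine Finset.sum_le_sum fun i _ => Finset.sum_le_sum fun K hK => ?_
          refine (h.sum_partitionSum_insert_le b m n i (K.map b)
            (by simpa using hK)).trans ?_
          have := h.partitionSum_submul b h0 h1 (m + n) i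
          rw [show m + i + n = m + n + i by ring, mul_assoc, le_inv_mul_iff₀ h.pos,
            mul_comm (partitionSum b κ ψ i)]
          exact this
      _ = M * R (m + n) := by
          rw [hM, Finset.sum_mul]
          refine Finset.sum_congr rfl fun i _ => ?_
          rw [Finset.sum_const, nsmul_eq_mul]; ring
  refine ⟨c ^ κ / (M + 1), div_pos (Real.rpow_pos_of_pos h.pos _) (by linarith), fun m n => ?_⟩
  rw [div_mul_eq_mul_div, div_le_iff₀ (by linarith)]
  nlinarith [main m n, hRpos (m + n)]

/-! ### The normalised word probabilities -/

theorem fiberWeight_nonneg (h : GluingWeight S c ψ) (b : A → B) (I : List A) :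
    0 ≤ fiberWeight b κ ψ I :=
  mul_nonneg (h.nonneg I) (Real.rpow_nonneg (push_nonneg b h.nonneg _) _)

theorem fiberWeight_pos_iff (h : GluingWeight S c ψ) (b : A → B) (I : List A) :
    0 < fiberWeight b κ ψ I ↔ 0 < ψ I := by
  refine ⟨fun h1 => lt_of_le_of_ne (h.nonneg I) fun h0 => ?_, fun h1 =>
    mul_pos h1 (Real.rpow_pos_of_pos (h.push_pos b h1) _)⟩
  simp [fiberWeight, ← h0] at h1

theorem push_fiberWeight (h : GluingWeight S c ψ) (b : A → B) (h0 : 0 < κ) (J : List B) :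
    push b (fiberWeight b κ ψ) J = push b ψ J ^ κ := by
  have : push b (fiberWeight b κ ψ) J = push b ψ J * push b ψ J ^ (κ - 1) := by
    rw [push, push, Finset.sum_mul]
    refine Finset.sum_congr rfl fun I hI => ?_
    rw [fiberWeight, mem_fiber.1 hI, push]
  rw [this]
  rcases (push_nonneg b h.nonneg J).eq_or_lt with hz | hz
  · rw [← hz, Real.zero_rpow h0.ne', zero_mul]
  · rw [Real.rpow_sub_one hz.ne']; field_simp

theorem sum_fiberWeight (h : GluingWeight S c ψ) (b : A → B) (h0 : 0 < κ) (n : ℕ) :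
    ∑ I ∈ allWords A n, fiberWeight b κ ψ I = partitionSum b κ ψ n := by
  rw [← sum_push b]
  exact Finset.sum_congr rfl fun J _ => h.push_fiberWeight b h0 J

theorem wordProb_nonneg (h : GluingWeight S c ψ) (b : A → B) (I : List A) :
    0 ≤ wordProb b κ ψ I :=
  div_nonneg (h.fiberWeight_nonneg b I) (h.partitionSum_pos b _).le

theorem wordProb_pos_iff (h : GluingWeight S c ψ) (b : A → B) (I : List A) :
    0 < wordProb b κ ψ I ↔ 0 < ψ I := by
  rw [← h.fiberWeight_pos_iff (κ := κ) b, wordProb, div_pos_iff_of_pos_right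
    (h.partitionSum_pos b _)]

theorem sum_wordProb (h : GluingWeight S c ψ) (b : A → B) (h0 : 0 < κ) (n : ℕ) :
    ∑ I ∈ allWords A n, wordProb b κ ψ I = 1 := by
  have : ∀ I ∈ allWords A n, wordProb b κ ψ I =
      fiberWeight b κ ψ I / partitionSum b κ ψ n := fun I hI => by
    rw [wordProb, mem_allWords.1 hI]
  rw [Finset.sum_congr rfl this, ← Finset.sum_div, h.sum_fiberWeight b h0,
    div_self (h.partitionSum_pos b n).ne']

/-- The weights `ψ` and their fibre sums are bounded on the finitely many words whose length is a
connector length. -/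
theorem exists_bound (h : GluingWeight S c ψ) (b : A → B) :
    ∃ M : ℝ, 1 ≤ M ∧ (∀ K : List A, K.length ∈ S → ψ K ≤ M) ∧
      (∀ K : List B, K.length ∈ S → push b ψ K ≤ M) ∧
      ∀ i ∈ S, partitionSum b κ ψ i ≤ M := by
  have hZ := fun J => push_nonneg b h.nonneg J
  have hR := fun n => (h.partitionSum_pos (κ := κ) b n).le
  have n1 : 0 ≤ ∑ i ∈ S, ∑ K ∈ allWords A i, ψ K :=
    Finset.sum_nonneg fun i _ => Finset.sum_nonneg fun K _ => h.nonneg K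
  have n2 : 0 ≤ ∑ i ∈ S, ∑ K ∈ allWords B i, push b ψ K :=
    Finset.sum_nonneg fun i _ => Finset.sum_nonneg fun K _ => hZ K
  have n3 : 0 ≤ ∑ i ∈ S, partitionSum b κ ψ i := Finset.sum_nonneg fun i _ => hR i
  refine ⟨1 + (∑ i ∈ S, ∑ K ∈ allWords A i, ψ K) + (∑ i ∈ S, ∑ K ∈ allWords B i, push b ψ K) +
    ∑ i ∈ S, partitionSum b κ ψ i, by linarith, fun K hK => ?_, fun K hK => ?_, fun i hi => ?_⟩
  · have e1 := Finset.single_le_sum (f := fun i => ∑ K ∈ allWords A i, ψ K)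
      (fun i _ => Finset.sum_nonneg fun K _ => h.nonneg K) hK
    have e2 := Finset.single_le_sum (f := ψ) (s := allWords A K.length)
      (fun K _ => h.nonneg K) (a := K) (by simp)
    linarith
  · have e1 := Finset.single_le_sum (f := fun i => ∑ K ∈ allWords B i, push b ψ K)
      (fun i _ => Finset.sum_nonneg fun K _ => hZ K) hK
    have e2 := Finset.single_le_sum (f := push b ψ) (s := allWords B K.length)
      (fun K _ => hZ K) (a := K) (by simp)
    linarith
  · have e1 := Finset.single_le_sum (f := fun i => partitionSum b κ ψ i) (fun i _ => hR i) hi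
    linarith

end GluingWeight

end Weights

/-! ### Gluing and extending words under the word probabilities -/

section Padding

variable {A : Type*} [Finite A]

/-- The sum of `F` over all words that contain `I` after `m` letters and before `n` letters. For
`F = wordProb` it is the probability that a random word of length `m + |I| + n` shows `I` at
position `m`. -/
def paddedSum (F : List A → ℝ) (m n : ℕ) (I : List A) : ℝ :=
  ∑ U ∈ allWords A m, ∑ V ∈ allWords A n, F (U ++ I ++ V)

theorem sum_paddedSum_append_right (F : List A → ℝ) (m n k : ℕ) (I : List A) :
    ∑ V ∈ allWords A k, paddedSum F m n (I ++ V) = paddedSum F m (k + n) I := by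
  simp only [paddedSum]
  rw [Finset.sum_comm]
  refine Finset.sum_congr rfl fun U _ => ?_
  rw [sum_allWords_add]
  simp only [List.append_assoc]

theorem sum_paddedSum_append_left (F : List A → ℝ) (m n k : ℕ) (I : List A) :
    ∑ V ∈ allWords A k, paddedSum F m n (V ++ I) = paddedSum F (m + k) n I := by
  simp only [paddedSum]
  rw [sum_allWords_add, Finset.sum_comm]
  simp only [List.append_assoc]

theorem paddedSum_nil (F : List A → ℝ) (m n : ℕ) :
    paddedSum F m n [] = ∑ W ∈ allWords A (m + n), F W := by
  rw [sum_allWords_add]; simp [paddedSum]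

theorem paddedSum_zero_zero (F : List A → ℝ) (I : List A) : paddedSum F 0 0 I = F I := by
  simp [paddedSum]

theorem paddedSum_nonneg {F : List A → ℝ} (hF : ∀ I, 0 ≤ F I) (m n : ℕ) (I : List A) :
    0 ≤ paddedSum F m n I :=
  Finset.sum_nonneg fun _ _ => Finset.sum_nonneg fun _ _ => hF _

theorem sum_paddedSum (F : List A → ℝ) (m n k : ℕ) :
    ∑ I ∈ allWords A k, paddedSum F m n I = ∑ W ∈ allWords A (m + (k + n)), F W := by
  rw [← paddedSum_nil, ← sum_paddedSum_append_right]
  simp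

end Padding

namespace GluingWeight

variable {A B : Type*} [Finite A] [Finite B] {S : Finset ℕ} {c κ : ℝ} {ψ : List A → ℝ}

/-- The exponent `κ - 1` of the fibre sum in `fiberWeight` is nonpositive, so upper bounds for
fibre sums give lower bounds for fibre weights. -/
theorem le_fiberWeight (h : GluingWeight S c ψ) (b : A → B) (h1 : κ ≤ 1) {W I J : List A}
    {a E : ℝ} (ha : 0 < a) (hE : 0 < E) (hψ : a * (ψ I * ψ J) ≤ ψ W)
    (hZ : 0 < ψ I → 0 < ψ J →
      push b ψ (W.map b) ≤ E * (push b ψ (I.map b) * push b ψ (J.map b))) :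
    a * E ^ (κ - 1) * (fiberWeight b κ ψ I * fiberWeight b κ ψ J) ≤ fiberWeight b κ ψ W := by
  rcases (h.nonneg I).eq_or_lt with hI | hI
  · simp [fiberWeight, ← hI]
    exact h.fiberWeight_nonneg b W
  rcases (h.nonneg J).eq_or_lt with hJ | hJ
  · simp [fiberWeight, ← hJ]
    exact h.fiberWeight_nonneg b W
  have hW : 0 < ψ W := lt_of_lt_of_le (mul_pos ha (mul_pos hI hJ)) hψ
  have hp := Real.rpow_le_rpow_of_nonpos (h.push_pos b hW) (hZ hI hJ) (sub_nonpos.2 h1)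
  rw [Real.mul_rpow hE.le (mul_nonneg (push_nonneg b h.nonneg _) (push_nonneg b h.nonneg _)),
    Real.mul_rpow (push_nonneg b h.nonneg _) (push_nonneg b h.nonneg _)] at hp
  calc _ = (a * (ψ I * ψ J)) * (E ^ (κ - 1) *
        (push b ψ (I.map b) ^ (κ - 1) * push b ψ (J.map b) ^ (κ - 1))) := by
        simp only [fiberWeight]; ring
    _ ≤ ψ W * push b ψ (W.map b) ^ (κ - 1) :=
        mul_le_mul hψ hp (mul_nonneg (Real.rpow_nonneg hE.le _)
          (mul_nonneg (Real.rpow_nonneg (push_nonneg b h.nonneg _) _)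
            (Real.rpow_nonneg (push_nonneg b h.nonneg _) _))) (h.nonneg W)
    _ = _ := rfl

/-- The word probabilities inherit the gluing property. They are in general not submultiplicative,
not even up to a constant. -/
theorem wordProb_glue (h : GluingWeight S c ψ) (b : A → B) (h0 : 0 < κ) (h1 : κ ≤ 1) :
    ∃ d : ℝ, 0 < d ∧ ∀ I J, ∃ K : List A, K.length ∈ S ∧
      d * (wordProb b κ ψ I * wordProb b κ ψ J) ≤ wordProb b κ ψ (I ++ K ++ J) := by
  obtain ⟨M, hM1, -, hMZ, hMR⟩ := h.exists_bound (κ := κ) b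
  have hM : 0 < M := by linarith
  have hc := h.pos
  set E := (c * c)⁻¹ * M with hEdef
  have hE : 0 < E := by positivity
  have hEi : c * c * E = M := by rw [hEdef]; field_simp
  refine ⟨c * E ^ (κ - 1) / E, div_pos (mul_pos hc (Real.rpow_pos_of_pos hE _)) hE,
    fun I J => ?_⟩
  obtain ⟨K, hK, hle⟩ := h.glue I J
  refine ⟨K, hK, ?_⟩
  have hR := fun n => h.partitionSum_pos (κ := κ) b n
  have hZn := fun J => push_nonneg b h.nonneg J
  have hZ : push b ψ ((I ++ K ++ J).map b) ≤ E * (push b ψ (I.map b) * push b ψ (J.map b)) := by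
    rw [List.map_append, List.map_append]
    have e1 := h.push_submul b (I.map b ++ K.map b) (J.map b)
    have e2 := h.push_submul b (I.map b) (K.map b)
    have e3 := hMZ (K.map b) (by simpa using hK)
    have e4 : c * (c * push b ψ (I.map b ++ K.map b ++ J.map b)) ≤
        c * c * E * (push b ψ (I.map b) * push b ψ (J.map b)) := by
      rw [hEi]
      calc _ ≤ c * (push b ψ (I.map b ++ K.map b) * push b ψ (J.map b)) := by gcongr
        _ = (c * push b ψ (I.map b ++ K.map b)) * push b ψ (J.map b) := by ring
        _ ≤ (push b ψ (I.map b) * M) * push b ψ (J.map b) := by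
            refine mul_le_mul_of_nonneg_right (e2.trans ?_) (hZn _)
            exact mul_le_mul_of_nonneg_left e3 (hZn _)
        _ = _ := by ring
    have e5 : 0 < c * c := by positivity
    refine le_of_mul_le_mul_left ?_ e5
    calc _ = c * (c * push b ψ (I.map b ++ K.map b ++ J.map b)) := by ring
      _ ≤ _ := e4
      _ = _ := by ring
  have hw := h.le_fiberWeight b h1 (W := I ++ K ++ J) hc hE hle fun _ _ => hZ
  have hRle : partitionSum b κ ψ (I ++ K ++ J).length ≤
      E * (partitionSum b κ ψ I.length * partitionSum b κ ψ J.length) := by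
    rw [List.length_append, List.length_append]
    have e1 := h.partitionSum_submul b h0 h1 (I.length + K.length) J.length
    have e2 := h.partitionSum_submul b h0 h1 I.length K.length
    have e3 := hMR _ hK
    have e5 : 0 < c * c := by positivity
    refine le_of_mul_le_mul_left ?_ e5
    calc _ = c * (c * partitionSum b κ ψ (I.length + K.length + J.length)) := by ring
      _ ≤ c * (partitionSum b κ ψ (I.length + K.length) * partitionSum b κ ψ J.length) := by
          gcongr
      _ = (c * partitionSum b κ ψ (I.length + K.length)) * partitionSum b κ ψ J.length := by ring
      _ ≤ (partitionSum b κ ψ I.length * M) * partitionSum b κ ψ J.length := by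
          refine mul_le_mul_of_nonneg_right (e2.trans ?_) (hR _).le
          exact mul_le_mul_of_nonneg_left e3 (hR _).le
      _ = c * c * E * (partitionSum b κ ψ I.length * partitionSum b κ ψ J.length) := by
          rw [hEi]; ring
      _ = _ := by ring
  simp only [wordProb]
  rw [le_div_iff₀ (hR _)]
  have hI := hR I.length
  have hJ := hR J.length
  have hq : 0 ≤ c * E ^ (κ - 1) / E * (fiberWeight b κ ψ I / partitionSum b κ ψ I.length *
      (fiberWeight b κ ψ J / partitionSum b κ ψ J.length)) := by
    have := h.fiberWeight_nonneg (κ := κ) b I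
    have := h.fiberWeight_nonneg (κ := κ) b J
    have := (Real.rpow_pos_of_pos hE (κ - 1)).le
    positivity
  refine (mul_le_mul_of_nonneg_left hRle hq).trans (le_trans (le_of_eq ?_) hw)
  field_simp

/-- The total weight of the words whose fibre sum drops by a factor less than `ε` when the last `i`
letters are appended is of order `ε ^ κ`. -/
theorem sum_fiberWeight_drop_le (h : GluingWeight S c ψ) (b : A → B) (h0 : 0 < κ)
    {k i : ℕ} (hik : i ≤ k) {ε : ℝ} (hε : 0 < ε) :
    (∑ V ∈ allWords A k, open Classical in
      if push b ψ (V.map b) < ε * push b ψ ((V.map b).take (k - i)) then fiberWeight b κ ψ V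
        else 0) ≤
      ε ^ κ * ((allWords B i).card * partitionSum b κ ψ (k - i)) := by
  classical
  have hZn := fun J => push_nonneg b h.nonneg J
  rw [← sum_fiber_allWords b]
  have e1 : ∀ J ∈ allWords B k, (∑ V ∈ fiber b J,
      if push b ψ (V.map b) < ε * push b ψ ((V.map b).take (k - i)) then fiberWeight b κ ψ V
        else 0) ≤ ε ^ κ * push b ψ (J.take (k - i)) ^ κ := by
    intro J _
    have e2 : (∑ V ∈ fiber b J,
      if push b ψ (V.map b) < ε * push b ψ ((V.map b).take (k - i)) then fiberWeight b κ ψ V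
        else 0) = if push b ψ J < ε * push b ψ (J.take (k - i)) then push b ψ J ^ κ else 0 := by
      split_ifs with hc
      · rw [← h.push_fiberWeight b h0 J, push]
        refine Finset.sum_congr rfl fun V hV => ?_
        rw [mem_fiber.1 hV, if_pos hc]
      · refine Finset.sum_eq_zero fun V hV => ?_
        rw [mem_fiber.1 hV, if_neg hc]
    rw [e2, ← Real.mul_rpow hε.le (hZn _)]
    split_ifs with hc
    · exact Real.rpow_le_rpow (hZn _) hc.le h0.le
    · exact Real.rpow_nonneg (mul_nonneg hε.le (hZn _)) _
  refine (Finset.sum_le_sum e1).trans (le_of_eq ?_)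
  rw [← Finset.mul_sum]
  congr 1
  conv_lhs => rw [show k = k - i + i by omega]
  rw [sum_allWords_add, partitionSum, Finset.mul_sum]
  refine Finset.sum_congr rfl fun U hU => ?_
  rw [← nsmul_eq_mul, ← Finset.sum_const]
  refine Finset.sum_congr rfl fun V _ => ?_
  rw [mem_allWords] at hU
  rw [show k - i + i - i = U.length by omega, List.take_left]

/-- At least half of the total weight is carried by words whose fibre sum stays comparable when
some of the last letters, in a number from `S`, are removed. -/
theorem exists_half_weight (h : GluingWeight S c ψ) (b : A → B) (h0 : 0 < κ) (h1 : κ ≤ 1) :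
    ∃ ε : ℝ, 0 < ε ∧ ∀ k, (∀ i ∈ S, i ≤ k) →
      partitionSum b κ ψ k / 2 ≤ ∑ V ∈ allWords A k, open Classical in
        if ∀ i ∈ S, ε * push b ψ ((V.map b).take (k - i)) ≤ push b ψ (V.map b)
          then fiberWeight b κ ψ V else 0 := by
  classical
  obtain ⟨d, hd, hsup⟩ := h.partitionSum_supermul (κ := κ) b h0 h1
  have hR := fun n => h.partitionSum_pos (κ := κ) b n
  set T := ∑ i ∈ S, ((allWords B i).card : ℝ) / (d * partitionSum b κ ψ i) with hT
  have hT0 : 0 ≤ T := Finset.sum_nonneg fun i _ =>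
    div_nonneg (Nat.cast_nonneg _) (mul_pos hd (hR i)).le
  -- the words excluded by one `i` have total weight at most `ε ^ κ` times a summand of `T`
  set δ : ℝ := (2 * (T + 1))⁻¹ with hδ
  have hδ0 : 0 < δ := inv_pos.2 (by linarith)
  refine ⟨δ ^ (1 / κ), Real.rpow_pos_of_pos hδ0 _, fun k hk => ?_⟩
  set ε := δ ^ (1 / κ) with hεdef
  have hε : 0 < ε := Real.rpow_pos_of_pos hδ0 _
  have hεκ : ε ^ κ = δ := by
    rw [hεdef, ← Real.rpow_mul hδ0.le, one_div, inv_mul_cancel₀ h0.ne', Real.rpow_one]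
  have split : ∀ V ∈ allWords A k, fiberWeight b κ ψ V ≤
      (if ∀ i ∈ S, ε * push b ψ ((V.map b).take (k - i)) ≤ push b ψ (V.map b)
          then fiberWeight b κ ψ V else 0) +
      ∑ i ∈ S, if push b ψ (V.map b) < ε * push b ψ ((V.map b).take (k - i))
        then fiberWeight b κ ψ V else 0 := by
    intro V _
    have hnn : ∀ i ∈ S, 0 ≤ if push b ψ (V.map b) < ε * push b ψ ((V.map b).take (k - i))
        then fiberWeight b κ ψ V else 0 := fun i _ => by
      split_ifs
      · exact h.fiberWeight_nonneg b V
      · exact le_rfl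
    by_cases hg : ∀ i ∈ S, ε * push b ψ ((V.map b).take (k - i)) ≤ push b ψ (V.map b)
    · rw [if_pos hg]
      linarith [Finset.sum_nonneg hnn]
    · rw [if_neg hg, zero_add]
      push Not at hg
      obtain ⟨i, hi, hlt⟩ := hg
      refine le_trans (le_of_eq ?_) (Finset.single_le_sum hnn hi)
      rw [if_pos hlt]
  have hsum := Finset.sum_le_sum split
  rw [h.sum_fiberWeight b h0, Finset.sum_add_distrib, Finset.sum_comm] at hsum
  have hbad : ∑ i ∈ S, ∑ V ∈ allWords A k,
      (if push b ψ (V.map b) < ε * push b ψ ((V.map b).take (k - i))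
        then fiberWeight b κ ψ V else 0) ≤ partitionSum b κ ψ k / 2 := by
    calc _ ≤ ∑ i ∈ S, δ * (((allWords B i).card : ℝ) / (d * partitionSum b κ ψ i) *
              partitionSum b κ ψ k) := by
          refine Finset.sum_le_sum fun i hi => ?_
          refine (h.sum_fiberWeight_drop_le b h0 (hk i hi) hε).trans ?_
          rw [hεκ]
          refine mul_le_mul_of_nonneg_left ?_ hδ0.le
          rw [div_mul_eq_mul_div, mul_div_assoc]
          refine mul_le_mul_of_nonneg_left ?_ (Nat.cast_nonneg _)
          rw [le_div_iff₀ (mul_pos hd (hR i))]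
          have := hsup (k - i) i
          rw [Nat.sub_add_cancel (hk i hi)] at this
          linarith
      _ = δ * T * partitionSum b κ ψ k := by
          rw [hT, ← Finset.mul_sum, ← Finset.sum_mul]; ring
      _ ≤ partitionSum b κ ψ k / 2 := by
          rw [div_eq_mul_inv, mul_comm]
          refine mul_le_mul_of_nonneg_left ?_ (hR k).le
          rw [hδ, mul_inv, mul_assoc]
          refine mul_le_of_le_one_right (by norm_num) ?_
          rw [inv_mul_le_iff₀ (by linarith)]
          linarith
  linarith

/-- If the fibre sum of `V` stays comparable under truncation, the word obtained by gluing `V` to `W`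
and truncating to the length `|W| + |V|` has at least a constant times the product of the weights. -/
theorem exists_append_weight (h : GluingWeight S c ψ) (b : A → B) (h1 : κ ≤ 1)
    {ε : ℝ} (hε : 0 < ε) :
    ∃ d : ℝ, 0 < d ∧ ∀ k, (∀ i ∈ S, i ≤ k) → ∀ W V : List A, V.length = k →
      (∀ i ∈ S, ε * push b ψ ((V.map b).take (k - i)) ≤ push b ψ (V.map b)) →
      d * (fiberWeight b κ ψ W * fiberWeight b κ ψ V) ≤
        ∑ i ∈ S, ∑ K ∈ allWords A i, fiberWeight b κ ψ (W ++ (K ++ V.take (k - i))) := by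
  obtain ⟨M, hM1, hMψ, hMZ, -⟩ := h.exists_bound (κ := κ) b
  have hM : 0 < M := by linarith
  have hc := h.pos
  have hZn := fun J => push_nonneg b h.nonneg J
  set a := c * c / M with hadef
  have ha : 0 < a := by positivity
  set E := (c * c)⁻¹ * M * ε⁻¹ with hEdef
  have hE : 0 < E := by positivity
  refine ⟨a * E ^ (κ - 1), mul_pos ha (Real.rpow_pos_of_pos hE _), fun k hk W V hV hgood => ?_⟩
  obtain ⟨K, hK, hle⟩ := h.glue W V
  have hik := hk _ hK
  set V₁ := V.take (k - K.length) with hV₁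
  set V₂ := V.drop (k - K.length) with hV₂
  have hVV : V = V₁ ++ V₂ := (List.take_append_drop _ _).symm
  have hV₂l : V₂.length = K.length := by rw [hV₂, List.length_drop, hV]; omega
  have hψ : a * (ψ W * ψ V) ≤ ψ (W ++ (K ++ V₁)) := by
    have e1 := h.submul (W ++ (K ++ V₁)) V₂
    have e2 : W ++ (K ++ V₁) ++ V₂ = W ++ K ++ V := by rw [hVV]; simp
    rw [e2] at e1
    have e3 := hMψ V₂ (hV₂l ▸ hK)
    rw [hadef, div_mul_eq_mul_div, div_le_iff₀ hM]
    calc c * c * (ψ W * ψ V) = c * (c * (ψ W * ψ V)) := by ring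
      _ ≤ c * ψ (W ++ K ++ V) := mul_le_mul_of_nonneg_left hle hc.le
      _ ≤ _ := e1
      _ ≤ _ := mul_le_mul_of_nonneg_left e3 (h.nonneg _)
  have hZ : push b ψ ((W ++ (K ++ V₁)).map b) ≤
      E * (push b ψ (W.map b) * push b ψ (V.map b)) := by
    rw [List.map_append, List.map_append]
    have e1 := h.push_submul b (W.map b) (K.map b ++ V₁.map b)
    have e2 := h.push_submul b (K.map b) (V₁.map b)
    have e3 := hMZ (K.map b) (by simpa using hK)
    have e4 := hgood _ hK
    rw [← List.map_take, ← hV₁] at e4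
    have e5 : 0 < c * c := by positivity
    refine le_of_mul_le_mul_left ?_ e5
    calc c * c * push b ψ (W.map b ++ (K.map b ++ V₁.map b))
        = c * (c * push b ψ (W.map b ++ (K.map b ++ V₁.map b))) := by ring
      _ ≤ c * (push b ψ (W.map b) * push b ψ (K.map b ++ V₁.map b)) := by gcongr
      _ = push b ψ (W.map b) * (c * push b ψ (K.map b ++ V₁.map b)) := by ring
      _ ≤ push b ψ (W.map b) * (M * (ε⁻¹ * push b ψ (V.map b))) := by
          refine mul_le_mul_of_nonneg_left (e2.trans ?_) (hZn _)
          refine mul_le_mul e3 ?_ (hZn _) hM.le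
          rwa [le_inv_mul_iff₀ hε]
      _ = _ := by rw [hEdef]; field_simp
  refine (h.le_fiberWeight b h1 ha hE hψ fun _ _ => hZ).trans ?_
  have hw := fun I => h.fiberWeight_nonneg (κ := κ) b I
  refine le_trans ?_ (Finset.single_le_sum
    (f := fun i => ∑ K ∈ allWords A i, fiberWeight b κ ψ (W ++ (K ++ V.take (k - i))))
    (fun i _ => Finset.sum_nonneg fun K _ => hw _) hK)
  exact Finset.single_le_sum
    (f := fun K' => fiberWeight b κ ψ (W ++ (K' ++ V.take (k - K.length))))
    (fun K _ => hw _) (by simp)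

/-- The words of length `|W| + k` that extend `W` have, up to a constant, at least the probability
of `W`. Gluing alone gives this only for one of the lengths `k + i`, `i ∈ S`; to reach the exact
length, the glued word is truncated, which is harmless unless the fibre sum increases much, and that
happens only with small probability. -/
theorem sum_wordProb_append_ge (h : GluingWeight S c ψ) (b : A → B) (h0 : 0 < κ) (h1 : κ ≤ 1) :
    ∃ d : ℝ, 0 < d ∧ ∀ k, (∀ i ∈ S, i ≤ k) → ∀ W : List A,
      d * wordProb b κ ψ W ≤ ∑ V ∈ allWords A k, wordProb b κ ψ (W ++ V) := by
  classical
  obtain ⟨ε, hε, hhalf⟩ := h.exists_half_weight b h0 h1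
  obtain ⟨d, hd, happ⟩ := h.exists_append_weight (κ := κ) b h1 hε
  have hR := fun n => h.partitionSum_pos (κ := κ) b n
  have hw := fun I => h.fiberWeight_nonneg (κ := κ) b I
  have hc := h.pos
  set Q : ℝ := ∑ i ∈ S, ((allWords A i).card : ℝ) with hQ
  have hQ0 : 0 ≤ Q := Finset.sum_nonneg fun _ _ => Nat.cast_nonneg _
  refine ⟨c * d / (2 * (Q + 1)), div_pos (mul_pos hc hd) (by linarith), fun k hk W => ?_⟩
  have step : d * fiberWeight b κ ψ W * (partitionSum b κ ψ k / 2) ≤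
      Q * ∑ U ∈ allWords A k, fiberWeight b κ ψ (W ++ U) := by
    calc d * fiberWeight b κ ψ W * (partitionSum b κ ψ k / 2)
        ≤ d * fiberWeight b κ ψ W * ∑ V ∈ allWords A k,
          if ∀ i ∈ S, ε * push b ψ ((V.map b).take (k - i)) ≤ push b ψ (V.map b)
          then fiberWeight b κ ψ V else 0 :=
          mul_le_mul_of_nonneg_left (hhalf k hk) (mul_nonneg hd.le (hw W))
      _ ≤ ∑ V ∈ allWords A k, ∑ i ∈ S, ∑ K ∈ allWords A i,
            fiberWeight b κ ψ (W ++ (K ++ V.take (k - i))) := by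
          rw [Finset.mul_sum]
          refine Finset.sum_le_sum fun V hV => ?_
          split_ifs with hg
          · rw [mul_assoc]
            exact happ k hk W V (mem_allWords.1 hV) hg
          · rw [mul_zero]
            exact Finset.sum_nonneg fun i _ => Finset.sum_nonneg fun K _ => hw _
      _ = ∑ i ∈ S, ((allWords A i).card : ℝ) *
            ∑ U ∈ allWords A k, fiberWeight b κ ψ (W ++ U) := by
          rw [Finset.sum_comm]
          refine Finset.sum_congr rfl fun i hi => ?_
          have hik := hk i hi
          rw [← nsmul_eq_mul, ← Finset.sum_const]
          conv_rhs => rw [Finset.sum_comm]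
          conv_lhs => rw [show k = k - i + i by omega]
          conv_rhs => rw [show k = i + (k - i) by omega]
          rw [sum_allWords_add, sum_allWords_add, Finset.sum_comm]
          conv_rhs => rw [Finset.sum_congr rfl fun K _ => Finset.sum_comm, Finset.sum_comm]
          refine Finset.sum_congr rfl fun V₂ _ => ?_
          rw [Finset.sum_comm]
          refine Finset.sum_congr rfl fun K _ => ?_
          refine Finset.sum_congr rfl fun V₁ hV₁ => ?_
          rw [mem_allWords] at hV₁
          rw [show k - i + i - i = V₁.length by omega, List.take_left]
      _ = _ := by rw [hQ, Finset.sum_mul]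
  have hsum : ∑ V ∈ allWords A k, wordProb b κ ψ (W ++ V) =
      (∑ V ∈ allWords A k, fiberWeight b κ ψ (W ++ V)) / partitionSum b κ ψ (W.length + k) := by
    rw [Finset.sum_div]
    refine Finset.sum_congr rfl fun V hV => ?_
    rw [wordProb, List.length_append, mem_allWords.1 hV]
  rw [hsum, le_div_iff₀ (hR _), wordProb]
  have e1 := h.partitionSum_submul b h0 h1 W.length k
  set X := ∑ U ∈ allWords A k, fiberWeight b κ ψ (W ++ U) with hX
  have hX0 : 0 ≤ X := Finset.sum_nonneg fun _ _ => hw _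
  have hRW := hR W.length
  have hRk := hR k
  have hwW := hw W
  calc c * d / (2 * (Q + 1)) * (fiberWeight b κ ψ W / partitionSum b κ ψ W.length) *
        partitionSum b κ ψ (W.length + k)
      = d / (2 * (Q + 1)) * (fiberWeight b κ ψ W / partitionSum b κ ψ W.length) *
        (c * partitionSum b κ ψ (W.length + k)) := by ring
    _ ≤ d / (2 * (Q + 1)) * (fiberWeight b κ ψ W / partitionSum b κ ψ W.length) *
        (partitionSum b κ ψ W.length * partitionSum b κ ψ k) := by
        exact mul_le_mul_of_nonneg_left e1
          (mul_nonneg (div_nonneg hd.le (by linarith)) (div_nonneg hwW hRW.le))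
    _ = (d * fiberWeight b κ ψ W * (partitionSum b κ ψ k / 2)) / (Q + 1) := by field_simp
    _ ≤ Q * X / (Q + 1) := div_le_div_of_nonneg_right step (by linarith)
    _ ≤ X := by rw [div_le_iff₀ (by linarith)]; nlinarith

theorem paddedSum_le_one (h : GluingWeight S c ψ) (b : A → B) (h0 : 0 < κ) (m n : ℕ)
    (I : List A) : paddedSum (wordProb b κ ψ) m n I ≤ 1 := by
  rw [← h.sum_wordProb b h0 (m + (I.length + n)), ← sum_paddedSum]
  exact Finset.single_le_sum (f := paddedSum (wordProb b κ ψ) m n)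
    (fun I _ => paddedSum_nonneg (h.wordProb_nonneg b) m n I) (by simp)

/-- Lengthening the right margin by at least `max S` loses at most a constant factor. -/
theorem paddedSum_extend (h : GluingWeight S c ψ) (b : A → B) (h0 : 0 < κ) (h1 : κ ≤ 1) :
    ∃ d : ℝ, 0 < d ∧ ∀ k, (∀ i ∈ S, i ≤ k) → ∀ m n I,
      d * paddedSum (wordProb b κ ψ) m n I ≤ paddedSum (wordProb b κ ψ) m (n + k) I := by
  obtain ⟨d, hd, hle⟩ := h.sum_wordProb_append_ge b h0 h1
  refine ⟨d, hd, fun k hk m n I => ?_⟩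
  simp only [paddedSum, Finset.mul_sum]
  refine Finset.sum_le_sum fun U _ => ?_
  rw [sum_allWords_add]
  refine Finset.sum_le_sum fun V _ => ?_
  simpa only [List.append_assoc] using hle k hk (U ++ I ++ V)

/-- Gluing, summed over all margins. -/
theorem paddedSum_glue (h : GluingWeight S c ψ) (b : A → B) (h0 : 0 < κ) (h1 : κ ≤ 1) :
    ∃ d : ℝ, 0 < d ∧ ∀ m n m' n' I J,
      d * (paddedSum (wordProb b κ ψ) m n I * paddedSum (wordProb b κ ψ) m' n' J) ≤
        ∑ i ∈ S, ∑ V ∈ allWords A (n + i + m'),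
          paddedSum (wordProb b κ ψ) m n' (I ++ V ++ J) := by
  obtain ⟨d, hd, hglue⟩ := h.wordProb_glue b h0 h1
  refine ⟨d, hd, fun m n m' n' I J => ?_⟩
  set f := wordProb b κ ψ with hf
  have hf0 : ∀ I, 0 ≤ f I := h.wordProb_nonneg b
  have h2 : ∀ P Q, d * (f P * f Q) ≤ ∑ i ∈ S, ∑ K ∈ allWords A i, f (P ++ K ++ Q) := by
    intro P Q
    obtain ⟨K, hK, hle⟩ := hglue P Q
    refine hle.trans ?_
    refine le_trans ?_ (Finset.single_le_sum
      (f := fun i => ∑ K ∈ allWords A i, f (P ++ K ++ Q))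
      (fun i _ => Finset.sum_nonneg fun K _ => hf0 _) hK)
    exact Finset.single_le_sum (f := fun K => f (P ++ K ++ Q)) (fun K _ => hf0 _) (by simp)
  calc d * (paddedSum f m n I * paddedSum f m' n' J)
      = ∑ U ∈ allWords A m, ∑ V ∈ allWords A n, ∑ U' ∈ allWords A m', ∑ V' ∈ allWords A n',
          d * (f (U ++ I ++ V) * f (U' ++ J ++ V')) := by
        simp only [paddedSum, Finset.sum_mul]
        simp only [Finset.mul_sum]
    _ ≤ ∑ U ∈ allWords A m, ∑ V ∈ allWords A n, ∑ U' ∈ allWords A m', ∑ V' ∈ allWords A n',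
          ∑ i ∈ S, ∑ K ∈ allWords A i, f (U ++ I ++ V ++ K ++ (U' ++ J ++ V')) :=
        Finset.sum_le_sum fun U _ => Finset.sum_le_sum fun V _ => Finset.sum_le_sum fun U' _ =>
          Finset.sum_le_sum fun V' _ => h2 _ _
    _ = ∑ i ∈ S, ∑ U ∈ allWords A m, ∑ V ∈ allWords A n, ∑ U' ∈ allWords A m',
          ∑ V' ∈ allWords A n', ∑ K ∈ allWords A i,
            f (U ++ I ++ V ++ K ++ (U' ++ J ++ V')) := by
        symm
        rw [Finset.sum_comm]
        refine Finset.sum_congr rfl fun U _ => ?_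
        rw [Finset.sum_comm]
        refine Finset.sum_congr rfl fun V _ => ?_
        rw [Finset.sum_comm]
        refine Finset.sum_congr rfl fun U' _ => ?_
        rw [Finset.sum_comm]
    _ = ∑ i ∈ S, ∑ V ∈ allWords A (n + i + m'), paddedSum f m n' (I ++ V ++ J) := by
        refine Finset.sum_congr rfl fun i _ => ?_
        simp only [paddedSum, sum_allWords_add]
        symm
        rw [Finset.sum_congr rfl fun V _ => Finset.sum_congr rfl fun K _ => Finset.sum_comm,
          Finset.sum_congr rfl fun V _ => Finset.sum_comm, Finset.sum_comm]
        refine Finset.sum_congr rfl fun U _ => Finset.sum_congr rfl fun V _ => ?_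
        rw [Finset.sum_comm]
        refine Finset.sum_congr rfl fun U' _ => ?_
        rw [Finset.sum_comm]
        refine Finset.sum_congr rfl fun V' _ => Finset.sum_congr rfl fun K _ => ?_
        simp only [List.append_assoc]

/-- Enlarging the left margin to a prescribed length, up to a length from `S`, loses at most a
constant factor: glue an arbitrary word in front. -/
theorem paddedSum_shift (h : GluingWeight S c ψ) (b : A → B) (h0 : 0 < κ) (h1 : κ ≤ 1) :
    ∃ d : ℝ, 0 < d ∧ ∀ m n M I, m ≤ M →
      d * paddedSum (wordProb b κ ψ) m n I ≤
        ∑ i ∈ S, paddedSum (wordProb b κ ψ) (M + i) n I := by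
  obtain ⟨d, hd, hglue⟩ := h.paddedSum_glue b h0 h1
  refine ⟨d, hd, fun m n M I hm => ?_⟩
  have := hglue 0 (M - m) m n [] I
  rw [paddedSum_nil, h.sum_wordProb b h0, one_mul] at this
  refine this.trans (le_of_eq (Finset.sum_congr rfl fun i _ => ?_))
  simp only [List.nil_append]
  rw [sum_paddedSum_append_left]
  congr 1
  omega

end GluingWeight

/-! ### Entropy and energy of probabilities on words -/

section Energy

variable {A B : Type*} [Finite A] [Finite B]

/-- The Shannon entropy of the restriction of `g` to the words of length `n`. -/
def wordEntropy (n : ℕ) (g : List A → ℝ) : ℝ := ∑ I ∈ allWords A n, Real.negMulLog (g I)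

/-- The mean of `log ψ` under the restriction of `g` to the words of length `n`. Words of zero
weight contribute nothing if `g` vanishes on them. -/
def wordMean (ψ : List A → ℝ) (n : ℕ) (g : List A → ℝ) : ℝ :=
  ∑ I ∈ allWords A n, g I * Real.log (ψ I)

/-- The weighted free energy at level `n`: mean of `log ψ`, plus entropy, plus `β` times the
entropy of the push-forward. -/
def energy (b : A → B) (β : ℝ) (ψ : List A → ℝ) (n : ℕ) (g : List A → ℝ) : ℝ :=
  wordMean ψ n g + wordEntropy n g + β * wordEntropy n (push b g)

/-- Relative entropy of `g` with respect to `f` on the words of length `n`. -/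
def relEntropy (n : ℕ) (g f : List A → ℝ) : ℝ :=
  ∑ I ∈ allWords A n, g I * (Real.log (g I) - Real.log (f I))

/-- The tangent line inequality behind Gibbs' inequality. The value `log 0 = 0` is harmless, since
the logarithms are multiplied by `x`. -/
theorem sub_le_mul_log_sub {x y : ℝ} (hx : 0 ≤ x) (hy : 0 ≤ y) (hxy : 0 < x → 0 < y) :
    x - y ≤ x * (Real.log x - Real.log y) := by
  rcases hx.eq_or_lt with h0 | h0
  · rw [← h0]; simpa using hy
  · have hy' := hxy h0
    have h2 := Real.log_le_sub_one_of_pos (div_pos hy' h0)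
    rw [Real.log_div hy'.ne' h0.ne'] at h2
    have h3 := mul_le_mul_of_nonneg_left h2 h0.le
    have h4 : x * (y / x - 1) = y - x := by field_simp
    linarith

theorem gibbs_inequality {ι : Type*} (s : Finset ι) (g f : ι → ℝ) (hg : ∀ i ∈ s, 0 ≤ g i)
    (hf : ∀ i ∈ s, 0 ≤ f i) (hfg : ∀ i ∈ s, 0 < g i → 0 < f i)
    (hle : ∑ i ∈ s, f i ≤ ∑ i ∈ s, g i) :
    0 ≤ ∑ i ∈ s, g i * (Real.log (g i) - Real.log (f i)) := by
  have h1 : ∀ i ∈ s, g i - f i ≤ g i * (Real.log (g i) - Real.log (f i)) := fun i hi =>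
    sub_le_mul_log_sub (hg i hi) (hf i hi) (hfg i hi)
  have h2 := Finset.sum_le_sum h1
  rw [Finset.sum_sub_distrib] at h2
  linarith

/-- Subadditivity of Shannon entropy. -/
theorem entropy_marginals_le {ι ι' : Type*} (s : Finset ι) (t : Finset ι') (H : ι → ι' → ℝ)
    (h0 : ∀ i ∈ s, ∀ j ∈ t, 0 ≤ H i j) (h1 : ∑ i ∈ s, ∑ j ∈ t, H i j = 1) :
    ∑ i ∈ s, ∑ j ∈ t, Real.negMulLog (H i j) ≤
      ∑ i ∈ s, Real.negMulLog (∑ j ∈ t, H i j) + ∑ j ∈ t, Real.negMulLog (∑ i ∈ s, H i j) := by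
  set p := fun i => ∑ j ∈ t, H i j with hp
  set r := fun j => ∑ i ∈ s, H i j with hr
  have hp0 : ∀ i ∈ s, 0 ≤ p i := fun i hi => Finset.sum_nonneg fun j hj => h0 i hi j hj
  have hr0 : ∀ j ∈ t, 0 ≤ r j := fun j hj => Finset.sum_nonneg fun i hi => h0 i hi j hj
  have hpH : ∀ i ∈ s, ∀ j ∈ t, H i j ≤ p i := fun i hi j hj =>
    Finset.single_le_sum (f := fun j => H i j) (fun j hj => h0 i hi j hj) hj
  have hrH : ∀ i ∈ s, ∀ j ∈ t, H i j ≤ r j := fun i hi j hj =>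
    Finset.single_le_sum (f := fun i => H i j) (fun i hi => h0 i hi j hj) hi
  have hr1 : ∑ j ∈ t, r j = 1 := by rw [hr, Finset.sum_comm]; exact h1
  have key := gibbs_inequality (s ×ˢ t) (fun x => H x.1 x.2) (fun x => p x.1 * r x.2)
    (fun x hx => h0 _ (Finset.mem_product.1 hx).1 _ (Finset.mem_product.1 hx).2)
    (fun x hx => mul_nonneg (hp0 _ (Finset.mem_product.1 hx).1)
      (hr0 _ (Finset.mem_product.1 hx).2))
    (fun x hx hpos => mul_pos
      (hpos.trans_le (hpH _ (Finset.mem_product.1 hx).1 _ (Finset.mem_product.1 hx).2))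
      (hpos.trans_le (hrH _ (Finset.mem_product.1 hx).1 _ (Finset.mem_product.1 hx).2)))
    (by
      rw [Finset.sum_product, Finset.sum_product, h1, ← Finset.sum_mul_sum, hr1, h1, mul_one])
  rw [Finset.sum_product] at key
  have e : ∀ i ∈ s, ∀ j ∈ t, H i j * (Real.log (H i j) - Real.log (p i * r j)) =
      -Real.negMulLog (H i j) - H i j * Real.log (p i) - H i j * Real.log (r j) := by
    intro i hi j hj
    rcases (h0 i hi j hj).eq_or_lt with hz | hz
    · simp [← hz]
    · rw [Real.log_mul (hz.trans_le (hpH i hi j hj)).ne' (hz.trans_le (hrH i hi j hj)).ne',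
        Real.negMulLog]
      ring
  rw [Finset.sum_congr rfl fun i hi => Finset.sum_congr rfl fun j hj => e i hi j hj] at key
  simp only [Finset.sum_sub_distrib, Finset.sum_neg_distrib] at key
  have e1 : ∑ i ∈ s, ∑ j ∈ t, H i j * Real.log (p i) = -∑ i ∈ s, Real.negMulLog (p i) := by
    rw [← Finset.sum_neg_distrib]
    refine Finset.sum_congr rfl fun i _ => ?_
    rw [← Finset.sum_mul, Real.negMulLog]; ring
  have e2 : ∑ i ∈ s, ∑ j ∈ t, H i j * Real.log (r j) = -∑ j ∈ t, Real.negMulLog (r j) := by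
    rw [← Finset.sum_neg_distrib, Finset.sum_comm]
    refine Finset.sum_congr rfl fun i _ => ?_
    rw [← Finset.sum_mul, Real.negMulLog]; ring
  rw [e1, e2] at key
  linarith

theorem wordEntropy_add_le (m n : ℕ) {g : List A → ℝ} (h0 : ∀ I, 0 ≤ g I)
    (h1 : ∑ I ∈ allWords A (m + n), g I = 1) :
    wordEntropy (m + n) g ≤ wordEntropy m (fun U => ∑ V ∈ allWords A n, g (U ++ V)) +
      wordEntropy n (fun V => ∑ U ∈ allWords A m, g (U ++ V)) := by
  rw [wordEntropy, sum_allWords_add]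
  rw [sum_allWords_add] at h1
  exact entropy_marginals_le _ _ _ (fun _ _ _ _ => h0 _) h1

theorem wordEntropy_congr {n : ℕ} {g g' : List A → ℝ} (h : ∀ I : List A, I.length = n → g I = g' I) :
    wordEntropy n g = wordEntropy n g' :=
  Finset.sum_congr rfl fun I hI => by rw [h I (mem_allWords.1 hI)]

theorem wordEntropy_nonneg {n : ℕ} {g : List A → ℝ} (h0 : ∀ I, 0 ≤ g I)
    (h1 : ∑ I ∈ allWords A n, g I = 1) : 0 ≤ wordEntropy n g :=
  Finset.sum_nonneg fun I hI => Real.negMulLog_nonneg (h0 I)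
    (h1 ▸ Finset.single_le_sum (f := g) (fun I _ => h0 I) hI)

theorem energy_congr (b : A → B) (β : ℝ) (ψ : List A → ℝ) {n : ℕ} {g g' : List A → ℝ}
    (h : ∀ I : List A, I.length = n → g I = g' I) : energy b β ψ n g = energy b β ψ n g' := by
  have h1 : ∀ J : List B, J.length = n → push b g J = push b g' J := fun J hJ =>
    Finset.sum_congr rfl fun I hI => h I (by
      rw [mem_fiber] at hI
      rw [← hJ, ← hI, List.length_map])
  have h2 : wordMean ψ n g = wordMean ψ n g' :=
    Finset.sum_congr rfl fun I hI => by rw [h I (mem_allWords.1 hI)]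
  rw [energy, energy, h2, wordEntropy_congr h, wordEntropy_congr h1]

theorem continuous_energy (b : A → B) (β : ℝ) (ψ : List A → ℝ) (n : ℕ) :
    Continuous (energy b β ψ n) := by
  unfold energy wordMean wordEntropy push
  have h := Real.continuous_negMulLog
  fun_prop

/-- Jensen's inequality for the energy, which is a concave functional. -/
theorem sum_energy_le (b : A → B) {β : ℝ} (hβ : 0 ≤ β) (ψ : List A → ℝ) (q : ℕ) {K : ℕ}
    (hK : 0 < K) (g : ℕ → List A → ℝ) (h0 : ∀ k I, 0 ≤ g k I) :
    ∑ k ∈ Finset.range K, energy b β ψ q (g k) ≤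
      K * energy b β ψ q (fun I => (K : ℝ)⁻¹ * ∑ k ∈ Finset.range K, g k I) := by
  have hK' : (0 : ℝ) < K := Nat.cast_pos.2 hK
  have jensen : ∀ x : ℕ → ℝ, (∀ k, 0 ≤ x k) → ∑ k ∈ Finset.range K, Real.negMulLog (x k) ≤
      K * Real.negMulLog ((K : ℝ)⁻¹ * ∑ k ∈ Finset.range K, x k) := by
    intro x hx
    have := Real.concaveOn_negMulLog.le_map_sum (t := Finset.range K) (w := fun _ => (K : ℝ)⁻¹)
      (p := x) (fun _ _ => by positivity) (by simp [hK'.ne']) (fun k _ => hx k)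
    simp only [smul_eq_mul, ← Finset.mul_sum] at this
    rwa [inv_mul_le_iff₀ hK'] at this
  have e1 : ∑ k ∈ Finset.range K, wordMean ψ q (g k) =
      K * wordMean ψ q (fun I => (K : ℝ)⁻¹ * ∑ k ∈ Finset.range K, g k I) := by
    simp only [wordMean]
    rw [Finset.sum_comm, Finset.mul_sum]
    refine Finset.sum_congr rfl fun I _ => ?_
    rw [← Finset.sum_mul]
    field_simp
  have ent : ∀ {D : Type _} [Finite D] (g : ℕ → List D → ℝ), (∀ k I, 0 ≤ g k I) →
      ∑ k ∈ Finset.range K, wordEntropy q (g k) ≤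
      K * wordEntropy q (fun I => (K : ℝ)⁻¹ * ∑ k ∈ Finset.range K, g k I) := by
    intro D _ g h0
    simp only [wordEntropy]
    rw [Finset.sum_comm, Finset.mul_sum]
    exact Finset.sum_le_sum fun I _ => jensen (fun k => g k I) fun k => h0 k I
  have e3 : ∑ k ∈ Finset.range K, wordEntropy q (push b (g k)) ≤
      K * wordEntropy q (push b (fun I => (K : ℝ)⁻¹ * ∑ k ∈ Finset.range K, g k I)) := by
    simp only [wordEntropy]
    rw [Finset.sum_comm, Finset.mul_sum]
    refine Finset.sum_le_sum fun J _ => ?_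
    refine (jensen (fun k => push b (g k) J) fun k => push_nonneg b (h0 k) J).trans (le_of_eq ?_)
    simp only [push]
    rw [Finset.sum_comm, Finset.mul_sum]
  simp only [energy]
  rw [Finset.sum_add_distrib, Finset.sum_add_distrib, ← Finset.mul_sum, e1]
  have e2 := ent g h0
  have e4 := mul_le_mul_of_nonneg_left e3 hβ
  linarith

theorem relEntropy_nonneg {n : ℕ} {g f : List A → ℝ} (hg : ∀ I, 0 ≤ g I) (hf : ∀ I, 0 ≤ f I)
    (hfg : ∀ I : List A, I.length = n → 0 < g I → 0 < f I) (hg1 : ∑ I ∈ allWords A n, g I = 1)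
    (hf1 : ∑ I ∈ allWords A n, f I = 1) : 0 ≤ relEntropy n g f :=
  gibbs_inequality _ _ _ (fun I _ => hg I) (fun I _ => hf I)
    (fun I hI => hfg I (mem_allWords.1 hI)) (hf1.trans hg1.symm).le

end Energy

namespace GluingWeight

variable {A B : Type*} [Finite A] [Finite B] {S : Finset ℕ} {c κ β : ℝ} {ψ : List A → ℝ}

theorem neg_log_nonneg (h : GluingWeight S c ψ) : 0 ≤ -Real.log c :=
  neg_nonneg.2 (Real.log_nonpos h.pos.le h.le_one)

/-- Submultiplicativity of `ψ`, integrated. -/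
theorem wordMean_add_le (h : GluingWeight S c ψ) (m n : ℕ) {g : List A → ℝ} (h0 : ∀ I, 0 ≤ g I)
    (h1 : ∑ I ∈ allWords A (m + n), g I = 1)
    (hsupp : ∀ I : List A, I.length = m + n → 0 < g I → 0 < ψ I) :
    wordMean ψ (m + n) g ≤ wordMean ψ m (fun U => ∑ V ∈ allWords A n, g (U ++ V)) +
      wordMean ψ n (fun V => ∑ U ∈ allWords A m, g (U ++ V)) - Real.log c := by
  have e1 : ∀ U ∈ allWords A m, ∀ V ∈ allWords A n, g (U ++ V) * Real.log (ψ (U ++ V)) ≤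
      g (U ++ V) * Real.log (ψ U) + g (U ++ V) * Real.log (ψ V) - g (U ++ V) * Real.log c := by
    intro U hU V hV
    rcases (h0 (U ++ V)).eq_or_lt with hz | hz
    · simp [← hz]
    · have hp := hsupp (U ++ V) (by
        rw [List.length_append, mem_allWords.1 hU, mem_allWords.1 hV]) hz
      obtain ⟨hU', hV'⟩ := h.pos_of_append hp
      have h2 := Real.log_le_log (mul_pos h.pos hp) (h.submul U V)
      rw [Real.log_mul h.pos.ne' hp.ne', Real.log_mul hU'.ne' hV'.ne'] at h2
      have h3 := mul_le_mul_of_nonneg_left h2 hz.le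
      linarith
  have e2 := Finset.sum_le_sum fun U hU => Finset.sum_le_sum fun V hV => e1 U hU V hV
  simp only [Finset.sum_sub_distrib, Finset.sum_add_distrib, ← Finset.sum_mul] at e2
  rw [sum_allWords_add] at h1
  rw [h1, one_mul] at e2
  have e3 : ∑ U ∈ allWords A m, ∑ V ∈ allWords A n, g (U ++ V) * Real.log (ψ V) =
      wordMean ψ n (fun V => ∑ U ∈ allWords A m, g (U ++ V)) := by
    rw [Finset.sum_comm]
    simp only [wordMean, Finset.sum_mul]
  rw [e3] at e2
  rw [wordMean, sum_allWords_add]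
  exact e2

/-- The energy is subadditive up to the constant `-log c`. -/
theorem energy_add_le (h : GluingWeight S c ψ) (b : A → B) (hβ : 0 ≤ β) (m n : ℕ)
    {g : List A → ℝ} (h0 : ∀ I, 0 ≤ g I) (h1 : ∑ I ∈ allWords A (m + n), g I = 1)
    (hsupp : ∀ I : List A, I.length = m + n → 0 < g I → 0 < ψ I) :
    energy b β ψ (m + n) g ≤ energy b β ψ m (fun U => ∑ V ∈ allWords A n, g (U ++ V)) +
      energy b β ψ n (fun V => ∑ U ∈ allWords A m, g (U ++ V)) - Real.log c := by
  have e1 := h.wordMean_add_le m n h0 h1 hsupp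
  have e2 := wordEntropy_add_le m n h0 h1
  have e3 := wordEntropy_add_le m n (push_nonneg b h0) ((sum_push b _ g).trans h1)
  rw [show (fun U => ∑ V ∈ allWords B n, push b g (U ++ V)) =
      push b (fun U => ∑ V ∈ allWords A n, g (U ++ V)) from
      funext fun J => sum_push_append_right b g J n,
    show (fun V => ∑ U ∈ allWords B m, push b g (U ++ V)) =
      push b (fun V => ∑ U ∈ allWords A m, g (U ++ V)) from
      funext fun J => sum_push_append_left b g J m] at e3
  have e4 := mul_le_mul_of_nonneg_left e3 hβ
  simp only [energy]
  linarith

theorem push_wordProb (h : GluingWeight S c ψ) (b : A → B) (h0 : 0 < κ) (J : List B) :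
    push b (wordProb b κ ψ) J = push b ψ J ^ κ / partitionSum b κ ψ J.length := by
  rw [← h.push_fiberWeight b h0, push, push, Finset.sum_div]
  refine Finset.sum_congr rfl fun I hI => ?_
  rw [wordProb, ← mem_fiber.1 hI, List.length_map]

/-- The defect in the variational inequality is a sum of relative entropies. -/
theorem energy_eq (h : GluingWeight S c ψ) (b : A → B) (h0 : 0 < κ) (hκ : κ * (1 + β) = 1)
    (n : ℕ) {g : List A → ℝ} (hg : ∀ I, 0 ≤ g I) (h1 : ∑ I ∈ allWords A n, g I = 1)
    (hsupp : ∀ I : List A, I.length = n → 0 < g I → 0 < ψ I) :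
    energy b β ψ n g + relEntropy n g (wordProb b κ ψ) +
      β * relEntropy n (push b g) (push b (wordProb b κ ψ)) =
      (1 + β) * Real.log (partitionSum b κ ψ n) := by
  set R := partitionSum b κ ψ n with hR
  have hRpos : 0 < R := h.partitionSum_pos b n
  set z := ∑ J ∈ allWords B n, Real.log (push b ψ J) * push b g J with hz
  have hz' : z = ∑ I ∈ allWords A n, Real.log (push b ψ (I.map b)) * g I :=
    sum_mul_push b n (fun J => Real.log (push b ψ J)) g
  have e1 : relEntropy n g (wordProb b κ ψ) =
      -wordEntropy n g - wordMean ψ n g - (κ - 1) * z + Real.log R := by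
    have : ∀ I ∈ allWords A n, g I * (Real.log (g I) - Real.log (wordProb b κ ψ I)) =
        -Real.negMulLog (g I) - g I * Real.log (ψ I) -
          (κ - 1) * (Real.log (push b ψ (I.map b)) * g I) + g I * Real.log R := by
      intro I hI
      rw [mem_allWords] at hI
      rcases (hg I).eq_or_lt with h2 | h2
      · simp [← h2]
      · have hψ := hsupp I hI h2
        have hZ := h.push_pos b hψ
        rw [wordProb, fiberWeight, hI, ← hR, Real.log_div
          (mul_pos hψ (Real.rpow_pos_of_pos hZ _)).ne' hRpos.ne',
          Real.log_mul hψ.ne' (Real.rpow_pos_of_pos hZ _).ne', Real.log_rpow hZ, Real.negMulLog]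
        ring
    rw [relEntropy, Finset.sum_congr rfl this, Finset.sum_add_distrib, Finset.sum_sub_distrib,
      Finset.sum_sub_distrib, Finset.sum_neg_distrib, ← Finset.mul_sum, ← Finset.sum_mul, h1,
      one_mul, hz', wordEntropy, wordMean]
  have e2 : relEntropy n (push b g) (push b (wordProb b κ ψ)) =
      -wordEntropy n (push b g) - κ * z + Real.log R := by
    have : ∀ J ∈ allWords B n,
        push b g J * (Real.log (push b g J) - Real.log (push b (wordProb b κ ψ) J)) =
        -Real.negMulLog (push b g J) -
          κ * (Real.log (push b ψ J) * push b g J) + push b g J * Real.log R := by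
      intro J hJ
      rw [mem_allWords] at hJ
      rcases (push_nonneg b hg J).eq_or_lt with h2 | h2
      · simp [← h2]
      · obtain ⟨I, hI, hgI⟩ : ∃ I ∈ fiber b J, 0 < g I := by
          by_contra! hcon
          exact absurd h2 (not_lt.2 (Finset.sum_nonpos hcon))
        rw [mem_fiber] at hI
        have hψ := hsupp I (by rw [← hJ, ← hI, List.length_map]) hgI
        have hZ := h.push_pos b hψ
        rw [hI] at hZ
        rw [h.push_wordProb b h0, hJ, ← hR, Real.log_div
          (Real.rpow_pos_of_pos hZ _).ne' hRpos.ne', Real.log_rpow hZ, Real.negMulLog]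
        ring
    rw [relEntropy, Finset.sum_congr rfl this, Finset.sum_add_distrib, Finset.sum_sub_distrib,
      Finset.sum_neg_distrib, ← Finset.mul_sum, ← Finset.sum_mul, sum_push, h1,
      one_mul, wordEntropy]
  rw [e1, e2, energy]
  linear_combination (-z) * hκ

/-- Gibbs' inequality for the push-forwards allows to drop their term in `energy_eq`. -/
theorem relEntropy_le (h : GluingWeight S c ψ) (b : A → B) (h0 : 0 < κ) (hβ : 0 ≤ β)
    (hκ : κ * (1 + β) = 1) (n : ℕ) {g : List A → ℝ} (hg : ∀ I, 0 ≤ g I)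
    (h1 : ∑ I ∈ allWords A n, g I = 1)
    (hsupp : ∀ I : List A, I.length = n → 0 < g I → 0 < ψ I) :
    relEntropy n g (wordProb b κ ψ) ≤
      (1 + β) * Real.log (partitionSum b κ ψ n) - energy b β ψ n g := by
  have e1 := h.energy_eq b h0 hκ n hg h1 hsupp
  have e2 : 0 ≤ relEntropy n (push b g) (push b (wordProb b κ ψ)) := by
    refine relEntropy_nonneg (push_nonneg b hg) (push_nonneg b (h.wordProb_nonneg b)) ?_
      ((sum_push b n g).trans h1) ((sum_push b n _).trans (h.sum_wordProb b h0 n))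
    intro J hJ hpos
    obtain ⟨I, hI, hgI⟩ : ∃ I ∈ fiber b J, 0 < g I := by
      by_contra! hcon
      exact absurd hpos (not_lt.2 (Finset.sum_nonpos hcon))
    rw [mem_fiber] at hI
    have hψ := hsupp I (by rw [← hJ, ← hI, List.length_map]) hgI
    rw [← hI]
    exact ((h.wordProb_pos_iff b I).2 hψ).trans_le (le_push_map b (h.wordProb_nonneg b) I)
  have e3 := mul_nonneg hβ e2
  linarith

theorem energy_le (h : GluingWeight S c ψ) (b : A → B) (h0 : 0 < κ) (hβ : 0 ≤ β)
    (hκ : κ * (1 + β) = 1) (n : ℕ) {g : List A → ℝ} (hg : ∀ I, 0 ≤ g I)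
    (h1 : ∑ I ∈ allWords A n, g I = 1)
    (hsupp : ∀ I : List A, I.length = n → 0 < g I → 0 < ψ I) :
    energy b β ψ n g ≤ (1 + β) * Real.log (partitionSum b κ ψ n) := by
  have e1 := h.relEntropy_le b h0 hβ hκ n hg h1 hsupp
  have e2 : 0 ≤ relEntropy n g (wordProb b κ ψ) :=
    relEntropy_nonneg hg (h.wordProb_nonneg b)
      (fun I hI hp => (h.wordProb_pos_iff b I).2 (hsupp I hI hp)) h1 (h.sum_wordProb b h0 n)
  linarith

theorem energy_wordProb (h : GluingWeight S c ψ) (b : A → B) (h0 : 0 < κ)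
    (hκ : κ * (1 + β) = 1) (n : ℕ) :
    energy b β ψ n (wordProb b κ ψ) = (1 + β) * Real.log (partitionSum b κ ψ n) := by
  have e1 := h.energy_eq b h0 hκ n (h.wordProb_nonneg b) (h.sum_wordProb b h0 n)
    fun I _ hp => (h.wordProb_pos_iff b I).1 hp
  have e2 : relEntropy n (wordProb b κ ψ) (wordProb b κ ψ) = 0 := by simp [relEntropy]
  have e3 : relEntropy n (push b (wordProb b κ ψ)) (push b (wordProb b κ ψ)) = 0 := by
    simp [relEntropy]
  rw [e2, e3] at e1
  linarith

theorem pos_of_paddedSum_pos (h : GluingWeight S c ψ) (b : A → B) {m n : ℕ} {I : List A}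
    (hI : 0 < paddedSum (wordProb b κ ψ) m n I) : 0 < ψ I := by
  by_contra hcon
  refine absurd hI (not_lt.2 (Finset.sum_nonpos fun U _ => Finset.sum_nonpos fun V _ => ?_))
  by_contra! h2
  rw [h.wordProb_pos_iff] at h2
  exact hcon (h.pos_of_append (h.pos_of_append h2).1).2

theorem sum_paddedSum_wordProb (h : GluingWeight S c ψ) (b : A → B) (h0 : 0 < κ) (m n k : ℕ) :
    ∑ I ∈ allWords A k, paddedSum (wordProb b κ ψ) m n I = 1 := by
  rw [sum_paddedSum, h.sum_wordProb b h0]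

/-- Subadditivity of the energy for adjacent windows in a random word. -/
theorem energy_paddedSum_add_le (h : GluingWeight S c ψ) (b : A → B) (h0 : 0 < κ) (hβ : 0 ≤ β)
    (k q r n : ℕ) :
    energy b β ψ (q + r) (paddedSum (wordProb b κ ψ) k n) ≤
      energy b β ψ q (paddedSum (wordProb b κ ψ) k (r + n)) +
      energy b β ψ r (paddedSum (wordProb b κ ψ) (k + q) n) - Real.log c := by
  have e := h.energy_add_le b hβ q r (g := paddedSum (wordProb b κ ψ) k n)
    (paddedSum_nonneg (h.wordProb_nonneg b) _ _) (h.sum_paddedSum_wordProb b h0 _ _ _)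
    fun I _ hI => h.pos_of_paddedSum_pos b hI
  simp only [sum_paddedSum_append_right, sum_paddedSum_append_left] at e
  exact e

/-- The energy of the word probability at level `N`, which is `(1 + β) log R(N)`, is bounded by the
mean of the energies of its marginals on windows of length `q`. -/
theorem mul_log_partitionSum_le (h : GluingWeight S c ψ) (b : A → B) (h0 : 0 < κ) (hβ : 0 ≤ β)
    (hκ : κ * (1 + β) = 1) (q : ℕ) :
    ∃ C : ℝ, ∀ N, q ≤ N → q * ((1 + β) * Real.log (partitionSum b κ ψ N)) ≤
      ∑ k ∈ Finset.range (N - q + 1),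
        energy b β ψ q (paddedSum (wordProb b κ ψ) k (N - k - q)) +
      (N - q + 1 : ℕ) * (-Real.log c) + C := by
  set C := -Real.log c with hC
  set lR := fun n => (1 + β) * Real.log (partitionSum b κ ψ n) with hlR
  set M := ∑ j ∈ Finset.range q, |lR j| with hM
  have hMle : ∀ j < q, lR j ≤ M := fun j hj => (le_abs_self _).trans
    (Finset.single_le_sum (f := fun j => |lR j|) (fun _ _ => abs_nonneg _)
      (Finset.mem_range.2 hj))
  have bound : ∀ m n j, energy b β ψ j (paddedSum (wordProb b κ ψ) m n) ≤ lR j := fun m n j =>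
    h.energy_le b h0 hβ hκ j (paddedSum_nonneg (h.wordProb_nonneg b) _ _)
      (h.sum_paddedSum_wordProb b h0 _ _ _) fun I _ hI => h.pos_of_paddedSum_pos b hI
  refine ⟨q * (M + C) + q * M, fun N hN => ?_⟩
  set a := fun n => energy b β ψ n (paddedSum (wordProb b κ ψ) 0 (N - n)) with ha
  have haN : lR N = a N := by
    simp only [ha, hlR]
    rw [← h.energy_wordProb b h0 hκ, Nat.sub_self]
    exact energy_congr b β ψ fun I _ => (paddedSum_zero_zero _ I).symm
  -- split the window `[0, n + q)` into `[0, n)` and a window of length `q`, and sum over `n`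
  have step : ∀ n, n + q ≤ N →
      a (n + q) ≤ a n + energy b β ψ q (paddedSum (wordProb b κ ψ) n (N - n - q)) + C := by
    intro n hn
    have e := h.energy_paddedSum_add_le b h0 hβ 0 n q (N - (n + q))
    rw [show q + (N - (n + q)) = N - n by omega, zero_add,
      show N - (n + q) = N - n - q by omega] at e
    simp only [ha, hC]
    rw [show N - (n + q) = N - n - q by omega]
    linarith
  -- the last `q` terms are comparable with the term at `N`
  have last : ∀ j < q, a N ≤ a (N - q + 1 + j) + M + C := by
    intro j hj
    have e := h.energy_paddedSum_add_le b h0 hβ 0 (N - q + 1 + j) (q - 1 - j) 0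
    rw [show N - q + 1 + j + (q - 1 - j) = N by omega, add_zero,
      show q - 1 - j = N - (N - q + 1 + j) by omega] at e
    simp only [ha, hC]
    rw [Nat.sub_self]
    have e2 := bound (0 + (N - q + 1 + j)) 0 (N - (N - q + 1 + j))
    have e3 := hMle (N - (N - q + 1 + j)) (by omega)
    linarith
  have s1 : ∑ n ∈ Finset.range (N + 1), a n =
      ∑ n ∈ Finset.range q, a n + ∑ n ∈ Finset.range (N - q + 1), a (n + q) := by
    rw [show N + 1 = q + (N - q + 1) by omega, Finset.sum_range_add]
    simp only [add_comm q]
  have s2 : ∑ n ∈ Finset.range (N + 1), a n =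
      ∑ n ∈ Finset.range (N - q + 1), a n + ∑ j ∈ Finset.range q, a (N - q + 1 + j) := by
    rw [← Finset.sum_range_add]
    congr 2
    omega
  have s3 : ∑ n ∈ Finset.range (N - q + 1), a (n + q) ≤ ∑ n ∈ Finset.range (N - q + 1), a n +
      ∑ k ∈ Finset.range (N - q + 1),
        energy b β ψ q (paddedSum (wordProb b κ ψ) k (N - k - q)) + (N - q + 1 : ℕ) * C := by
    have := Finset.sum_le_sum fun n (hn : n ∈ Finset.range (N - q + 1)) =>
      step n (by rw [Finset.mem_range] at hn; omega)
    simpa [Finset.sum_add_distrib] using this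
  have s4 : (q : ℝ) * a N ≤ ∑ j ∈ Finset.range q, a (N - q + 1 + j) + q * (M + C) := by
    have := Finset.sum_le_sum fun j (hj : j ∈ Finset.range q) => last j (Finset.mem_range.1 hj)
    simp only [Finset.sum_add_distrib, Finset.sum_const, Finset.card_range, nsmul_eq_mul] at this
    linarith
  have s5 : ∑ n ∈ Finset.range q, a n ≤ q * M := by
    have := Finset.sum_le_sum fun n (hn : n ∈ Finset.range q) =>
      (bound 0 (N - n) n).trans (hMle n (Finset.mem_range.1 hn))
    simpa using this
  have s6 : (q : ℝ) * lR N = q * a N := by rw [haN]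
  change (q : ℝ) * lR N ≤ _
  linarith

/-- The partition sums grow exponentially, up to a bounded factor. -/
theorem exists_log_partitionSum (h : GluingWeight S c ψ) (b : A → B) (h0 : 0 < κ) (h1 : κ ≤ 1) :
    ∃ P C : ℝ, ∀ n : ℕ, |Real.log (partitionSum b κ ψ n) - n * P| ≤ C := by
  obtain ⟨d, hd, hsup⟩ := h.partitionSum_supermul (κ := κ) b h0 h1
  have hR := fun n => h.partitionSum_pos (κ := κ) b n
  set u := fun n => Real.log (partitionSum b κ ψ n) with hu
  have up : ∀ m n, u (m + n) ≤ u m + u n - Real.log c := by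
    intro m n
    have := Real.log_le_log (mul_pos h.pos (hR (m + n))) (h.partitionSum_submul b h0 h1 m n)
    rw [Real.log_mul h.pos.ne' (hR _).ne', Real.log_mul (hR _).ne' (hR _).ne'] at this
    simp only [hu]; linarith
  have lo : ∀ m n, Real.log d + u m + u n ≤ u (m + n) := by
    intro m n
    have := Real.log_le_log (mul_pos hd (mul_pos (hR m) (hR n))) (hsup m n)
    rw [Real.log_mul hd.ne' (mul_pos (hR m) (hR n)).ne',
      Real.log_mul (hR _).ne' (hR _).ne'] at this
    simp only [hu]; linarith
  -- `u + C` and `-u + C` are subadditive, and Fekete's lemma applies to both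
  set C := |Real.log c| + |Real.log d| with hC
  have hc1 : -Real.log c ≤ C := (neg_le_abs _).trans (by simp [hC])
  have hc2 : -Real.log d ≤ C := (neg_le_abs _).trans (by simp [hC])
  have sv : Subadditive fun n => u n + C := fun m n => by have := up m n; linarith
  have sw : Subadditive fun n => -u n + C := fun m n => by have := lo m n; linarith
  have hC0 : 0 ≤ C := by positivity
  have lin : ∀ n : ℕ, |u n| ≤ (n + 1) * (|u 0| + |u 1| + C) := by
    intro n
    induction n with
    | zero => simp only [Nat.cast_zero, zero_add, one_mul]; linarith [abs_nonneg (u 1)]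
    | succ n ih =>
      have e1 := up n 1
      have e2 := lo n 1
      have e3 := abs_le.1 ih
      have e4 := abs_le.1 (le_refl |u 1|)
      have e5 := abs_nonneg (u 0)
      rw [abs_le]
      push_cast
      constructor <;> nlinarith
  have bd : ∀ (s : ℝ), |s| ≤ 1 → BddBelow (Set.range fun n : ℕ => (s * u n + C) / n) := by
    intro s hs
    refine ⟨-(2 * (|u 0| + |u 1| + C)), ?_⟩
    rintro _ ⟨n, rfl⟩
    have hK : 0 ≤ |u 0| + |u 1| + C := by positivity
    rcases Nat.eq_zero_or_pos n with rfl | hn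
    · simp only [Nat.cast_zero, div_zero]; linarith
    · have hn' : (1 : ℝ) ≤ n := by exact_mod_cast hn
      simp only
      rw [le_div_iff₀ (by linarith)]
      have e1 : |s * u n| ≤ (n + 1) * (|u 0| + |u 1| + C) := by
        rw [abs_mul]
        exact (mul_le_of_le_one_left (abs_nonneg _) hs).trans (lin n)
      have e2 := (abs_le.1 e1).1
      nlinarith
  have bv : BddBelow (Set.range fun n : ℕ => (u n + C) / n) := by simpa using bd 1 (by simp)
  have bw : BddBelow (Set.range fun n : ℕ => (-u n + C) / n) := by simpa using bd (-1) (by simp)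
  have tv := sv.tendsto_lim bv
  have tw := sw.tendsto_lim bw
  have hlim : sw.lim = -sv.lim := by
    refine tendsto_nhds_unique tw ?_
    have t0 : Tendsto (fun n : ℕ => 2 * C / (n : ℝ)) atTop (nhds 0) :=
      tendsto_const_nhds.div_atTop tendsto_natCast_atTop_atTop
    have := t0.sub tv
    rw [zero_sub] at this
    refine this.congr fun n => ?_
    rw [← sub_div]
    congr 1
    ring
  refine ⟨sv.lim, C + |u 0|, fun n => ?_⟩
  change |u n - _| ≤ _
  rcases Nat.eq_zero_or_pos n with rfl | hn
  · simp [hC0]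
  · have hn' : (0 : ℝ) < n := Nat.cast_pos.2 hn
    have e1 := sv.lim_le_div bv hn.ne'
    have e2 := sw.lim_le_div bw hn.ne'
    rw [hlim] at e2
    rw [le_div_iff₀ hn'] at e1 e2
    have := abs_nonneg (u 0)
    rw [abs_le]
    constructor <;> linarith

end GluingWeight

/-! ### Words, cylinders and measures on a subshift -/

theorem length_initialWord {A : Type*} (x : ℕ → A) (n : ℕ) : (initialWord x n).length = n := by
  simp [initialWord]

theorem initialWord_add {A : Type*} (x : ℕ → A) (m n : ℕ) :
    initialWord x (m + n) = initialWord x m ++ initialWord (fun i => x (m + i)) n := by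
  simp only [initialWord]
  rw [List.ofFn_add]
  simp

theorem initialWord_eq_of_le {A : Type*} {x y : ℕ → A} {m n : ℕ} (hmn : m ≤ n)
    (h : initialWord x n = initialWord y n) : initialWord x m = initialWord y m := by
  obtain ⟨k, rfl⟩ := Nat.exists_eq_add_of_le hmn
  rw [initialWord_add, initialWord_add] at h
  exact (List.append_inj h (by simp [length_initialWord])).1

section Cylinders

variable {A : Type*} [TopologicalSpace A]

theorem shiftMap_apply (X : Subshift A ℕ) (x : X.carrier) (i : ℕ) :
    (shiftMap X x).1 i = x.1 (1 + i) := rfl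

theorem iterate_shiftMap_apply (X : Subshift A ℕ) (k : ℕ) (x : X.carrier) (i : ℕ) :
    ((shiftMap X)^[k] x).1 i = x.1 (k + i) := by
  induction k generalizing x with
  | zero => simp
  | succ k ih =>
    rw [Function.iterate_succ_apply, ih, shiftMap_apply, show 1 + (k + i) = k + 1 + i by omega]

theorem mem_cyl_initialWord (X : Subshift A ℕ) (x : X.carrier) (n : ℕ) :
    x ∈ cyl X (initialWord x.1 n) := by
  simp [cyl, length_initialWord]

theorem mem_cyl_iff (X : Subshift A ℕ) {x : X.carrier} {I : List A} :
    x ∈ cyl X I ↔ initialWord x.1 I.length = I := Iff.rfl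

@[simp] theorem cyl_nil (X : Subshift A ℕ) : cyl X [] = Set.univ := by
  ext x; simp [cyl, initialWord]

theorem cyl_append (X : Subshift A ℕ) (I J : List A) :
    cyl X (I ++ J) = cyl X I ∩ (shiftMap X)^[I.length] ⁻¹' cyl X J := by
  ext x
  have : (fun i => x.1 (I.length + i)) = ((shiftMap X)^[I.length] x).1 :=
    funext fun i => (iterate_shiftMap_apply X _ x i).symm
  simp only [Set.mem_inter_iff, Set.mem_preimage, mem_cyl_iff, List.length_append]
  rw [initialWord_add, this]
  refine ⟨fun h => List.append_inj h (by simp [length_initialWord]), fun h => ?_⟩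
  rw [h.1, h.2]

theorem mem_language_iff (X : Subshift A ℕ) (hX : X.carrier.Nonempty) {I : List A} :
    I ∈ language X ↔ (cyl X I).Nonempty := by
  constructor
  · rintro (rfl | ⟨x, hx, hI⟩)
    · obtain ⟨x, hx⟩ := hX
      exact ⟨⟨x, hx⟩, by simp⟩
    · exact ⟨⟨x, hx⟩, hI⟩
  · rintro ⟨x, hx⟩
    exact Or.inr ⟨x.1, x.2, hx⟩

theorem cyl_eq_empty (X : Subshift A ℕ) {I : List A} (hI : I ∉ language X) : cyl X I = ∅ := by
  by_contra hne
  obtain ⟨x, hx⟩ := Set.nonempty_iff_ne_empty.2 hne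
  exact hI (Or.inr ⟨x.1, x.2, hx⟩)

theorem language_of_append (X : Subshift A ℕ) (hX : X.carrier.Nonempty) {I J : List A}
    (h : I ++ J ∈ language X) : I ∈ language X ∧ J ∈ language X := by
  rw [mem_language_iff X hX, cyl_append] at h
  obtain ⟨x, hx, hx'⟩ := h
  exact ⟨(mem_language_iff X hX).2 ⟨x, hx⟩, (mem_language_iff X hX).2 ⟨_, hx'⟩⟩

variable [DiscreteTopology A]

theorem continuous_shiftMap (X : Subshift A ℕ) : Continuous (shiftMap X) := by
  refine Continuous.subtype_mk ?_ _
  exact (continuous_shift 1).comp continuous_subtype_val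

theorem isClopen_cyl (X : Subshift A ℕ) (I : List A) : IsClopen (cyl X I) := by
  have : cyl X I = (fun x : X.carrier => fun i : Fin I.length => x.1 i) ⁻¹'
      {y | List.ofFn y = I} := by
    ext x; rfl
  rw [this]
  exact (isClopen_discrete _).preimage
    (continuous_pi fun i => (continuous_apply (i : ℕ)).comp continuous_subtype_val)

variable [Finite A]

instance compactSpace_carrier (X : Subshift A ℕ) : CompactSpace X.carrier :=
  isCompact_iff_compactSpace.1 X.isClosed.isCompact

variable [MeasurableSpace A] [BorelSpace A]

theorem measurable_shiftMap (X : Subshift A ℕ) : Measurable (shiftMap X) :=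
  (continuous_shiftMap X).measurable

theorem measurableSet_cyl (X : Subshift A ℕ) (I : List A) : MeasurableSet (cyl X I) :=
  (isClopen_cyl X I).isOpen.measurableSet

/-- The sets that depend on finitely many coordinates only. -/
def cylinderSets (X : Subshift A ℕ) : Set (Set X.carrier) :=
  {s | ∃ n, ∀ x y : X.carrier, initialWord x.1 n = initialWord y.1 n → (x ∈ s ↔ y ∈ s)}

theorem eq_biUnion_cyl (X : Subshift A ℕ) {s : Set X.carrier} {n : ℕ}
    (hs : ∀ x y : X.carrier, initialWord x.1 n = initialWord y.1 n → (x ∈ s ↔ y ∈ s)) :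
    s = ⋃ I ∈ (open Classical in (allWords A n).filter fun I => cyl X I ⊆ s), cyl X I := by
  classical
  ext x
  simp only [Finset.mem_filter, mem_allWords, Set.mem_iUnion, exists_prop]
  constructor
  · intro hx
    refine ⟨initialWord x.1 n, ⟨length_initialWord _ _, fun y hy => ?_⟩, mem_cyl_initialWord X x n⟩
    rw [mem_cyl_iff, length_initialWord] at hy
    exact (hs y x hy).2 hx
  · rintro ⟨I, ⟨_, hI⟩, hx⟩
    exact hI hx

theorem pairwiseDisjoint_cyl (X : Subshift A ℕ) {n : ℕ} (s : Set (List A))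
    (hs : ∀ I ∈ s, I.length = n) : s.PairwiseDisjoint (cyl X) := by
  intro I hI J hJ hne
  rw [Function.onFun, Set.disjoint_left]
  intro x hx hx'
  rw [mem_cyl_iff, hs I hI] at hx
  rw [mem_cyl_iff, hs J hJ] at hx'
  exact hne (hx.symm.trans hx')

theorem isSetRing_cylinderSets (X : Subshift A ℕ) : IsSetRing (cylinderSets X) where
  empty_mem := ⟨0, fun _ _ _ => by simp⟩
  union_mem := by
    rintro s t ⟨n, hn⟩ ⟨m, hm⟩
    refine ⟨max n m, fun x y h => ?_⟩
    rw [Set.mem_union, Set.mem_union, hn x y (initialWord_eq_of_le (le_max_left _ _) h),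
      hm x y (initialWord_eq_of_le (le_max_right _ _) h)]
  sdiff_mem := by
    rintro s t ⟨n, hn⟩ ⟨m, hm⟩
    refine ⟨max n m, fun x y h => ?_⟩
    rw [Set.mem_sdiff, Set.mem_sdiff, hn x y (initialWord_eq_of_le (le_max_left _ _) h),
      hm x y (initialWord_eq_of_le (le_max_right _ _) h)]

theorem measurableSet_of_mem_cylinderSets (X : Subshift A ℕ) {s : Set X.carrier}
    (hs : s ∈ cylinderSets X) : MeasurableSet s := by
  obtain ⟨n, hn⟩ := hs
  rw [eq_biUnion_cyl X hn]
  exact Finset.measurableSet_biUnion _ fun I _ => measurableSet_cyl X I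

theorem univ_mem_cylinderSets (X : Subshift A ℕ) : Set.univ ∈ cylinderSets X :=
  ⟨0, fun _ _ _ => by simp⟩

theorem generateFrom_cylinderSets (X : Subshift A ℕ) :
    (inferInstance : MeasurableSpace X.carrier) =
      MeasurableSpace.generateFrom (cylinderSets X) := by
  refine le_antisymm ?_ (MeasurableSpace.generateFrom_le fun s hs =>
    measurableSet_of_mem_cylinderSets X hs)
  have hcoord : ∀ i : ℕ, @Measurable X.carrier A
      (MeasurableSpace.generateFrom (cylinderSets X)) _ (fun x => x.1 i) := by
    intro i s _
    refine MeasurableSpace.measurableSet_generateFrom ⟨i + 1, fun x y h => ?_⟩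
    have : x.1 i = y.1 i := by
      rw [initialWord, initialWord, List.ofFn_inj] at h
      exact congrFun h ⟨i, Nat.lt_succ_self i⟩
    simp only [Set.mem_preimage, this]
  have h : @Measurable X.carrier (ℕ → A)
      (MeasurableSpace.generateFrom (cylinderSets X)) _ Subtype.val :=
    @measurable_pi_lambda _ _ _ (MeasurableSpace.generateFrom (cylinderSets X)) _ _ hcoord
  exact h.comap_le

/-- The measures of the cylinders, as a function on words. -/
def cylMeasure (X : Subshift A ℕ) (η : Measure X.carrier) (I : List A) : ℝ := η.real (cyl X I)

theorem cylMeasure_nonneg (X : Subshift A ℕ) (η : Measure X.carrier) (I : List A) :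
    0 ≤ cylMeasure X η I := measureReal_nonneg

theorem cylMeasure_of_notMem (X : Subshift A ℕ) (η : Measure X.carrier) {I : List A}
    (hI : I ∉ language X) : cylMeasure X η I = 0 := by
  rw [cylMeasure, cyl_eq_empty X hI, measureReal_empty]

theorem sum_measureReal_inter_cyl (X : Subshift A ℕ) (η : Measure X.carrier) [IsFiniteMeasure η]
    {s : Set X.carrier} (hs : MeasurableSet s) {f : X.carrier → X.carrier} (hf : Measurable f)
    (n : ℕ) : ∑ V ∈ allWords A n, η.real (s ∩ f ⁻¹' cyl X V) = η.real s := by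
  rw [← measureReal_biUnion_finset]
  · congr 1
    ext x
    simp only [mem_allWords, Set.mem_iUnion, Set.mem_inter_iff, Set.mem_preimage, exists_prop]
    exact ⟨fun ⟨_, _, h, _⟩ => h, fun h =>
      ⟨initialWord (f x).1 n, length_initialWord _ _, h, mem_cyl_initialWord X _ n⟩⟩
  · intro I hI J hJ hne
    exact ((pairwiseDisjoint_cyl X (n := n) (allWords A n : Set (List A))
      (fun I hI => by simpa using hI) hI hJ hne).preimage f).inter_left' _ |>.inter_right' _
  · intro V _
    exact hs.inter (hf (measurableSet_cyl X V))

theorem sum_cylMeasure_append_right (X : Subshift A ℕ) (η : Measure X.carrier)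
    [IsFiniteMeasure η] (I : List A) (n : ℕ) :
    ∑ V ∈ allWords A n, cylMeasure X η (I ++ V) = cylMeasure X η I := by
  simp only [cylMeasure, cyl_append]
  exact sum_measureReal_inter_cyl X η (measurableSet_cyl X I)
    ((measurable_shiftMap X).iterate _) n

theorem sum_cylMeasure (X : Subshift A ℕ) (η : Measure X.carrier) [IsProbabilityMeasure η]
    (n : ℕ) : ∑ V ∈ allWords A n, cylMeasure X η V = 1 := by
  have := sum_cylMeasure_append_right X η [] n
  simpa [cylMeasure] using this

theorem measureReal_preimage_cyl (X : Subshift A ℕ) (η : Measure X.carrier)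
    [IsFiniteMeasure η] (I : List A) (k : ℕ) :
    η.real ((shiftMap X)^[k] ⁻¹' cyl X I) = ∑ U ∈ allWords A k, cylMeasure X η (U ++ I) := by
  have := sum_measureReal_inter_cyl X η
    (((measurable_shiftMap X).iterate k) (measurableSet_cyl X I)) measurable_id k
  rw [← this]
  refine Finset.sum_congr rfl fun U hU => ?_
  rw [cylMeasure, cyl_append, mem_allWords.1 hU, Set.inter_comm]
  rfl

theorem sum_cylMeasure_append_left (X : Subshift A ℕ) {η : Measure X.carrier}
    [IsFiniteMeasure η] (hη : MeasurePreserving (shiftMap X) η η) (I : List A) (k : ℕ) :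
    ∑ U ∈ allWords A k, cylMeasure X η (U ++ I) = cylMeasure X η I := by
  rw [← measureReal_preimage_cyl]
  exact (hη.iterate k).measureReal_preimage (measurableSet_cyl X I).nullMeasurableSet

theorem measureReal_eq_sum_cyl (X : Subshift A ℕ) (η : Measure X.carrier) [IsFiniteMeasure η]
    {s : Set X.carrier} {n : ℕ}
    (hs : ∀ x y : X.carrier, initialWord x.1 n = initialWord y.1 n → (x ∈ s ↔ y ∈ s)) :
    η.real s = ∑ I ∈ (open Classical in (allWords A n).filter fun I => cyl X I ⊆ s),
      cylMeasure X η I := by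
  classical
  conv_lhs => rw [eq_biUnion_cyl X hs]
  rw [measureReal_biUnion_finset]
  · rfl
  · exact pairwiseDisjoint_cyl X (n := n) _ fun I hI => by
      rw [Finset.mem_coe, Finset.mem_filter, mem_allWords] at hI
      exact hI.1
  · exact fun I _ => measurableSet_cyl X I

theorem measure_ext_cyl (X : Subshift A ℕ) {η ν : Measure X.carrier} [IsFiniteMeasure η]
    [IsFiniteMeasure ν] (h : ∀ I, cylMeasure X η I = cylMeasure X ν I) : η = ν := by
  have key : ∀ s ∈ cylinderSets X, η s = ν s := by
    rintro s ⟨n, hn⟩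
    rw [← ENNReal.toReal_eq_toReal_iff' (measure_ne_top _ _) (measure_ne_top _ _)]
    change η.real s = ν.real s
    rw [measureReal_eq_sum_cyl X η hn, measureReal_eq_sum_cyl X ν hn]
    exact Finset.sum_congr rfl fun I _ => h I
  exact ext_of_generate_finite (cylinderSets X) (generateFrom_cylinderSets X)
    (isSetRing_cylinderSets X).isSetSemiring.isPiSystem key (key _ (univ_mem_cylinderSets X))

/-- Borel sets are approximated in measure by finite unions of cylinders. -/
theorem exists_cylinderSet_symmDiff_lt (X : Subshift A ℕ) (η : Measure X.carrier)
    [IsFiniteMeasure η] {s : Set X.carrier} (hs : MeasurableSet s) {ε : ℝ≥0∞} (hε : 0 < ε) :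
    ∃ t ∈ cylinderSets X, η (symmDiff t s) < ε :=
  exists_measure_symmDiff_lt_of_generateFrom_isSetRing (isSetRing_cylinderSets X)
    ⟨{Set.univ}, Set.countable_singleton _,
      Set.singleton_subset_iff.2 (univ_mem_cylinderSets X), by simp⟩
    (generateFrom_cylinderSets X) hs hε

/-- Averages along orbits of arbitrary probability measures have invariant limits. -/
theorem exists_invariant_limit (X : Subshift A ℕ) (P : ℕ → Measure X.carrier)
    [hP : ∀ N, IsProbabilityMeasure (P N)] :
    ∃ l : Filter ℕ, l.NeBot ∧ l ≤ atTop ∧ ∃ μ : Measure X.carrier, μ ∈ invariantMeasures X ∧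
      ∀ I, Tendsto (fun N : ℕ => ((N : ℝ) + 1)⁻¹ * ∑ k ∈ Finset.range (N + 1),
        (P N).real ((shiftMap X)^[k] ⁻¹' cyl X I)) l (nhds (cylMeasure X μ I)) := by
  have hT := measurable_shiftMap X
  set Q : ℕ → Measure X.carrier := fun N =>
    ((N : ℝ≥0∞) + 1)⁻¹ • ∑ k ∈ Finset.range (N + 1), (P N).map (shiftMap X)^[k] with hQ
  have hN0 : ∀ N : ℕ, (N : ℝ≥0∞) + 1 ≠ 0 := fun N => by simp
  have hNt : ∀ N : ℕ, (N : ℝ≥0∞) + 1 ≠ ⊤ := fun N => by simp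
  have hQval : ∀ N s, MeasurableSet s → Q N s =
      ((N : ℝ≥0∞) + 1)⁻¹ * ∑ k ∈ Finset.range (N + 1), P N ((shiftMap X)^[k] ⁻¹' s) := by
    intro N s hs
    simp only [hQ, Measure.smul_apply, Measure.finsetSum_apply, smul_eq_mul]
    congr 1
    exact Finset.sum_congr rfl fun k _ => Measure.map_apply (hT.iterate k) hs
  have hQp : ∀ N, IsProbabilityMeasure (Q N) := fun N => ⟨by
    rw [hQval N _ MeasurableSet.univ]
    simp only [Set.preimage_univ, measure_univ, Finset.sum_const, Finset.card_range,
      nsmul_eq_mul, mul_one, Nat.cast_add, Nat.cast_one]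
    exact ENNReal.inv_mul_cancel (hN0 N) (hNt N)⟩
  have hQreal : ∀ N s, MeasurableSet s → (Q N).real s =
      ((N : ℝ) + 1)⁻¹ * ∑ k ∈ Finset.range (N + 1), (P N).real ((shiftMap X)^[k] ⁻¹' s) := by
    intro N s hs
    rw [measureReal_def, hQval N s hs, ENNReal.toReal_mul, ENNReal.toReal_inv,
      ENNReal.toReal_sum fun _ _ => measure_ne_top _ _]
    congr 2
  let u : ℕ → ProbabilityMeasure X.carrier := fun N => ⟨Q N, hQp N⟩
  have : Nonempty (ProbabilityMeasure X.carrier) := ⟨u 0⟩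
  let F : Ultrafilter (ProbabilityMeasure X.carrier) := (hyperfilter ℕ).map u
  have hlim : Tendsto u (hyperfilter ℕ : Filter ℕ) (nhds F.lim) := F.le_nhds_lim
  have hclopen : ∀ s : Set X.carrier, IsClopen s → Tendsto (fun N => (Q N).real s)
      (hyperfilter ℕ : Filter ℕ) (nhds ((F.lim : Measure X.carrier).real s)) := by
    intro s hs
    have h1 := ProbabilityMeasure.tendsto_measure_of_null_frontier_of_tendsto' hlim (E := s)
      (by rw [hs.frontier_eq]; simp)
    exact (ENNReal.tendsto_toReal (measure_ne_top _ _)).comp h1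
  have hinv : ∀ I, (F.lim : Measure X.carrier).real (shiftMap X ⁻¹' cyl X I) =
      (F.lim : Measure X.carrier).real (cyl X I) := by
    intro I
    have t1 := hclopen _ ((isClopen_cyl X I).preimage (continuous_shiftMap X))
    have t2 := hclopen _ (isClopen_cyl X I)
    have t3 : Tendsto (fun N : ℕ => ((N : ℝ) + 1)⁻¹) (hyperfilter ℕ : Filter ℕ) (nhds 0) := by
      have := (tendsto_one_div_add_atTop_nhds_zero_nat (𝕜 := ℝ)).mono_left
        Nat.hyperfilter_le_atTop
      simpa only [one_div] using this
    have t4 := squeeze_zero_norm (a := fun N : ℕ => ((N : ℝ) + 1)⁻¹) (fun N => ?_) t3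
      (f := fun N => (Q N).real (shiftMap X ⁻¹' cyl X I) - (Q N).real (cyl X I))
    · exact sub_eq_zero.1 (tendsto_nhds_unique (t1.sub t2) t4)
    · rw [hQreal N _ (hT (measurableSet_cyl X I)), hQreal N _ (measurableSet_cyl X I),
        ← mul_sub, ← Finset.sum_sub_distrib, norm_mul]
      have e : ∀ k, (shiftMap X)^[k] ⁻¹' (shiftMap X ⁻¹' cyl X I) =
          (shiftMap X)^[k + 1] ⁻¹' cyl X I := fun k => by
        rw [← Set.preimage_comp, Function.iterate_succ']
      simp only [e]
      rw [Finset.sum_range_sub (fun k => (P N).real ((shiftMap X)^[k] ⁻¹' cyl X I)),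
        Real.norm_of_nonneg (by positivity)]
      refine mul_le_of_le_one_right (by positivity) ?_
      rw [Real.norm_eq_abs, abs_le]
      constructor <;>
      linarith [measureReal_nonneg (μ := P N) (s := (shiftMap X)^[N + 1] ⁻¹' cyl X I),
        measureReal_nonneg (μ := P N) (s := (shiftMap X)^[0] ⁻¹' cyl X I),
        measureReal_le_one (μ := P N) (s := (shiftMap X)^[N + 1] ⁻¹' cyl X I),
        measureReal_le_one (μ := P N) (s := (shiftMap X)^[0] ⁻¹' cyl X I)]
  refine ⟨(hyperfilter ℕ : Filter ℕ), inferInstance, Nat.hyperfilter_le_atTop,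
    (F.lim : Measure X.carrier), ⟨inferInstance, hT, ?_⟩, fun I => ?_⟩
  · refine measure_ext_cyl X fun I => ?_
    rw [cylMeasure, map_measureReal_apply hT (measurableSet_cyl X I), hinv I, cylMeasure]
  · refine (hclopen _ (isClopen_cyl X I)).congr fun N => ?_
    rw [hQreal N _ (measurableSet_cyl X I)]

/-- A probability on the words of length `N` is realised by a measure on the subshift, if it is
carried by legal words. -/
theorem exists_measure_of_words (X : Subshift A ℕ) (N : ℕ) (f : List A → ℝ) (h0 : ∀ I, 0 ≤ f I)
    (hX : ∀ I, 0 < f I → (cyl X I).Nonempty) (h1 : ∑ I ∈ allWords A N, f I = 1) :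
    ∃ P : Measure X.carrier, IsProbabilityMeasure P ∧
      ∀ I : List A, I.length = N → cylMeasure X P I = f I := by
  classical
  have hne : Nonempty X.carrier := by
    by_contra hcon
    have : ∀ I ∈ allWords A N, f I = 0 := fun I _ => by
      refine le_antisymm (not_lt.1 fun hpos => ?_) (h0 I)
      exact hcon ⟨(hX I hpos).some⟩
    rw [Finset.sum_eq_zero this] at h1
    exact zero_ne_one h1
  let x : List A → X.carrier := fun I =>
    if h : (cyl X I).Nonempty then h.some else Classical.choice hne
  have hx : ∀ I, 0 < f I → x I ∈ cyl X I := fun I hI => by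
    simp only [x, dif_pos (hX I hI)]
    exact (hX I hI).some_mem
  set P : Measure X.carrier :=
    ∑ W ∈ allWords A N, ENNReal.ofReal (f W) • Measure.dirac (x W) with hP
  refine ⟨P, ⟨?_⟩, fun I hI => ?_⟩
  · simp only [hP, Measure.finsetSum_apply, Measure.smul_apply, measure_univ, smul_eq_mul, mul_one]
    rw [← ENNReal.ofReal_sum_of_nonneg fun I _ => h0 I, h1, ENNReal.ofReal_one]
  · rw [cylMeasure, measureReal_def, hP]
    simp only [Measure.finsetSum_apply, Measure.smul_apply, smul_eq_mul]
    rw [Finset.sum_eq_single_of_mem I (by simpa using hI)]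
    · rcases (h0 I).eq_or_lt with hz | hz
      · simp [← hz]
      · rw [Measure.dirac_apply' _ (measurableSet_cyl X I), Set.indicator_of_mem (hx I hz)]
        simp [h0 I]
    · intro W hW hne
      rcases (h0 W).eq_or_lt with hz | hz
      · simp [← hz]
      · rw [Measure.dirac_apply' _ (measurableSet_cyl X I), Set.indicator_of_notMem, mul_zero]
        intro hmem
        have h2 := hx W hz
        rw [mem_cyl_iff, mem_allWords.1 hW] at h2
        rw [mem_cyl_iff, hI] at hmem
        exact hne (h2.symm.trans hmem)

/-- The law of the letters at the positions `k, …, k + |I| - 1` under a measure with given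
probabilities of the words of length `N`. -/
theorem measureReal_preimage_of_words (X : Subshift A ℕ) {N : ℕ} {f : List A → ℝ}
    (P : Measure X.carrier) [IsProbabilityMeasure P]
    (hP : ∀ I : List A, I.length = N → cylMeasure X P I = f I) {k : ℕ} {I : List A}
    (hk : k + I.length ≤ N) :
    P.real ((shiftMap X)^[k] ⁻¹' cyl X I) = paddedSum f k (N - k - I.length) I := by
  rw [measureReal_preimage_cyl, paddedSum]
  refine Finset.sum_congr rfl fun U hU => ?_
  rw [← sum_cylMeasure_append_right X P (U ++ I) (N - k - I.length)]
  refine Finset.sum_congr rfl fun V hV => hP _ ?_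
  rw [mem_allWords] at hU hV
  simp only [List.length_append, hU, hV]
  omega

end Cylinders

/-! ### The Gibbs measure of a gluing weight -/

/-- Cesàro means of numbers in `[0, 1]` do not change in the limit when boundedly many terms are
dropped. -/
theorem tendsto_mean_drop {l : Filter ℕ} (hl : l ≤ atTop) (a : ℕ → ℕ → ℝ) (q : ℕ) {t : ℝ}
    (h0 : ∀ N k, 0 ≤ a N k) (h1 : ∀ N k, a N k ≤ 1)
    (h : Tendsto (fun N : ℕ => ((N : ℝ) + 1)⁻¹ * ∑ k ∈ Finset.range (N + 1), a N k) l (nhds t)) :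
    Tendsto (fun N : ℕ => ((N - q + 1 : ℕ) : ℝ)⁻¹ * ∑ k ∈ Finset.range (N - q + 1), a N k) l
      (nhds t) := by
  have hz : Tendsto (fun N : ℕ => (q : ℝ) * (1 / ((N : ℝ) + 1))) l (nhds 0) := by
    simpa using ((tendsto_one_div_add_atTop_nhds_zero_nat (𝕜 := ℝ)).const_mul (q : ℝ)).mono_left hl
  have hd : Tendsto (fun N : ℕ => ((N - q + 1 : ℕ) : ℝ)⁻¹ * ∑ k ∈ Finset.range (N - q + 1), a N k -
      ((N : ℝ) + 1)⁻¹ * ∑ k ∈ Finset.range (N + 1), a N k) l (nhds 0) := by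
    refine squeeze_zero_norm' ?_ hz
    filter_upwards [hl (eventually_ge_atTop q)] with N hN
    set K := N - q + 1 with hK
    have hNK : N + 1 = K + q := by omega
    set σ := ∑ k ∈ Finset.range K, a N k with hσ
    have hσ0 : 0 ≤ σ := Finset.sum_nonneg fun k _ => h0 N k
    have hσ1 : σ ≤ K := by
      simpa using Finset.sum_le_sum fun k (_ : k ∈ Finset.range K) => h1 N k
    set ρ := ∑ k ∈ Finset.range q, a N (K + k) with hρ
    have hρ0 : 0 ≤ ρ := Finset.sum_nonneg fun k _ => h0 N _
    have hρ1 : ρ ≤ q := by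
      simpa using Finset.sum_le_sum fun k (_ : k ∈ Finset.range q) => h1 N (K + k)
    have hs : ∑ k ∈ Finset.range (N + 1), a N k = σ + ρ := by rw [hNK, Finset.sum_range_add]
    have hKpos : (0 : ℝ) < K := by rw [hK]; positivity
    have hN1 : (N : ℝ) + 1 = K + q := by exact_mod_cast hNK
    have hq : (0 : ℝ) ≤ q := Nat.cast_nonneg q
    rw [hs, hN1]
    have e : (K : ℝ)⁻¹ * σ - ((K : ℝ) + q)⁻¹ * (σ + ρ) = (σ * q / K - ρ) * (1 / (K + q)) := by
      field_simp; ring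
    rw [e, norm_mul, Real.norm_of_nonneg (by positivity : (0 : ℝ) ≤ 1 / (K + q))]
    refine mul_le_mul_of_nonneg_right ?_ (by positivity)
    have e1 : σ * q / K ≤ q := by
      rw [div_le_iff₀ hKpos, mul_comm]
      exact mul_le_mul_of_nonneg_left hσ1 hq
    have e2 : 0 ≤ σ * q / K := by positivity
    rw [Real.norm_eq_abs, abs_le]
    constructor <;> linarith
  simpa using hd.add h

section Gibbs

variable {A B : Type*} [Finite A] [Finite B] [TopologicalSpace A] [DiscreteTopology A]
  [MeasurableSpace A] [BorelSpace A] {X : Subshift A ℕ} {S : Finset ℕ} {c κ β : ℝ}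
  {ψ : List A → ℝ}

/-- The word probabilities have a shift invariant limit `μ` such that `μ(I)` is comparable to the
supremum of the probabilities of seeing `I` inside a longer random word, and such that the energy
of `μ` at level `q` is at least `q (1 + β) P` up to a constant, `P` being the growth rate of the
partition sums. -/
theorem GluingWeight.exists_gibbs_measure (h : GluingWeight S c ψ) (b : A → B) (h0 : 0 < κ)
    (h1 : κ ≤ 1) (hβ : 0 ≤ β) (hκ : κ * (1 + β) = 1) (hX : ∀ I, 0 < ψ I → (cyl X I).Nonempty)
    {P C : ℝ} (hP : ∀ n : ℕ, |Real.log (partitionSum b κ ψ n) - n * P| ≤ C) :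
    ∃ μ ∈ invariantMeasures X,
      (∃ d : ℝ, 0 < d ∧ ∀ m n I, d * paddedSum (wordProb b κ ψ) m n I ≤ cylMeasure X μ I) ∧
      (∀ I t, (∀ m n, paddedSum (wordProb b κ ψ) m n I ≤ t) → cylMeasure X μ I ≤ t) ∧
      ∀ q : ℕ, q * ((1 + β) * P) + Real.log c ≤ energy b β ψ q (cylMeasure X μ) := by
  set f := wordProb b κ ψ with hf
  have hf0 : ∀ I, 0 ≤ f I := h.wordProb_nonneg b
  choose Q hQp hQ using fun N => exists_measure_of_words X N f hf0
    (fun I hI => hX I ((h.wordProb_pos_iff b I).1 hI)) (h.sum_wordProb b h0 N)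
  obtain ⟨l, hlne, hl, μ, hμ, hlim⟩ := exists_invariant_limit X Q
  have hQpad : ∀ N k (I : List A), k + I.length ≤ N →
      (Q N).real ((shiftMap X)^[k] ⁻¹' cyl X I) = paddedSum f k (N - k - I.length) I :=
    fun N k I hk => measureReal_preimage_of_words X (Q N) (hQ N) hk
  have hinv : Tendsto (fun N : ℕ => ((N : ℝ) + 1)⁻¹) l (nhds 0) := by
    simpa only [one_div] using (tendsto_one_div_add_atTop_nhds_zero_nat (𝕜 := ℝ)).mono_left hl
  refine ⟨μ, hμ, ?_, ?_, ?_⟩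
  · obtain ⟨d₁, hd₁, hshift⟩ := h.paddedSum_shift b h0 h1
    obtain ⟨d₂, hd₂, hext⟩ := h.paddedSum_extend b h0 h1
    set p := S.sup id with hp
    have hSp : ∀ i ∈ S, i ≤ p := fun i hi => Finset.le_sup (f := id) hi
    have hcard : (0 : ℝ) < S.card := Nat.cast_pos.2 (Finset.card_pos.2 h.nonempty_lengths)
    refine ⟨d₁ * d₂ / S.card, div_pos (mul_pos hd₁ hd₂) hcard, fun m n I => ?_⟩
    set w := paddedSum f m n I with hw
    have hw0 : 0 ≤ w := paddedSum_nonneg hf0 m n I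
    set t := m + n + I.length + 2 * p with ht
    -- `M` runs over the positions where there is room for a shift by a connector and an extension
    -- to the total length `N`
    have step : ∀ N, t ≤ N → ((N + 1 : ℝ) - t) * (d₁ * d₂ * w) ≤
        S.card * ∑ k ∈ Finset.range (N + 1), (Q N).real ((shiftMap X)^[k] ⁻¹' cyl X I) := by
      intro N hN
      set a := fun k => (Q N).real ((shiftMap X)^[k] ⁻¹' cyl X I) with ha
      have s1 : ∀ M ∈ Finset.range (N + 1 - t), d₁ * d₂ * w ≤ ∑ i ∈ S, a (m + M + i) := by
        intro M hM
        rw [Finset.mem_range] at hM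
        have e1 := hshift m n (m + M) I (by omega)
        have e2 : ∀ i ∈ S, d₂ * paddedSum f (m + M + i) n I ≤ a (m + M + i) := by
          intro i hi
          have hip := hSp i hi
          have e3 := hext (N - (m + M + i) - I.length - n)
            (fun j hj => by have := hSp j hj; omega) (m + M + i) n I
          simp only [ha]
          rw [hQpad N _ I (by omega)]
          rw [show n + (N - (m + M + i) - I.length - n) = N - (m + M + i) - I.length by omega] at e3
          exact e3
        calc d₁ * d₂ * w = d₂ * (d₁ * w) := by ring
          _ ≤ d₂ * ∑ i ∈ S, paddedSum f (m + M + i) n I := mul_le_mul_of_nonneg_left e1 hd₂.le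
          _ = ∑ i ∈ S, d₂ * paddedSum f (m + M + i) n I := Finset.mul_sum _ _ _
          _ ≤ _ := Finset.sum_le_sum e2
      have s2 := Finset.sum_le_sum s1
      rw [Finset.sum_const, Finset.card_range, nsmul_eq_mul, Finset.sum_comm,
        Nat.cast_sub (by omega)] at s2
      push_cast at s2 ⊢
      refine s2.trans ?_
      rw [← nsmul_eq_mul, ← Finset.sum_const]
      refine Finset.sum_le_sum fun i hi => ?_
      have hip := hSp i hi
      have e : ∑ M ∈ Finset.range (N + 1 - t), a (m + M + i) =
          ∑ k ∈ Finset.Ico (m + i) (m + i + (N + 1 - t)), a k := by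
        rw [Finset.sum_Ico_eq_sum_range, Nat.add_sub_cancel_left]
        exact Finset.sum_congr rfl fun M _ => by rw [show m + M + i = m + i + M by omega]
      rw [e]
      refine Finset.sum_le_sum_of_subset_of_nonneg ?_ fun _ _ _ => measureReal_nonneg
      intro k hk
      rw [Finset.mem_Ico] at hk
      rw [Finset.mem_range]
      omega
    have lim2 : Tendsto (fun N : ℕ => (1 - t * ((N : ℝ) + 1)⁻¹) * (d₁ * d₂ / S.card * w)) l
        (nhds ((1 - t * 0) * (d₁ * d₂ / S.card * w))) :=
      ((hinv.const_mul _).const_sub _).mul_const _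
    rw [mul_zero, sub_zero, one_mul] at lim2
    refine le_of_tendsto_of_tendsto lim2 (hlim I) ?_
    filter_upwards [hl (eventually_ge_atTop t)] with N hN
    have hN1 : (0 : ℝ) < N + 1 := by positivity
    rw [le_inv_mul_iff₀ hN1]
    have := step N hN
    rw [← div_le_iff₀' hcard] at this
    refine le_trans (le_of_eq ?_) this
    field_simp
  · intro I t ht
    have ht0 : 0 ≤ t := (paddedSum_nonneg hf0 0 0 I).trans (ht 0 0)
    refine le_of_tendsto (tendsto_mean_drop hl
      (fun N k => (Q N).real ((shiftMap X)^[k] ⁻¹' cyl X I)) I.length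
      (fun _ _ => measureReal_nonneg) (fun _ _ => measureReal_le_one) (hlim I)) ?_
    filter_upwards [hl (eventually_ge_atTop I.length)] with N hN
    have hK : (0 : ℝ) < (N - I.length + 1 : ℕ) := by positivity
    rw [inv_mul_le_iff₀ hK]
    calc _ ≤ ∑ k ∈ Finset.range (N - I.length + 1), t := by
          refine Finset.sum_le_sum fun k hk => ?_
          rw [Finset.mem_range] at hk
          rw [hQpad N k I (by omega)]
          exact ht _ _
      _ = _ := by simp
  · intro q
    obtain ⟨C₁, hC₁⟩ := h.mul_log_partitionSum_le b h0 hβ hκ q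
    have hE : Tendsto (fun N : ℕ => energy b β ψ q fun I => ((N - q + 1 : ℕ) : ℝ)⁻¹ *
        ∑ k ∈ Finset.range (N - q + 1), (Q N).real ((shiftMap X)^[k] ⁻¹' cyl X I)) l
        (nhds (energy b β ψ q (cylMeasure X μ))) := by
      refine ((continuous_energy b β ψ q).tendsto _).comp (tendsto_pi_nhds.2 fun I => ?_)
      exact tendsto_mean_drop hl (fun N k => (Q N).real ((shiftMap X)^[k] ⁻¹' cyl X I)) q
        (fun _ _ => measureReal_nonneg) (fun _ _ => measureReal_le_one) (hlim I)
    have hKinv : Tendsto (fun N : ℕ => ((N - q + 1 : ℕ) : ℝ)⁻¹) l (nhds 0) := by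
      refine Tendsto.mono_left ?_ hl
      have h2 : Tendsto (fun N : ℕ => N - q + 1) atTop atTop :=
        (tendsto_add_atTop_nat 1).comp (tendsto_sub_atTop_nat q)
      exact tendsto_inv_atTop_zero.comp (tendsto_natCast_atTop_atTop.comp h2)
    set D := q * ((1 + β) * (((q : ℝ) - 1) * P - C)) - C₁ with hD
    have hlow : Tendsto (fun N : ℕ => q * ((1 + β) * P) + Real.log c +
        D * ((N - q + 1 : ℕ) : ℝ)⁻¹) l (nhds (q * ((1 + β) * P) + Real.log c + D * 0)) :=
      (hKinv.const_mul D).const_add _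
    rw [mul_zero, add_zero] at hlow
    refine le_of_tendsto_of_tendsto hlow hE ?_
    filter_upwards [hl (eventually_ge_atTop q)] with N hN
    set K := N - q + 1 with hKdef
    have hK : (0 : ℝ) < (K : ℝ) := by rw [hKdef]; positivity
    have hKr : (N : ℝ) = K + (q - 1) := by
      rw [hKdef]; push_cast [Nat.cast_sub hN]; ring
    have e1 := hC₁ N hN
    have e2 := sum_energy_le b hβ ψ q (K := K) (by omega)
      (fun k => paddedSum f k (N - k - q)) fun k I => paddedSum_nonneg hf0 _ _ I
    have e3 : energy b β ψ q (fun I => (K : ℝ)⁻¹ *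
        ∑ k ∈ Finset.range K, paddedSum f k (N - k - q) I) =
        energy b β ψ q (fun I => (K : ℝ)⁻¹ *
        ∑ k ∈ Finset.range K, (Q N).real ((shiftMap X)^[k] ⁻¹' cyl X I)) := by
      refine energy_congr b β ψ fun I hI => ?_
      congr 1
      refine Finset.sum_congr rfl fun k hk => ?_
      rw [Finset.mem_range] at hk
      rw [hQpad N k I (by omega), hI]
    rw [e3] at e2
    set E := energy b β ψ q (fun I => (K : ℝ)⁻¹ *
        ∑ k ∈ Finset.range K, (Q N).real ((shiftMap X)^[k] ⁻¹' cyl X I)) with hEdef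
    have e4 : (N : ℝ) * P - C ≤ Real.log (partitionSum b κ ψ N) := by
      have := (abs_le.1 (hP N)).1
      linarith
    have hqβ : (0 : ℝ) ≤ q * (1 + β) := mul_nonneg (Nat.cast_nonneg q) (by linarith)
    have e5 := mul_le_mul_of_nonneg_left e4 hqβ
    rw [hKr] at e5
    have e6 : (K : ℝ) * (q * ((1 + β) * P) + Real.log c + D * (K : ℝ)⁻¹) ≤ K * E := by
      have : (K : ℝ) * (q * ((1 + β) * P) + Real.log c + D * (K : ℝ)⁻¹) =
          K * (q * ((1 + β) * P) + Real.log c) + D := by field_simp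
      rw [this, hD]
      linarith
    exact le_of_mul_le_mul_left e6 hK

/-! ### Lower bounds for correlations and ergodicity -/

theorem sum_cylMeasure_between (X : Subshift A ℕ) (η : Measure X.carrier) [IsFiniteMeasure η]
    (I J : List A) (k : ℕ) :
    ∑ V ∈ allWords A k, cylMeasure X η (I ++ V ++ J) =
      η.real (cyl X I ∩ (shiftMap X)^[I.length + k] ⁻¹' cyl X J) := by
  have hT := measurable_shiftMap X
  rw [← sum_measureReal_inter_cyl X η ((measurableSet_cyl X I).inter
    ((hT.iterate _) (measurableSet_cyl X J))) (hT.iterate I.length) k]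
  refine Finset.sum_congr rfl fun V hV => ?_
  rw [cylMeasure, List.append_assoc, cyl_append, cyl_append, mem_allWords.1 hV,
    Set.preimage_inter, ← Set.preimage_comp, ← Function.iterate_add, add_comm k]
  congr 1
  ext x
  simp only [Set.mem_inter_iff]
  tauto

/-- The Gibbs property gives a lower bound for the correlations of cylinders: almost the full
measure of `I` is seen in words continuing `I` by any prescribed large number of letters, and these
can be glued to words containing `J`. -/
theorem GluingWeight.correlation_cyl (h : GluingWeight S c ψ) (b : A → B) (h0 : 0 < κ)
    (h1 : κ ≤ 1) {μ : Measure X.carrier} [IsProbabilityMeasure μ] {d : ℝ} (hd : 0 < d)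
    (hlow : ∀ m n I, d * paddedSum (wordProb b κ ψ) m n I ≤ cylMeasure X μ I)
    (hup : ∀ I t, (∀ m n, paddedSum (wordProb b κ ψ) m n I ≤ t) → cylMeasure X μ I ≤ t) :
    ∃ e : ℝ, 0 < e ∧ ∀ I J, ∀ᶠ N in atTop, e * (cylMeasure X μ I * cylMeasure X μ J) ≤
      ∑ i ∈ S, μ.real (cyl X I ∩ (shiftMap X)^[N + i] ⁻¹' cyl X J) := by
  obtain ⟨d₂, hd₂, hext⟩ := h.paddedSum_extend b h0 h1
  obtain ⟨d₃, hd₃, hglue⟩ := h.paddedSum_glue b h0 h1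
  -- some extension sum is close to the supremum, which is at least the measure of the cylinder
  have half : ∀ I, ∃ m n, cylMeasure X μ I / 2 ≤ paddedSum (wordProb b κ ψ) m n I := by
    intro I
    rcases (cylMeasure_nonneg X μ I).eq_or_lt with hz | hz
    · refine ⟨0, 0, ?_⟩
      rw [← hz, zero_div]
      exact paddedSum_nonneg (h.wordProb_nonneg b) _ _ _
    · by_contra! hcon
      have := hup I _ fun m n => (hcon m n).le
      linarith
  set p := S.sup id with hp
  have hSp : ∀ i ∈ S, i ≤ p := fun i hi => Finset.le_sup (f := id) hi
  refine ⟨d * d₃ * d₂ / 4, by positivity, fun I J => ?_⟩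
  obtain ⟨m, n, hI⟩ := half I
  obtain ⟨m', n', hJ⟩ := half J
  filter_upwards [eventually_ge_atTop (I.length + n + m' + p)] with N hN
  set k := N - I.length - n - m' with hk
  have e1 := hext k (fun i hi => by have := hSp i hi; omega) m n I
  have e2 := hglue m (n + k) m' n' I J
  set x := paddedSum (wordProb b κ ψ) m n I
  set y := paddedSum (wordProb b κ ψ) m' n' J
  set z := paddedSum (wordProb b κ ψ) m (n + k) I
  have hx := cylMeasure_nonneg X μ I
  have hy := cylMeasure_nonneg X μ J
  have e3 : ∀ i ∈ S, d * ∑ V ∈ allWords A (n + k + i + m'),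
      paddedSum (wordProb b κ ψ) m n' (I ++ V ++ J) ≤
      μ.real (cyl X I ∩ (shiftMap X)^[N + i] ⁻¹' cyl X J) := by
    intro i _
    rw [show N + i = I.length + (n + k + i + m') by omega, ← sum_cylMeasure_between,
      Finset.mul_sum]
    exact Finset.sum_le_sum fun V _ => hlow _ _ _
  have e4 : cylMeasure X μ I / 2 * (cylMeasure X μ J / 2) ≤ x * y :=
    mul_le_mul hI hJ (by linarith) (by linarith)
  have hy0 : 0 ≤ y := by linarith
  calc d * d₃ * d₂ / 4 * (cylMeasure X μ I * cylMeasure X μ J)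
      = d * d₃ * d₂ * (cylMeasure X μ I / 2 * (cylMeasure X μ J / 2)) := by ring
    _ ≤ d * d₃ * d₂ * (x * y) := mul_le_mul_of_nonneg_left e4 (by positivity)
    _ = d * (d₃ * (d₂ * x * y)) := by ring
    _ ≤ d * (d₃ * (z * y)) := by gcongr
    _ ≤ d * ∑ i ∈ S, ∑ V ∈ allWords A (n + k + i + m'),
          paddedSum (wordProb b κ ψ) m n' (I ++ V ++ J) := mul_le_mul_of_nonneg_left e2 hd.le
    _ ≤ _ := by rw [Finset.mul_sum]; exact Finset.sum_le_sum e3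

/-- Correlations of unions of cylinders are sums of correlations of cylinders. -/
theorem measureReal_inter_preimage_eq_sum (X : Subshift A ℕ) (μ : Measure X.carrier)
    [IsFiniteMeasure μ] {s t : Set X.carrier} {n m : ℕ}
    (hs : ∀ x y : X.carrier, initialWord x.1 n = initialWord y.1 n → (x ∈ s ↔ y ∈ s))
    (ht : ∀ x y : X.carrier, initialWord x.1 m = initialWord y.1 m → (x ∈ t ↔ y ∈ t)) (k : ℕ) :
    μ.real (s ∩ (shiftMap X)^[k] ⁻¹' t) =
      ∑ I ∈ (open Classical in (allWords A n).filter fun I => cyl X I ⊆ s),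
      ∑ J ∈ (open Classical in (allWords A m).filter fun I => cyl X I ⊆ t),
        μ.real (cyl X I ∩ (shiftMap X)^[k] ⁻¹' cyl X J) := by
  classical
  have hT := (measurable_shiftMap X).iterate k
  have hd : ∀ (m : ℕ) (t : Set X.carrier),
      (((allWords A m).filter fun I => cyl X I ⊆ t : Finset (List A)) :
        Set (List A)).PairwiseDisjoint (cyl X) := fun m t =>
    pairwiseDisjoint_cyl X (n := m) _ fun I hI => by
      rw [Finset.mem_coe, Finset.mem_filter, mem_allWords] at hI
      exact hI.1
  have e1 : s ∩ (shiftMap X)^[k] ⁻¹' t =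
      ⋃ I ∈ (allWords A n).filter fun I => cyl X I ⊆ s, cyl X I ∩ (shiftMap X)^[k] ⁻¹' t := by
    conv_lhs => rw [eq_biUnion_cyl X hs]
    rw [Set.iUnion₂_inter]
  have htm : MeasurableSet t := measurableSet_of_mem_cylinderSets X ⟨m, ht⟩
  rw [e1, measureReal_biUnion_finset
    (fun I hI J hJ hne => ((hd n s hI hJ hne).inter_left _).inter_right _)
    fun I _ => (measurableSet_cyl X I).inter (hT htm)]
  refine Finset.sum_congr rfl fun I _ => ?_
  have e2 : cyl X I ∩ (shiftMap X)^[k] ⁻¹' t =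
      ⋃ J ∈ (allWords A m).filter fun I => cyl X I ⊆ t,
        cyl X I ∩ (shiftMap X)^[k] ⁻¹' cyl X J := by
    conv_lhs => rw [eq_biUnion_cyl X ht]
    rw [Set.preimage_iUnion₂, Set.inter_iUnion₂]
  rw [e2, measureReal_biUnion_finset
    (fun J hJ K hK hne => (((hd m t hJ hK hne).preimage _).inter_left' _).inter_right' _)
    fun J _ => (measurableSet_cyl X I).inter (hT (measurableSet_cyl X J))]

/-- A lower bound for the correlations of cylinders passes to all Borel sets. -/
theorem correlation_of_cyl {μ : Measure X.carrier} [IsProbabilityMeasure μ]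
    (hμ : MeasurePreserving (shiftMap X) μ μ) {e : ℝ} (he : 0 < e)
    (hcyl : ∀ I J, ∀ᶠ N in atTop, e * (cylMeasure X μ I * cylMeasure X μ J) ≤
      ∑ i ∈ S, μ.real (cyl X I ∩ (shiftMap X)^[N + i] ⁻¹' cyl X J))
    {s t : Set X.carrier} (hs : MeasurableSet s) (ht : MeasurableSet t) {ε : ℝ} (hε : 0 < ε) :
    ∀ᶠ N in atTop, e * (μ.real s * μ.real t) - ε ≤
      ∑ i ∈ S, μ.real (s ∩ (shiftMap X)^[N + i] ⁻¹' t) := by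
  classical
  set δ := ε / (2 * S.card + 2 * e) with hδ
  have hden : 0 < 2 * (S.card : ℝ) + 2 * e := by positivity
  have hδ0 : 0 < δ := div_pos hε hden
  obtain ⟨s', ⟨n, hs'⟩, hss⟩ := exists_cylinderSet_symmDiff_lt X μ hs (ENNReal.ofReal_pos.2 hδ0)
  obtain ⟨t', ⟨m, ht'⟩, htt⟩ := exists_cylinderSet_symmDiff_lt X μ ht (ENNReal.ofReal_pos.2 hδ0)
  have hs'm : MeasurableSet s' := measurableSet_of_mem_cylinderSets X ⟨n, hs'⟩
  have ht'm : MeasurableSet t' := measurableSet_of_mem_cylinderSets X ⟨m, ht'⟩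
  have hssr : μ.real (symmDiff s' s) ≤ δ := ENNReal.toReal_le_of_le_ofReal hδ0.le hss.le
  have httr : μ.real (symmDiff t' t) ≤ δ := ENNReal.toReal_le_of_le_ofReal hδ0.le htt.le
  have ev : ∀ᶠ N in atTop, ∀ P ∈ ((allWords A n).filter fun I => cyl X I ⊆ s') ×ˢ
      ((allWords A m).filter fun I => cyl X I ⊆ t'),
      e * (cylMeasure X μ P.1 * cylMeasure X μ P.2) ≤
      ∑ i ∈ S, μ.real (cyl X P.1 ∩ (shiftMap X)^[N + i] ⁻¹' cyl X P.2) :=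
    (Finset.eventually_all _).2 fun P _ => hcyl P.1 P.2
  filter_upwards [ev] with N hN
  have h1 : e * (μ.real s' * μ.real t') ≤
      ∑ i ∈ S, μ.real (s' ∩ (shiftMap X)^[N + i] ⁻¹' t') := by
    rw [Finset.sum_congr rfl fun i _ =>
      measureReal_inter_preimage_eq_sum X μ hs' ht' (N + i), measureReal_eq_sum_cyl X μ hs',
      measureReal_eq_sum_cyl X μ ht', Finset.sum_mul_sum, ← Finset.sum_product',
      Finset.mul_sum, Finset.sum_congr rfl fun i _ => (Finset.sum_product' _ _ _).symm,
      Finset.sum_comm]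
    exact Finset.sum_le_sum hN
  have h2 : ∀ k, μ.real (s' ∩ (shiftMap X)^[k] ⁻¹' t') ≤
      μ.real (s ∩ (shiftMap X)^[k] ⁻¹' t) + 2 * δ := by
    intro k
    have hsub : s' ∩ (shiftMap X)^[k] ⁻¹' t' ⊆
        (s ∩ (shiftMap X)^[k] ⁻¹' t) ∪ (symmDiff s' s ∪ (shiftMap X)^[k] ⁻¹' symmDiff t' t) := by
      intro x hx
      simp only [Set.mem_union, Set.mem_inter_iff, Set.mem_preimage, Set.mem_symmDiff] at hx ⊢
      tauto
    have h3 := (measureReal_mono (μ := μ) hsub).trans (measureReal_union_le _ _)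
    have h4 := measureReal_union_le (μ := μ) (symmDiff s' s)
      ((shiftMap X)^[k] ⁻¹' symmDiff t' t)
    rw [(hμ.iterate k).measureReal_preimage (ht'm.symmDiff ht).nullMeasurableSet] at h4
    linarith
  have h3 : ∑ i ∈ S, μ.real (s' ∩ (shiftMap X)^[N + i] ⁻¹' t') ≤
      ∑ i ∈ S, μ.real (s ∩ (shiftMap X)^[N + i] ⁻¹' t) + S.card * (2 * δ) := by
    have := Finset.sum_le_sum fun i (_ : i ∈ S) => h2 (N + i)
    rwa [Finset.sum_add_distrib, Finset.sum_const, nsmul_eq_mul] at this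
  have h4 : ∀ {u u' : Set X.carrier}, μ.real (symmDiff u' u) ≤ δ →
      μ.real u ≤ μ.real u' + δ := by
    intro u u' hu
    have hsub : u ⊆ u' ∪ symmDiff u' u := by
      intro x hx
      simp only [Set.mem_union, Set.mem_symmDiff]
      tauto
    have := (measureReal_mono (μ := μ) hsub).trans (measureReal_union_le _ _)
    linarith
  have h5 := h4 hssr
  have h6 := h4 httr
  have h7 : μ.real s * μ.real t ≤ μ.real s' * μ.real t' + 2 * δ := by
    have a1 := measureReal_nonneg (μ := μ) (s := s)
    have a2 := measureReal_le_one (μ := μ) (s := s)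
    have a3 := measureReal_nonneg (μ := μ) (s := t')
    have a4 := measureReal_le_one (μ := μ) (s := t')
    nlinarith
  have h8 := mul_le_mul_of_nonneg_left h7 he.le
  have h9 : S.card * (2 * δ) + e * (2 * δ) = ε := by
    rw [hδ]; field_simp
  linarith

/-- The lower bound for correlations of cylinders in the form of a limes inferior over Borel sets. -/
theorem le_liminf_correlation {μ : Measure X.carrier} [IsProbabilityMeasure μ]
    (hμ : MeasurePreserving (shiftMap X) μ μ) {e : ℝ} (he : 0 < e)
    (hcyl : ∀ I J, ∀ᶠ N in atTop, e * (cylMeasure X μ I * cylMeasure X μ J) ≤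
      ∑ i ∈ S, μ.real (cyl X I ∩ (shiftMap X)^[N + i] ⁻¹' cyl X J))
    {s t : Set X.carrier} (hs : MeasurableSet s) (ht : MeasurableSet t) :
    (e.toNNReal : ℝ≥0∞) * μ s * μ t ≤
      liminf (fun n : ℕ => ∑ i ∈ S, μ (s ∩ (shiftMap X)^[n + i] ⁻¹' t)) atTop := by
  refine ENNReal.le_of_forall_pos_le_add fun ε hε _ => ?_
  rw [← tsub_le_iff_right]
  refine le_liminf_of_le (by isBoundedDefault) ?_
  filter_upwards [correlation_of_cyl hμ he hcyl hs ht (ε := ε) hε] with N hN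
  rw [tsub_le_iff_right]
  have e1 : (e.toNNReal : ℝ≥0∞) * μ s * μ t = ENNReal.ofReal (e * (μ.real s * μ.real t)) := by
    rw [ENNReal.ofReal_mul he.le, ENNReal.ofReal_mul measureReal_nonneg, ofReal_measureReal,
      ofReal_measureReal, mul_assoc]
    rfl
  have e2 : ∑ i ∈ S, μ (s ∩ (shiftMap X)^[N + i] ⁻¹' t) =
      ENNReal.ofReal (∑ i ∈ S, μ.real (s ∩ (shiftMap X)^[N + i] ⁻¹' t)) := by
    rw [ENNReal.ofReal_sum_of_nonneg fun _ _ => measureReal_nonneg]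
    exact Finset.sum_congr rfl fun _ _ => by rw [ofReal_measureReal]
  have e3 : (ε : ℝ≥0∞) = ENNReal.ofReal ε := by simp
  have e4 : 0 ≤ ∑ i ∈ S, μ.real (s ∩ (shiftMap X)^[N + i] ⁻¹' t) :=
    Finset.sum_nonneg fun _ _ => measureReal_nonneg
  rw [e1, e2, e3, ← ENNReal.ofReal_add e4 (NNReal.coe_nonneg ε)]
  exact ENNReal.ofReal_le_ofReal (by linarith)

/-- An invariant set `s` has correlation `0` with its complement, so `μ s * μ sᶜ = 0`. -/
theorem ergodic_of_correlation {μ : Measure X.carrier} [IsProbabilityMeasure μ]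
    (hμ : MeasurePreserving (shiftMap X) μ μ) {e : ℝ} (he : 0 < e)
    (hcyl : ∀ I J, ∀ᶠ N in atTop, e * (cylMeasure X μ I * cylMeasure X μ J) ≤
      ∑ i ∈ S, μ.real (cyl X I ∩ (shiftMap X)^[N + i] ⁻¹' cyl X J)) :
    Ergodic (shiftMap X) μ := by
  refine ⟨hμ, ⟨fun s hs hinv => ?_⟩⟩
  have hpre : ∀ k, (shiftMap X)^[k] ⁻¹' s = s := by
    intro k
    induction k with
    | zero => rfl
    | succ k ih => rw [Function.iterate_succ', Set.preimage_comp, hinv, ih]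
  have h0 : e * (μ.real s * μ.real sᶜ) ≤ 0 := by
    refine le_of_forall_pos_le_add fun ε hε => ?_
    obtain ⟨N, hN⟩ := (correlation_of_cyl hμ he hcyl hs hs.compl hε).exists
    simp only [Set.preimage_compl, hpre, Set.inter_compl_self, measureReal_empty,
      Finset.sum_const_zero] at hN
    linarith
  have h1 : μ.real s * μ.real sᶜ = 0 := by
    refine le_antisymm ?_ (mul_nonneg measureReal_nonneg measureReal_nonneg)
    by_contra hcon
    have := mul_pos he (not_le.1 hcon)
    linarith
  rw [eventuallyConst_set']
  rcases mul_eq_zero.1 h1 with h | h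
  · left
    rw [measureReal_eq_zero_iff] at h
    exact ae_eq_empty.2 h
  · right
    rw [measureReal_eq_zero_iff] at h
    exact ae_eq_univ.2 h

end Gibbs

/-! ### Bounded relative entropy and absolute continuity -/

section AbsolutelyContinuous

variable {A : Type*} [Finite A] [TopologicalSpace A] [DiscreteTopology A]
  [MeasurableSpace A] [BorelSpace A] {X : Subshift A ℕ}

/-- A set of small `μ`-measure has small `η`-measure, quantitatively: the words in `s` contribute at
least `η(s) log M - M μ(s)` to the relative entropy, the others at least `-1`. -/
theorem mul_log_le_of_relEntropy_le {η μ : Measure X.carrier} [IsProbabilityMeasure η]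
    [IsProbabilityMeasure μ] {C : ℝ} (hsupp : ∀ I, 0 < cylMeasure X η I → 0 < cylMeasure X μ I)
    (hC : ∀ n, relEntropy n (cylMeasure X η) (cylMeasure X μ) ≤ C) {M : ℝ} (hM : 1 ≤ M)
    {s : Set X.carrier} (hs : s ∈ cylinderSets X) :
    η.real s * Real.log M ≤ C + 1 + M * μ.real s := by
  classical
  obtain ⟨n, hn⟩ := hs
  have hM0 : 0 < M := by linarith
  set F := (allWords A n).filter fun I => cyl X I ⊆ s with hF
  set G := (allWords A n).filter fun I => ¬ cyl X I ⊆ s with hG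
  set g := cylMeasure X η
  set f := cylMeasure X μ
  have hg0 : ∀ I, 0 ≤ g I := cylMeasure_nonneg X η
  have hf0 : ∀ I, 0 ≤ f I := cylMeasure_nonneg X μ
  have hηs : η.real s = ∑ I ∈ F, g I := measureReal_eq_sum_cyl X η hn
  have hμs : μ.real s = ∑ I ∈ F, f I := measureReal_eq_sum_cyl X μ hn
  have hsplit : relEntropy n g f = ∑ I ∈ F, g I * (Real.log (g I) - Real.log (f I)) +
      ∑ I ∈ G, g I * (Real.log (g I) - Real.log (f I)) :=
    (Finset.sum_filter_add_sum_filter_not _ _ _).symm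
  have h1 : ∑ I ∈ F, g I * Real.log M - ∑ I ∈ F, M * f I ≤
      ∑ I ∈ F, g I * (Real.log (g I) - Real.log (f I)) := by
    rw [← Finset.sum_sub_distrib]
    refine Finset.sum_le_sum fun I _ => ?_
    have e := sub_le_mul_log_sub (hg0 I) (mul_nonneg hM0.le (hf0 I))
      fun hp => mul_pos hM0 (hsupp I hp)
    rcases (hg0 I).eq_or_lt with hz | hz
    · rw [← hz] at e ⊢
      simp only [zero_mul] at e ⊢
      linarith
    · rw [Real.log_mul hM0.ne' (hsupp I hz).ne'] at e
      have := hg0 I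
      linarith
  have h2 : -1 ≤ ∑ I ∈ G, g I * (Real.log (g I) - Real.log (f I)) := by
    have e1 := Finset.sum_le_sum fun I (_ : I ∈ G) => sub_le_mul_log_sub (hg0 I) (hf0 I) (hsupp I)
    rw [Finset.sum_sub_distrib] at e1
    have e2 : ∑ I ∈ G, f I ≤ ∑ I ∈ allWords A n, f I :=
      Finset.sum_le_sum_of_subset_of_nonneg (Finset.filter_subset _ _) fun I _ _ => hf0 I
    rw [sum_cylMeasure] at e2
    have e3 : 0 ≤ ∑ I ∈ G, g I := Finset.sum_nonneg fun I _ => hg0 I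
    linarith
  rw [← Finset.sum_mul, ← Finset.mul_sum, ← hηs, ← hμs] at h1
  have := hC n
  linarith

/-- If the relative entropies of `η` with respect to `μ` on cylinders are bounded, then `η` is
absolutely continuous with respect to `μ`: the bound `η(s) log M ≤ C + 1 + M μ(s)` holds for
cylinder sets, hence for all Borel sets, and `M` is arbitrary. -/
theorem absolutelyContinuous_of_relEntropy_le {η μ : Measure X.carrier} [IsProbabilityMeasure η]
    [IsProbabilityMeasure μ] {C : ℝ} (hsupp : ∀ I, 0 < cylMeasure X η I → 0 < cylMeasure X μ I)
    (hC : ∀ n, relEntropy n (cylMeasure X η) (cylMeasure X μ) ≤ C) : η ≪ μ := by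
  refine Measure.AbsolutelyContinuous.mk fun s hs hμs => ?_
  have key : ∀ M : ℝ, 1 ≤ M → η.real s * Real.log M ≤ C + 1 := by
    intro M hM
    refine le_of_forall_pos_le_add fun ε hε => ?_
    have hlog := Real.log_nonneg hM
    -- replacing `s` by a cylinder set costs `δ` in each measure, hence `ε` in the inequality
    set δ := ε / (Real.log M + M) with hδ
    have hδ0 : 0 < δ := div_pos hε (by linarith)
    obtain ⟨t, ht, hlt⟩ := exists_cylinderSet_symmDiff_lt X (η + μ) hs (ENNReal.ofReal_pos.2 hδ0)
    have h1 : η.real (symmDiff t s) ≤ δ := ENNReal.toReal_le_of_le_ofReal hδ0.le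
      (le_trans (by simp [Measure.add_apply]) hlt.le)
    have h2 : μ.real (symmDiff t s) ≤ δ := ENNReal.toReal_le_of_le_ofReal hδ0.le
      (le_trans (by simp [Measure.add_apply]) hlt.le)
    have h3 : η.real s ≤ η.real t + δ := by
      have hsub : s ⊆ t ∪ symmDiff t s := by
        intro x hx
        simp only [Set.mem_union, Set.mem_symmDiff]
        tauto
      have := (measureReal_mono (μ := η) hsub).trans (measureReal_union_le _ _)
      linarith
    have h4 : μ.real t ≤ δ := by
      have hsub : t ⊆ s ∪ symmDiff t s := by
        intro x hx
        simp only [Set.mem_union, Set.mem_symmDiff]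
        tauto
      have h5 := (measureReal_mono (μ := μ) hsub).trans (measureReal_union_le _ _)
      have h6 : μ.real s = 0 := by rw [measureReal_def, hμs]; rfl
      linarith
    have h5 := mul_log_le_of_relEntropy_le hsupp hC hM ht
    have h6 : (Real.log M + M) * δ = ε := by
      rw [hδ]; field_simp
    have h7 := mul_le_mul_of_nonneg_right h3 hlog
    have h8 := mul_le_mul_of_nonneg_left h4 (by linarith : (0 : ℝ) ≤ M)
    linarith
  have h0 : η.real s = 0 := by
    refine le_antisymm (not_lt.1 fun hpos => ?_) measureReal_nonneg
    set x := |C + 2| / η.real s with hx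
    have hx0 : 0 ≤ x := by positivity
    have h1 := key (Real.exp x) (Real.one_le_exp hx0)
    rw [Real.log_exp, hx, mul_div_cancel₀ _ hpos.ne'] at h1
    have := le_abs_self (C + 2)
    linarith
  exact (measureReal_eq_zero_iff (measure_ne_top _ _)).1 h0

end AbsolutelyContinuous

/-! ### Entropy and potential of an invariant measure through words -/

section Words

variable {A : Type*} [Finite A] [TopologicalSpace A]

theorem mem_words (X : Subshift A ℕ) {n : ℕ} {I : List A} :
    I ∈ words X n ↔ I ∈ language X ∧ I.length = n := by
  simp [words]

theorem sum_words_eq {M : Type*} [AddCommMonoid M] (X : Subshift A ℕ) (n : ℕ) (F : List A → M)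
    (hF : ∀ I ∉ language X, F I = 0) : ∑ I ∈ words X n, F I = ∑ I ∈ allWords A n, F I := by
  refine Finset.sum_subset (fun I hI => ?_) fun I hI hI' => hF I fun hl => ?_
  · rw [mem_allWords]
    exact ((mem_words X).1 hI).2
  · exact hI' ((mem_words X).2 ⟨hl, mem_allWords.1 hI⟩)

variable [DiscreteTopology A] [MeasurableSpace A] [BorelSpace A]

theorem sum_words_mul_log (X : Subshift A ℕ) (η : Measure X.carrier) (n : ℕ) :
    ∑ I ∈ words X n, η.real (cyl X I) * Real.log (η.real (cyl X I)) =
      -wordEntropy n (cylMeasure X η) := by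
  rw [sum_words_eq X n _ fun I hI => by rw [cyl_eq_empty X hI]; simp, wordEntropy,
    ← Finset.sum_neg_distrib]
  refine Finset.sum_congr rfl fun I _ => ?_
  rw [Real.negMulLog, cylMeasure]
  ring

/-- The entropy of an invariant measure is a limit, and by subadditivity a lower bound. -/
theorem entropy_spec (X : Subshift A ℕ) {η : Measure X.carrier} (hη : η ∈ invariantMeasures X) :
    Tendsto (fun n : ℕ => wordEntropy n (cylMeasure X η) / n) atTop (nhds (entropy X η)) ∧
      ∀ n : ℕ, n * entropy X η ≤ wordEntropy n (cylMeasure X η) := by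
  have := hη.1
  set H := fun n : ℕ => wordEntropy n (cylMeasure X η) with hH
  have hsub : Subadditive H := by
    intro m n
    have := wordEntropy_add_le m n (cylMeasure_nonneg X η) (sum_cylMeasure X η (m + n))
    simp only [sum_cylMeasure_append_right, sum_cylMeasure_append_left X hη.2] at this
    exact this
  have h0 : ∀ n, 0 ≤ H n := fun n =>
    wordEntropy_nonneg (cylMeasure_nonneg X η) (sum_cylMeasure X η n)
  have hbdd : BddBelow (Set.range fun n : ℕ => H n / n) := ⟨0, by
    rintro _ ⟨n, rfl⟩
    exact div_nonneg (h0 n) (Nat.cast_nonneg n)⟩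
  have hlim := hsub.tendsto_lim hbdd
  have hent : entropy X η = hsub.lim := by
    rw [entropy, ← hlim.limsup_eq]
    congr 1
    funext n
    rw [sum_words_mul_log, hH]
    simp only
    rw [mul_neg, neg_neg, div_eq_inv_mul]
  rw [hent]
  refine ⟨hlim, fun n => ?_⟩
  rcases Nat.eq_zero_or_pos n with rfl | hn
  · simpa using h0 0
  · have := hsub.lim_le_div hbdd hn.ne'
    rw [le_div_iff₀ (Nat.cast_pos.2 hn)] at this
    linarith

theorem lintegral_initialWord (X : Subshift A ℕ) (η : Measure X.carrier) (n : ℕ)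
    (G : List A → ℝ≥0∞) :
    ∫⁻ x, G (initialWord x.1 n) ∂η = ∑ I ∈ allWords A n, G I * η (cyl X I) := by
  classical
  have h : ∀ x : X.carrier, G (initialWord x.1 n) =
      ∑ I ∈ allWords A n, (cyl X I).indicator (fun _ => G I) x := by
    intro x
    rw [Finset.sum_eq_single_of_mem (initialWord x.1 n) (by simp [length_initialWord])]
    · rw [Set.indicator_of_mem (mem_cyl_initialWord X x n)]
    · intro I hI hne
      refine Set.indicator_of_notMem (fun hx => hne ?_) _
      rw [mem_cyl_iff, mem_allWords.1 hI] at hx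
      exact hx.symm
  simp_rw [h]
  rw [lintegral_finsetSum _ fun I _ => measurable_const.indicator (measurableSet_cyl X I)]
  exact Finset.sum_congr rfl fun I _ => lintegral_indicator_const (measurableSet_cyl X I) _

/-- The integral of `log φ_n` is a finite sum when `φ` is positive on the words charged by `η`. -/
theorem erealIntegral_log (X : Subshift A ℕ) (η : Measure X.carrier) [IsProbabilityMeasure η]
    (φ : List A → ℝ) (n : ℕ)
    (hpos : ∀ I : List A, I.length = n → 0 < cylMeasure X η I → 0 < φ I) :
    erealIntegral η (fun x => ENNReal.log (ENNReal.ofReal (generatedPotential X φ n x))) =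
      ((wordMean φ n (cylMeasure X η) : ℝ) : EReal) := by
  have key : ∀ (σ : ℝ → ℝ) (G : EReal → EReal), (∀ r : ℝ, G r = (σ r : ℝ)) →
      ∫⁻ x, (G (ENNReal.log (ENNReal.ofReal (φ (initialWord x.1 n))))).toENNReal ∂η =
      ENNReal.ofReal (∑ I ∈ allWords A n, cylMeasure X η I * max (σ (Real.log (φ I))) 0) := by
    intro σ G hG
    rw [lintegral_initialWord X η n
      (fun I => (G (ENNReal.log (ENNReal.ofReal (φ I)))).toENNReal),
      ENNReal.ofReal_sum_of_nonneg fun I _ =>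
        mul_nonneg (cylMeasure_nonneg X η I) (le_max_right _ _)]
    refine Finset.sum_congr rfl fun I hI => ?_
    rw [mem_allWords] at hI
    rcases (cylMeasure_nonneg X η I).eq_or_lt with hz | hz
    · rw [← hz, zero_mul, ENNReal.ofReal_zero]
      rw [cylMeasure, eq_comm, measureReal_eq_zero_iff] at hz
      rw [hz, mul_zero]
    · have hφ := hpos I hI hz
      rw [ENNReal.log_ofReal_of_pos hφ, hG, EReal.toENNReal_of_ne_top (EReal.coe_ne_top _),
        EReal.toReal_coe, mul_comm, ENNReal.ofReal_mul (cylMeasure_nonneg X η I), cylMeasure,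
        ofReal_measureReal]
      congr 1
      rw [ENNReal.ofReal_max, ENNReal.ofReal_zero, max_eq_left zero_le]
  have e1 := key id id fun r => rfl
  have e2 := key (fun r => -r) (fun r => -r) fun r => by simp
  simp only [id] at e1
  rw [erealIntegral]
  simp only [generatedPotential]
  rw [e1, e2, EReal.coe_ennreal_ofReal, EReal.coe_ennreal_ofReal, ← EReal.coe_sub]
  congr 1
  rw [max_eq_left (Finset.sum_nonneg fun I _ => mul_nonneg (cylMeasure_nonneg X η I)
    (le_max_right _ _)), max_eq_left (Finset.sum_nonneg fun I _ =>
    mul_nonneg (cylMeasure_nonneg X η I) (le_max_right _ _)), ← Finset.sum_sub_distrib, wordMean]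
  refine Finset.sum_congr rfl fun I _ => ?_
  rw [← mul_sub]
  congr 1
  rcases le_total 0 (Real.log (φ I)) with h | h
  · rw [max_eq_left h, max_eq_right (neg_nonpos.2 h), sub_zero]
  · rw [max_eq_right h, max_eq_left (neg_nonneg.2 h), zero_sub, neg_neg]

/-- The integral of `log φ_n` is `-∞` as soon as `η` charges a word on which `φ` vanishes. -/
theorem erealIntegral_log_eq_bot (X : Subshift A ℕ) (η : Measure X.carrier)
    [IsProbabilityMeasure η] (φ : List A → ℝ) (n : ℕ)
    (hzero : ∃ I : List A, I.length = n ∧ 0 < cylMeasure X η I ∧ φ I ≤ 0) :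
    erealIntegral η (fun x => ENNReal.log (ENNReal.ofReal (generatedPotential X φ n x))) = ⊥ := by
  have e1 : ∫⁻ x : X.carrier,
      (-ENNReal.log (ENNReal.ofReal (φ (initialWord x.1 n)))).toENNReal ∂η = ⊤ := by
    rw [lintegral_initialWord X η n
      (fun I => (-ENNReal.log (ENNReal.ofReal (φ I))).toENNReal)]
    obtain ⟨I, hI, hpos, hle⟩ := hzero
    rw [ENNReal.sum_eq_top]
    refine ⟨I, by simpa using hI, ?_⟩
    rw [ENNReal.ofReal_of_nonpos hle, ENNReal.log_zero, EReal.neg_bot, EReal.toENNReal_top]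
    refine ENNReal.top_mul fun h0 => ?_
    rw [cylMeasure, measureReal_def, h0] at hpos
    exact lt_irrefl _ hpos
  rw [erealIntegral]
  simp only [generatedPotential]
  rw [e1]
  exact EReal.sub_top _

end Words

/-! ### The weighted variational inequality -/

section Potential

variable {A : Type*} [Finite A] [TopologicalSpace A] [DiscreteTopology A]
  [MeasurableSpace A] [BorelSpace A]

theorem potentialLimit_eq (X : Subshift A ℕ) (η : Measure X.carrier) [IsProbabilityMeasure η]
    (φ : List A → ℝ) (hpos : ∀ I, 0 < cylMeasure X η I → 0 < φ I) :
    potentialLimit X (generatedPotential X φ) η =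
      limsup (fun n : ℕ => ((wordMean φ n (cylMeasure X η) / n : ℝ) : EReal)) atTop := by
  rw [potentialLimit]
  congr 1
  funext n
  rw [erealIntegral_log X η φ n fun I _ hI => hpos I hI, ← EReal.coe_mul, div_eq_inv_mul]

/-- If `φ` vanishes on all charged extensions of a charged word, then `∫ log φ_n = -∞` for all large
`n`. -/
theorem potentialLimit_eq_bot (X : Subshift A ℕ) (η : Measure X.carrier) [IsProbabilityMeasure η]
    (φ : List A → ℝ)
    (hzero : ∃ I : List A, 0 < cylMeasure X η I ∧ ∀ V, 0 < cylMeasure X η (I ++ V) →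
      φ (I ++ V) ≤ 0) :
    potentialLimit X (generatedPotential X φ) η = ⊥ := by
  obtain ⟨I, hI, hV⟩ := hzero
  rw [potentialLimit]
  refine Tendsto.limsup_eq (tendsto_const_nhds.congr' ?_)
  filter_upwards [eventually_ge_atTop (I.length + 1)] with n hn
  rw [erealIntegral_log_eq_bot X η φ n]
  · rw [EReal.coe_mul_bot_of_pos]
    have : (0 : ℝ) < n := Nat.cast_pos.2 (by omega)
    positivity
  · have hsum := sum_cylMeasure_append_right X η I (n - I.length)
    obtain ⟨V, hVl, hVpos⟩ : ∃ V ∈ allWords A (n - I.length), 0 < cylMeasure X η (I ++ V) := by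
      by_contra! hcon
      have := Finset.sum_nonpos hcon
      linarith
    rw [mem_allWords] at hVl
    exact ⟨I ++ V, by rw [List.length_append]; omega, hVpos, hV V hVpos⟩

/-- The power `φ ^ (1 / a₁)` on the language of `X`, extended by zero to all words. -/
def rootWeight (X : Subshift A ℕ) (a₁ : ℝ) (φ : List A → ℝ) (I : List A) : ℝ :=
  open Classical in if I ∈ language X then φ I ^ (1 / a₁) else 0

theorem rootWeight_of_mem {X : Subshift A ℕ} {a₁ : ℝ} {φ : List A → ℝ} {I : List A}
    (hI : I ∈ language X) : rootWeight X a₁ φ I = φ I ^ (1 / a₁) := if_pos hI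

theorem rootWeight_of_notMem {X : Subshift A ℕ} {a₁ : ℝ} {φ : List A → ℝ} {I : List A}
    (hI : I ∉ language X) : rootWeight X a₁ φ I = 0 := if_neg hI

theorem rootWeight_pos_iff {X : Subshift A ℕ} {a₁ : ℝ} (ha₁ : 0 < a₁) {φ : List A → ℝ}
    (hφ : ∀ I ∈ language X, 0 ≤ φ I) {I : List A} :
    0 < rootWeight X a₁ φ I ↔ I ∈ language X ∧ 0 < φ I := by
  by_cases hI : I ∈ language X
  · rw [rootWeight_of_mem hI]
    refine ⟨fun h => ⟨hI, lt_of_le_of_ne (hφ I hI) fun h0 => ?_⟩, fun h =>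
      Real.rpow_pos_of_pos h.2 _⟩
    rw [← h0, Real.zero_rpow (one_div_pos.2 ha₁).ne'] at h
    exact lt_irrefl _ h
  · rw [rootWeight_of_notMem hI]
    simp [hI]

theorem wordMean_rootWeight {X : Subshift A ℕ} {a₁ : ℝ} (ha₁ : 0 < a₁) {φ : List A → ℝ}
    (hφ : ∀ I ∈ language X, 0 ≤ φ I) (η : Measure X.carrier) (n : ℕ) :
    wordMean φ n (cylMeasure X η) =
      a₁ * wordMean (rootWeight X a₁ φ) n (cylMeasure X η) := by
  rw [wordMean, wordMean, Finset.mul_sum]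
  refine Finset.sum_congr rfl fun I _ => ?_
  by_cases hI : I ∈ language X
  · rw [rootWeight_of_mem hI]
    rcases (hφ I hI).eq_or_lt with h0 | h0
    · rw [← h0, Real.zero_rpow (one_div_pos.2 ha₁).ne']
      simp
    · rw [Real.log_rpow h0]
      field_simp
  · rw [cylMeasure_of_notMem X η hI]
    simp

end Potential

section Factor

variable {A B : Type*} [Finite A] [TopologicalSpace A] [DiscreteTopology A]
  [MeasurableSpace A] [BorelSpace A] [Finite B] [TopologicalSpace B] [DiscreteTopology B]
  [MeasurableSpace B] [BorelSpace B] {X : Subshift A ℕ} {Y : Subshift B ℕ}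
  {π : X.carrier → Y.carrier} {b : A → B}

theorem IsOneBlockFactorMap.initialWord_map (hπ : IsOneBlockFactorMap X Y π b) (x : X.carrier)
    (n : ℕ) : initialWord (π x).1 n = (initialWord x.1 n).map b := by
  simp only [initialWord, List.map_ofFn]
  congr 1
  funext i
  exact hπ.oneBlock x i

theorem IsOneBlockFactorMap.cylMeasure_map (hπ : IsOneBlockFactorMap X Y π b)
    (η : Measure X.carrier) [IsFiniteMeasure η] (J : List B) :
    cylMeasure Y (η.map π) J = push b (cylMeasure X η) J := by
  rw [cylMeasure, map_measureReal_apply hπ.continuous.measurable (measurableSet_cyl Y J), push]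
  have : π ⁻¹' cyl Y J = ⋃ I ∈ fiber b J, cyl X I := by
    ext x
    simp only [Set.mem_preimage, mem_cyl_iff, Set.mem_iUnion, mem_fiber, exists_prop,
      hπ.initialWord_map]
    constructor
    · intro h
      exact ⟨_, h, by rw [length_initialWord]⟩
    · rintro ⟨I, rfl, h⟩
      rw [List.length_map, h]
  rw [this, measureReal_biUnion_finset]
  · rfl
  · exact pairwiseDisjoint_cyl X (n := J.length) _ fun I hI => by
      rw [Finset.mem_coe, mem_fiber] at hI
      rw [← hI, List.length_map]
  · exact fun I _ => measurableSet_cyl X I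

theorem IsOneBlockFactorMap.map_mem_invariantMeasures (hπ : IsOneBlockFactorMap X Y π b)
    {η : Measure X.carrier} (hη : η ∈ invariantMeasures X) : η.map π ∈ invariantMeasures Y := by
  have := hη.1
  have hm := hπ.continuous.measurable
  have hX := measurable_shiftMap X
  have hY := measurable_shiftMap Y
  refine ⟨Measure.isProbabilityMeasure_map hm.aemeasurable, hY, ?_⟩
  rw [Measure.map_map hY hm, ← hπ.semiconj.comp_eq, ← Measure.map_map hm hX, hη.2.map_eq]

variable {a₁ a₂ : ℝ} {φ : List A → ℝ} {S : Finset ℕ} {c : ℝ}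

/-- Multiplied by `a₁`, the energy of `ψ = φ ^ (1 / a₁)` is the weighted free energy at level `n`. -/
theorem mul_energy_eq (ha₁ : 0 < a₁) (hφ : ∀ I ∈ language X, 0 ≤ φ I) (η : Measure X.carrier)
    (n : ℕ) : a₁ * energy b (a₂ / a₁) (rootWeight X a₁ φ) n (cylMeasure X η) =
      wordMean φ n (cylMeasure X η) + (a₁ * wordEntropy n (cylMeasure X η) +
        a₂ * wordEntropy n (push b (cylMeasure X η))) := by
  rw [wordMean_rootWeight ha₁ hφ, energy]
  field_simp
  ring

/-- The exponent `κ = a₁ / (a₁ + a₂)` of the fibre sums and the weight `β = a₂ / a₁`. -/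
theorem kappa_facts (ha₁ : 0 < a₁) (ha₂ : 0 ≤ a₂) :
    0 < a₁ / (a₁ + a₂) ∧ a₁ / (a₁ + a₂) ≤ 1 ∧ 0 ≤ a₂ / a₁ ∧
      a₁ / (a₁ + a₂) * (1 + a₂ / a₁) = 1 := by
  have h : 0 < a₁ + a₂ := by linarith
  refine ⟨div_pos ha₁ h, (div_le_one h).2 (by linarith), div_nonneg ha₂ ha₁.le, ?_⟩
  field_simp

/-- The weighted sum of the entropies is the limit of the weighted sums of word entropies. -/
theorem IsOneBlockFactorMap.tendsto_entropies (hπ : IsOneBlockFactorMap X Y π b) (a₁ a₂ : ℝ)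
    {η : Measure X.carrier} (hη : η ∈ invariantMeasures X) :
    Tendsto (fun n : ℕ => (a₁ * wordEntropy n (cylMeasure X η) +
        a₂ * wordEntropy n (push b (cylMeasure X η))) / n) atTop
      (nhds (a₁ * entropy X η + a₂ * entropy Y (η.map π))) := by
  have := hη.1
  have h1 := (entropy_spec X hη).1
  have h2 := (entropy_spec Y (hπ.map_mem_invariantMeasures hη)).1
  rw [show cylMeasure Y (η.map π) = push b (cylMeasure X η) from
    funext fun J => hπ.cylMeasure_map η J] at h2
  refine ((h1.const_mul a₁).add (h2.const_mul a₂)).congr fun n => ?_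
  ring

/-- A measure charging a word of zero weight has free energy `-∞`. -/
theorem pos_of_freeEnergy_ne_bot (h : GluingWeight S c (rootWeight X a₁ φ)) (ha₁ : 0 < a₁)
    (hφ : ∀ I ∈ language X, 0 ≤ φ I) {η : Measure X.carrier} (hη : η ∈ invariantMeasures X)
    (hne : weightedFreeEnergy X Y π a₁ a₂ (generatedPotential X φ) η ≠ ⊥) :
    ∀ I, 0 < cylMeasure X η I → 0 < rootWeight X a₁ φ I := by
  have := hη.1
  by_contra! hcon
  obtain ⟨I, hI, hle⟩ := hcon
  refine hne ?_
  rw [weightedFreeEnergy, potentialLimit_eq_bot X η φ ⟨I, hI, fun V hV => ?_⟩, EReal.bot_add]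
  by_contra hpos
  have hmem : I ++ V ∈ language X := by
    by_contra hn
    rw [cylMeasure_of_notMem X η hn] at hV
    exact lt_irrefl _ hV
  have := (rootWeight_pos_iff ha₁ hφ).2 ⟨hmem, not_le.1 hpos⟩
  exact absurd (h.pos_of_append this).1 (not_lt.2 hle)

theorem add_coe_le_coe_of_le_sub {x : EReal} {r v : ℝ} (h : x ≤ ((r - v : ℝ) : EReal)) :
    x + (v : EReal) ≤ (r : EReal) := by
  calc x + (v : EReal) ≤ ((r - v : ℝ) : EReal) + (v : EReal) := by gcongr
    _ = (r : EReal) := by rw [← EReal.coe_add, sub_add_cancel]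

/-- The variational inequality. -/
theorem weightedFreeEnergy_le (hπ : IsOneBlockFactorMap X Y π b)
    (h : GluingWeight S c (rootWeight X a₁ φ)) (ha₁ : 0 < a₁) (ha₂ : 0 ≤ a₂)
    (hφ : ∀ I ∈ language X, 0 ≤ φ I) {P C : ℝ}
    (hP : ∀ n : ℕ, |Real.log (partitionSum b (a₁ / (a₁ + a₂)) (rootWeight X a₁ φ) n) - n * P| ≤ C)
    {η : Measure X.carrier} (hη : η ∈ invariantMeasures X) :
    weightedFreeEnergy X Y π a₁ a₂ (generatedPotential X φ) η ≤ (((a₁ + a₂) * P : ℝ) : EReal) := by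
  have := hη.1
  by_cases hbot : weightedFreeEnergy X Y π a₁ a₂ (generatedPotential X φ) η = ⊥
  · rw [hbot]; exact bot_le
  have hsupp := pos_of_freeEnergy_ne_bot h ha₁ hφ hη hbot
  obtain ⟨hκ0, hκ1, hβ, hκβ⟩ := kappa_facts ha₁ ha₂
  rw [weightedFreeEnergy, potentialLimit_eq X η φ fun I hI =>
    ((rootWeight_pos_iff ha₁ hφ).1 (hsupp I hI)).2]
  refine add_coe_le_coe_of_le_sub ?_
  have hv := hπ.tendsto_entropies a₁ a₂ hη
  have hz : Tendsto (fun n : ℕ => (a₁ + a₂) * (P + C / n)) atTop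
      (nhds ((a₁ + a₂) * (P + 0))) :=
    ((tendsto_const_nhds.div_atTop tendsto_natCast_atTop_atTop).const_add P).const_mul _
  rw [add_zero] at hz
  rw [← (continuous_coe_real_ereal.continuousAt.tendsto.comp (hz.sub hv)).limsup_eq]
  refine limsup_le_limsup ?_
  filter_upwards [eventually_gt_atTop 0] with n hn
  have hn' : (0 : ℝ) < n := Nat.cast_pos.2 hn
  refine EReal.coe_le_coe_iff.2 ?_
  have e1 := h.energy_le b hκ0 hβ hκβ n (cylMeasure_nonneg X η) (sum_cylMeasure X η n)
    fun I _ hI => hsupp I hI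
  have e2 := mul_energy_eq (b := b) (a₂ := a₂) ha₁ hφ η n
  have e3 := mul_le_mul_of_nonneg_left e1 ha₁.le
  rw [e2] at e3
  have e4 : Real.log (partitionSum b (a₁ / (a₁ + a₂)) (rootWeight X a₁ φ) n) ≤ n * P + C := by
    have := (abs_le.1 (hP n)).2
    linarith
  have e5 : a₁ * ((1 + a₂ / a₁) *
      Real.log (partitionSum b (a₁ / (a₁ + a₂)) (rootWeight X a₁ φ) n)) ≤
      (a₁ + a₂) * (n * P + C) := by
    rw [← mul_assoc, show a₁ * (1 + a₂ / a₁) = a₁ + a₂ by field_simp]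
    exact mul_le_mul_of_nonneg_left e4 (by linarith)
  rw [le_sub_iff_add_le, ← add_div, div_le_iff₀ hn']
  have e6 : (a₁ + a₂) * (P + C / n) * n = (a₁ + a₂) * (n * P + C) := by field_simp
  linarith

/-- A measure whose energies grow at the maximal rate has maximal free energy. -/
theorem le_weightedFreeEnergy (hπ : IsOneBlockFactorMap X Y π b) (ha₁ : 0 < a₁)
    (hφ : ∀ I ∈ language X, 0 ≤ φ I) {P C : ℝ} {η : Measure X.carrier}
    (hη : η ∈ invariantMeasures X)
    (hsupp : ∀ I, 0 < cylMeasure X η I → 0 < rootWeight X a₁ φ I)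
    (hC : ∀ n : ℕ, n * ((1 + a₂ / a₁) * P) + C ≤
      energy b (a₂ / a₁) (rootWeight X a₁ φ) n (cylMeasure X η)) :
    (((a₁ + a₂) * P : ℝ) : EReal) ≤
      weightedFreeEnergy X Y π a₁ a₂ (generatedPotential X φ) η := by
  have := hη.1
  rw [weightedFreeEnergy, potentialLimit_eq X η φ fun I hI =>
    ((rootWeight_pos_iff ha₁ hφ).1 (hsupp I hI)).2]
  have hv := hπ.tendsto_entropies a₁ a₂ hη
  set v := a₁ * entropy X η + a₂ * entropy Y (η.map π) with hvdef
  have hz : Tendsto (fun n : ℕ => (a₁ + a₂) * P + a₁ * C / n) atTop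
      (nhds ((a₁ + a₂) * P + 0)) :=
    (tendsto_const_nhds.div_atTop tendsto_natCast_atTop_atTop).const_add _
  rw [add_zero] at hz
  have hle : (((a₁ + a₂) * P - v : ℝ) : EReal) ≤
      limsup (fun n : ℕ => ((wordMean φ n (cylMeasure X η) / n : ℝ) : EReal)) atTop := by
    rw [← (continuous_coe_real_ereal.continuousAt.tendsto.comp (hz.sub hv)).limsup_eq]
    refine limsup_le_limsup ?_
    filter_upwards [eventually_gt_atTop 0] with n hn
    have hn' : (0 : ℝ) < n := Nat.cast_pos.2 hn
    refine EReal.coe_le_coe_iff.2 ?_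
    have e1 := mul_le_mul_of_nonneg_left (hC n) ha₁.le
    rw [mul_energy_eq ha₁ hφ] at e1
    rw [sub_le_iff_le_add, ← add_div, le_div_iff₀ hn']
    have e2 : ((a₁ + a₂) * P + a₁ * C / n) * n = a₁ * (n * ((1 + a₂ / a₁) * P) + C) := by
      field_simp
    linarith
  calc (((a₁ + a₂) * P : ℝ) : EReal) = (((a₁ + a₂) * P - v : ℝ) : EReal) + (v : EReal) := by
        rw [← EReal.coe_add, sub_add_cancel]
    _ ≤ _ := by gcongr

/-- For a measure of maximal free energy, each of the terms of the energy is, by subadditivity,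
bounded below by its linear asymptotics up to a constant. -/
theorem of_weightedFreeEnergy_eq (h : GluingWeight S c (rootWeight X a₁ φ)) (ha₁ : 0 < a₁)
    (hφ : ∀ I ∈ language X, 0 ≤ φ I) {r : ℝ} {η : Measure X.carrier}
    (hη : η ∈ invariantMeasures X)
    (heq : weightedFreeEnergy X Y π a₁ a₂ (generatedPotential X φ) η = (r : EReal)) :
    (∀ I, 0 < cylMeasure X η I → 0 < rootWeight X a₁ φ I) ∧
      ∃ t : ℝ, potentialLimit X (generatedPotential X φ) η = (t : EReal) ∧
        t + (a₁ * entropy X η + a₂ * entropy Y (η.map π)) = r ∧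
        ∀ n : ℕ, n * t + a₁ * Real.log c ≤ wordMean φ n (cylMeasure X η) := by
  have := hη.1
  have hne : weightedFreeEnergy X Y π a₁ a₂ (generatedPotential X φ) η ≠ ⊥ := by
    rw [heq]; exact EReal.coe_ne_bot r
  have hsupp := pos_of_freeEnergy_ne_bot h ha₁ hφ hη hne
  refine ⟨hsupp, ?_⟩
  set v := a₁ * entropy X η + a₂ * entropy Y (η.map π) with hvdef
  rw [weightedFreeEnergy] at heq
  obtain ⟨t, ht⟩ : ∃ t : ℝ, potentialLimit X (generatedPotential X φ) η = (t : EReal) := by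
    rcases hx : potentialLimit X (generatedPotential X φ) η with _ | t
    · rw [hx] at heq
      exact absurd (EReal.bot_add _ ▸ heq.symm) (EReal.coe_ne_bot r)
    · rcases t with _ | t
      · rw [hx] at heq
        exact absurd ((EReal.top_add_coe _).symm.trans heq).symm (EReal.coe_ne_top r)
      · exact ⟨t, rfl⟩
  refine ⟨t, ht, ?_, ?_⟩
  · rw [ht, ← EReal.coe_add] at heq
    exact EReal.coe_injective heq
  · rw [potentialLimit_eq X η φ fun I hI =>
      ((rootWeight_pos_iff ha₁ hφ).1 (hsupp I hI)).2] at ht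
    set U := fun n : ℕ => wordMean φ n (cylMeasure X η) + a₁ * -Real.log c with hU
    have hU0 : 0 ≤ a₁ * -Real.log c := mul_nonneg ha₁.le h.neg_log_nonneg
    have hsub : Subadditive U := by
      intro m n
      have e := h.wordMean_add_le m n (cylMeasure_nonneg X η) (sum_cylMeasure X η (m + n))
        fun I _ hI => hsupp I hI
      simp only [sum_cylMeasure_append_right, sum_cylMeasure_append_left X hη.2] at e
      have e2 := mul_le_mul_of_nonneg_left e ha₁.le
      simp only [hU]
      rw [wordMean_rootWeight ha₁ hφ, wordMean_rootWeight ha₁ hφ, wordMean_rootWeight ha₁ hφ]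
      linarith
    have key : ∀ n : ℕ, n * t ≤ U n := by
      intro n
      rcases Nat.eq_zero_or_pos n with rfl | hn
      · have := hsub 0 0
        simp only [add_zero] at this
        simp only [Nat.cast_zero, zero_mul]
        linarith
      · have hn' : (0 : ℝ) < n := Nat.cast_pos.2 hn
        rw [mul_comm, ← le_div_iff₀ hn']
        by_contra! hlt
        -- one ratio below `t` would force the upper limit below `t`, by subadditivity
        obtain ⟨L, hL1, hL2⟩ := exists_between hlt
        have hev := hsub.eventually_div_lt_of_div_lt hn.ne' hL1
        have hle : limsup (fun n : ℕ => ((wordMean φ n (cylMeasure X η) / n : ℝ) : EReal))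
            atTop ≤ (L : EReal) := by
          refine limsup_le_of_le (by isBoundedDefault) ?_
          filter_upwards [hev] with k hk
          refine EReal.coe_le_coe_iff.2 (le_trans ?_ hk.le)
          refine div_le_div_of_nonneg_right ?_ (Nat.cast_nonneg k)
          simp only [hU]
          linarith
        rw [ht, EReal.coe_le_coe_iff] at hle
        linarith
    intro n
    have := key n
    simp only [hU] at this
    linarith

end Factor

/-! ### Translation between functions on the language and gluing weights -/

section Translation

variable {A B : Type*} [Finite A] [TopologicalSpace A] [Finite B] [TopologicalSpace B]
  {X : Subshift A ℕ} {Y : Subshift B ℕ} {π : X.carrier → Y.carrier} {b : A → B} {a₁ a₂ : ℝ}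
  {φ : List A → ℝ}
variable [DiscreteTopology A] [MeasurableSpace A] [BorelSpace A] [DiscreteTopology B]
  [MeasurableSpace B] [BorelSpace B]

theorem nonempty_carrier_of_mem {I : List A} (hI : I ∈ language X) (hne : I ≠ []) :
    X.carrier.Nonempty := by
  rcases hI with h | ⟨x, hx, _⟩
  · exact absurd h hne
  · exact ⟨x, hx⟩

/-- The quasi-multiplicativity of `φ` on the language of `X` makes `φ ^ (1 / a₁)`, extended by zero, a
gluing weight on all words. -/
theorem gluingWeight_rootWeight {S : Finset ℕ} (ha₁ : 0 < a₁)
    (hφ : ∀ I ∈ language X, 0 ≤ φ I) (hpos : ∃ I ∈ language X, I ≠ [] ∧ 0 < φ I)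
    {c : ℝ} (hc0 : 0 < c) (hc1 : c ≤ 1)
    (hsub : ∀ I J : List A, I ++ J ∈ language X → φ (I ++ J) ≤ c⁻¹ * φ I * φ J)
    (hglue : ∀ I ∈ language X, ∀ J ∈ language X, ∃ K ∈ language X, K.length ∈ S ∧
      I ++ K ++ J ∈ language X ∧ c * φ I * φ J ≤ φ (I ++ K ++ J)) :
    GluingWeight S (c ^ (1 / a₁)) (rootWeight X a₁ φ) := by
  have hτ : 0 < 1 / a₁ := one_div_pos.2 ha₁
  obtain ⟨I₀, hI₀, hne, hI₀pos⟩ := hpos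
  have hX := nonempty_carrier_of_mem hI₀ hne
  have hnn : ∀ I, 0 ≤ rootWeight X a₁ φ I := fun I => by
    by_cases hI : I ∈ language X
    · rw [rootWeight_of_mem hI]
      exact Real.rpow_nonneg (hφ I hI) _
    · rw [rootWeight_of_notMem hI]
  refine ⟨hnn, ⟨I₀, hne, (rootWeight_pos_iff ha₁ hφ).2 ⟨hI₀, hI₀pos⟩⟩,
    Real.rpow_pos_of_pos hc0 _, Real.rpow_le_one hc0.le hc1 hτ.le, fun I J => ?_, fun I J => ?_⟩
  · by_cases hIJ : I ++ J ∈ language X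
    · obtain ⟨hI, hJ⟩ := language_of_append X hX hIJ
      rw [rootWeight_of_mem hIJ, rootWeight_of_mem hI, rootWeight_of_mem hJ,
        ← Real.mul_rpow hc0.le (hφ _ hIJ), ← Real.mul_rpow (hφ _ hI) (hφ _ hJ)]
      refine Real.rpow_le_rpow (mul_nonneg hc0.le (hφ _ hIJ)) ?_ hτ.le
      have := hsub I J hIJ
      rwa [mul_assoc, le_inv_mul_iff₀ hc0] at this
    · rw [rootWeight_of_notMem hIJ, mul_zero]
      exact mul_nonneg (hnn I) (hnn J)
  · by_cases hIJ : I ∈ language X ∧ J ∈ language X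
    · obtain ⟨K, _, hKS, hK, hle⟩ := hglue I hIJ.1 J hIJ.2
      refine ⟨K, hKS, ?_⟩
      rw [rootWeight_of_mem hK, rootWeight_of_mem hIJ.1, rootWeight_of_mem hIJ.2,
        ← Real.mul_rpow (hφ _ hIJ.1) (hφ _ hIJ.2),
        ← Real.mul_rpow hc0.le (mul_nonneg (hφ _ hIJ.1) (hφ _ hIJ.2))]
      refine Real.rpow_le_rpow (mul_nonneg hc0.le (mul_nonneg (hφ _ hIJ.1) (hφ _ hIJ.2))) ?_ hτ.le
      rwa [← mul_assoc]
    · obtain ⟨K, _, hKS, -⟩ := hglue [] (Or.inl rfl) [] (Or.inl rfl)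
      refine ⟨K, hKS, ?_⟩
      have : rootWeight X a₁ φ I * rootWeight X a₁ φ J = 0 := by
        rw [not_and_or] at hIJ
        rcases hIJ with h | h
        · rw [rootWeight_of_notMem h, zero_mul]
        · rw [rootWeight_of_notMem h, mul_zero]
      rw [this, mul_zero]
      exact hnn _

theorem exists_gluingWeight_of_memDw {p : ℕ} (ha₁ : 0 < a₁) (h : MemDw X p φ) :
    ∃ c, GluingWeight (Finset.range (p + 1)) c (rootWeight X a₁ φ) := by
  obtain ⟨hφ, hpos, c, hc0, hc1, hsub, hglue⟩ := h
  refine ⟨_, gluingWeight_rootWeight ha₁ hφ hpos hc0 hc1 hsub fun I hI J hJ => ?_⟩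
  obtain ⟨K, hK, hKp, hle⟩ := hglue I hI J hJ
  exact ⟨K, hK, Finset.mem_range.2 (Nat.lt_succ_of_le hKp), hle⟩

theorem exists_gluingWeight_of_memD {p : ℕ} (ha₁ : 0 < a₁) (h : MemD X p φ) :
    ∃ c, GluingWeight {p} c (rootWeight X a₁ φ) := by
  obtain ⟨hφ, hpos, c, hc0, hc1, hsub, hglue⟩ := h
  refine ⟨_, gluingWeight_rootWeight ha₁ hφ hpos hc0 hc1 hsub fun I hI J hJ => ?_⟩
  obtain ⟨K, hK, hKp, hle⟩ := hglue I hI J hJ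
  exact ⟨K, hK, Finset.mem_singleton.2 hKp, hle⟩

/-- Words outside the language carry no root weight, so the fibre sum may run over all words. -/
theorem phi2_eq (J : List B) : phi2 X b a₁ φ J = push b (rootWeight X a₁ φ) J ^ a₁ := by
  classical
  rw [phi2, push]
  congr 1
  symm
  rw [← Finset.sum_filter_add_sum_filter_not (fiber b J) (fun I => I ∈ language X)]
  rw [Finset.sum_eq_zero (s := (fiber b J).filter fun I => I ∉ language X)
    (fun I hI => rootWeight_of_notMem (Finset.mem_filter.1 hI).2), add_zero]
  refine Finset.sum_congr ?_ fun I hI => ?_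
  · ext I
    simp only [Finset.mem_filter, mem_fiber, mem_words]
    constructor
    · rintro ⟨rfl, hI⟩
      exact ⟨⟨hI, by simp⟩, rfl⟩
    · rintro ⟨⟨hI, _⟩, h⟩
      exact ⟨h, hI⟩
  · rw [Finset.mem_filter, mem_words] at hI
    exact rootWeight_of_mem hI.1.1

theorem IsOneBlockFactorMap.map_mem_language (hπ : IsOneBlockFactorMap X Y π b) {I : List A}
    (hI : I ∈ language X) : I.map b ∈ language Y := by
  rcases hI with rfl | ⟨x, hx, hI⟩
  · exact Or.inl rfl
  · refine Or.inr ⟨(π ⟨x, hx⟩).1, (π ⟨x, hx⟩).2, ?_⟩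
    rw [hπ.initialWord_map, List.length_map]
    exact congrArg _ hI

theorem phi3_eq (hπ : IsOneBlockFactorMap X Y π b) {S : Finset ℕ} {c : ℝ}
    (h : GluingWeight S c (rootWeight X a₁ φ)) (ha₁ : 0 < a₁) (ha₂ : 0 ≤ a₂) (n : ℕ) :
    phi3 X Y b a₁ a₂ φ n = partitionSum b (a₁ / (a₁ + a₂)) (rootWeight X a₁ φ) n := by
  have hκ : 0 < a₁ / (a₁ + a₂) := (kappa_facts ha₁ ha₂).1
  have e : ∀ J, phi2 X b a₁ φ J ^ (1 / (a₁ + a₂)) =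
      push b (rootWeight X a₁ φ) J ^ (a₁ / (a₁ + a₂)) := fun J => by
    rw [phi2_eq, ← Real.rpow_mul (push_nonneg b h.nonneg J), mul_one_div]
  rw [phi3, partitionSum, Finset.sum_congr rfl fun J _ => e J]
  refine sum_words_eq Y n _ fun J hJ => ?_
  have : push b (rootWeight X a₁ φ) J = 0 := Finset.sum_eq_zero fun I hI => by
    refine rootWeight_of_notMem fun hmem => hJ ?_
    rw [← mem_fiber.1 hI]
    exact hπ.map_mem_language hmem
  rw [this, Real.zero_rpow hκ.ne']

/-- `φ̃` is the word probability of the root weight, with exponent `κ = a₁ / (a₁ + a₂)`. -/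
theorem phiTilde_eq (hπ : IsOneBlockFactorMap X Y π b) {S : Finset ℕ} {c : ℝ}
    (h : GluingWeight S c (rootWeight X a₁ φ)) (ha₁ : 0 < a₁) (ha₂ : 0 ≤ a₂) {I : List A}
    (hI : I ∈ language X) :
    phiTilde X Y b a₁ a₂ φ I = wordProb b (a₁ / (a₁ + a₂)) (rootWeight X a₁ φ) I := by
  have hZ := push_nonneg b h.nonneg (I.map b)
  rw [phiTilde, phi3_eq hπ h ha₁ ha₂, phi2_eq, ← Real.rpow_mul hZ, ← Real.rpow_mul hZ,
    mul_one_div, mul_one_div, div_self ha₁.ne', Real.rpow_one, wordProb, fiberWeight,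
    ← rootWeight_of_mem hI]
  rcases hZ.eq_or_lt with hz | hz
  · have h0 : rootWeight X a₁ φ I = 0 :=
      le_antisymm (hz ▸ le_push_map b h.nonneg I) (h.nonneg I)
    rw [h0]; simp
  · rw [Real.rpow_sub_one hz.ne']
    ring

theorem extensionSum_eq (hπ : IsOneBlockFactorMap X Y π b) {S : Finset ℕ} {c : ℝ}
    (h : GluingWeight S c (rootWeight X a₁ φ)) (ha₁ : 0 < a₁) (ha₂ : 0 ≤ a₂)
    (hX : X.carrier.Nonempty) (m n : ℕ) (I : List A) :
    extensionSum X (phiTilde X Y b a₁ a₂ φ) m n I =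
      paddedSum (wordProb b (a₁ / (a₁ + a₂)) (rootWeight X a₁ φ)) m n I := by
  classical
  set f := wordProb b (a₁ / (a₁ + a₂)) (rootWeight X a₁ φ) with hf
  have hf0 : ∀ W ∉ language X, f W = 0 := fun W hW => by
    rw [hf, wordProb, fiberWeight, rootWeight_of_notMem hW]; simp
  rw [paddedSum, ← Finset.sum_product', extensionSum]
  have e : ∀ P ∈ (words X m ×ˢ words X n).filter (fun P => P.1 ++ I ++ P.2 ∈ language X),
      phiTilde X Y b a₁ a₂ φ (P.1 ++ I ++ P.2) = f (P.1 ++ I ++ P.2) := fun P hP =>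
    phiTilde_eq hπ h ha₁ ha₂ (Finset.mem_filter.1 hP).2
  rw [Finset.sum_congr rfl e]
  refine Finset.sum_subset (fun P hP => ?_) fun P hP hP' => hf0 _ fun hmem => hP' ?_
  · simp only [Finset.mem_filter, Finset.mem_product, mem_words, mem_allWords] at hP ⊢
    exact ⟨hP.1.1.2, hP.1.2.2⟩
  · simp only [Finset.mem_filter, Finset.mem_product, mem_words, mem_allWords] at hP ⊢
    obtain ⟨h1, h2⟩ := language_of_append X hX hmem
    exact ⟨⟨⟨(language_of_append X hX h1).1, hP.1⟩, h2, hP.2⟩, hmem⟩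

/-- A measure of maximal free energy has bounded relative entropies with respect to the word
probabilities. -/
theorem relEntropy_wordProb_le (hπ : IsOneBlockFactorMap X Y π b) {S : Finset ℕ} {c : ℝ}
    (h : GluingWeight S c (rootWeight X a₁ φ)) (ha₁ : 0 < a₁) (ha₂ : 0 ≤ a₂)
    (hφ : ∀ I ∈ language X, 0 ≤ φ I) {P C : ℝ}
    (hP : ∀ n : ℕ, |Real.log (partitionSum b (a₁ / (a₁ + a₂)) (rootWeight X a₁ φ) n) - n * P| ≤ C)
    {η : Measure X.carrier} (hη : η ∈ invariantMeasures X)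
    (heq : weightedFreeEnergy X Y π a₁ a₂ (generatedPotential X φ) η =
      (((a₁ + a₂) * P : ℝ) : EReal)) (n : ℕ) :
    a₁ * relEntropy n (cylMeasure X η) (wordProb b (a₁ / (a₁ + a₂)) (rootWeight X a₁ φ)) ≤
      (a₁ + a₂) * C - a₁ * Real.log c := by
  have := hη.1
  obtain ⟨hκ0, hκ1, hβ, hκβ⟩ := kappa_facts ha₁ ha₂
  obtain ⟨hsupp, t, -, hsum, hlow⟩ := of_weightedFreeEnergy_eq h ha₁ hφ hη heq
  have e1 := h.relEntropy_le b hκ0 hβ hκβ n (cylMeasure_nonneg X η) (sum_cylMeasure X η n)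
    fun I _ hI => hsupp I hI
  have e2 := mul_le_mul_of_nonneg_left e1 ha₁.le
  rw [mul_sub, mul_energy_eq ha₁ hφ, ← mul_assoc,
    show a₁ * (1 + a₂ / a₁) = a₁ + a₂ by field_simp] at e2
  have e3 := (entropy_spec X hη).2 n
  have e4 := (entropy_spec Y (hπ.map_mem_invariantMeasures hη)).2 n
  rw [show cylMeasure Y (η.map π) = push b (cylMeasure X η) from
    funext fun J => hπ.cylMeasure_map η J] at e4
  have e5 := mul_le_mul_of_nonneg_left e3 ha₁.le
  have e6 := mul_le_mul_of_nonneg_left e4 ha₂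
  have e7 := hlow n
  have e8 : Real.log (partitionSum b (a₁ / (a₁ + a₂)) (rootWeight X a₁ φ) n) ≤ n * P + C := by
    have := (abs_le.1 (hP n)).2
    linarith
  have e9 := mul_le_mul_of_nonneg_left e8 (by linarith : 0 ≤ a₁ + a₂)
  have e10 : (n : ℝ) * t + a₁ * (n * entropy X η) + a₂ * (n * entropy Y (η.map π)) =
      (a₁ + a₂) * (n * P) := by
    linear_combination (n : ℝ) * hsum
  linarith

/-- The three terms of the energy of a measure of maximal free energy agree with their linear
asymptotics up to a constant. -/
theorem bounds_of_weightedFreeEnergy_eq (hπ : IsOneBlockFactorMap X Y π b) {S : Finset ℕ} {c : ℝ}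
    (h : GluingWeight S c (rootWeight X a₁ φ)) (ha₁ : 0 < a₁) (ha₂ : 0 ≤ a₂)
    (hφ : ∀ I ∈ language X, 0 ≤ φ I) {P C : ℝ}
    (hP : ∀ n : ℕ, |Real.log (partitionSum b (a₁ / (a₁ + a₂)) (rootWeight X a₁ φ) n) - n * P| ≤ C)
    {η : Measure X.carrier} (hη : η ∈ invariantMeasures X)
    (heq : weightedFreeEnergy X Y π a₁ a₂ (generatedPotential X φ) η =
      (((a₁ + a₂) * P : ℝ) : EReal)) :
    ∃ t : ℝ, potentialLimit X (generatedPotential X φ) η = (t : EReal) ∧ ∃ D : ℝ, ∀ n : ℕ,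
      |wordMean φ n (cylMeasure X η) - n * t| ≤ D ∧
      |wordEntropy n (cylMeasure X η) - n * entropy X η| ≤ D := by
  have := hη.1
  obtain ⟨hκ0, hκ1, hβ, hκβ⟩ := kappa_facts ha₁ ha₂
  obtain ⟨hsupp, t, ht, hsum, hlow⟩ := of_weightedFreeEnergy_eq h ha₁ hφ hη heq
  set D := (a₁ + a₂) * C - a₁ * Real.log c with hD
  have hC0 : 0 ≤ C := (abs_nonneg _).trans (hP 0)
  have hlc := h.neg_log_nonneg
  have hac : 0 ≤ (a₁ + a₂) * C := mul_nonneg (by linarith) hC0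
  have hac' : 0 ≤ a₁ * -Real.log c := mul_nonneg ha₁.le hlc
  have hD0 : 0 ≤ D := by linarith
  refine ⟨t, ht, max D (D / a₁), fun n => ?_⟩
  have e1 := h.energy_le b hκ0 hβ hκβ n (cylMeasure_nonneg X η) (sum_cylMeasure X η n)
    fun I _ hI => hsupp I hI
  have e2 := mul_le_mul_of_nonneg_left e1 ha₁.le
  rw [mul_energy_eq ha₁ hφ, ← mul_assoc,
    show a₁ * (1 + a₂ / a₁) = a₁ + a₂ by field_simp] at e2
  have e3 := (entropy_spec X hη).2 n
  have e4 := (entropy_spec Y (hπ.map_mem_invariantMeasures hη)).2 n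
  rw [show cylMeasure Y (η.map π) = push b (cylMeasure X η) from
    funext fun J => hπ.cylMeasure_map η J] at e4
  have e5 := mul_le_mul_of_nonneg_left e3 ha₁.le
  have e6 := mul_le_mul_of_nonneg_left e4 ha₂
  have e7 := hlow n
  have e8 : Real.log (partitionSum b (a₁ / (a₁ + a₂)) (rootWeight X a₁ φ) n) ≤ n * P + C := by
    have := (abs_le.1 (hP n)).2
    linarith
  have e9 := mul_le_mul_of_nonneg_left e8 (by linarith : 0 ≤ a₁ + a₂)
  have e10 : (n : ℝ) * t + a₁ * (n * entropy X η) + a₂ * (n * entropy Y (η.map π)) =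
      (a₁ + a₂) * (n * P) := by
    linear_combination (n : ℝ) * hsum
  constructor
  · refine le_trans ?_ (le_max_left _ _)
    rw [abs_le]
    constructor <;> linarith
  · refine le_trans ?_ (le_max_right _ _)
    rw [abs_of_nonneg (by linarith), le_div_iff₀ ha₁]
    linarith

end Translation

end

end WeightedEquilibrium

open WeightedEquilibrium in
theorem theorem6p1 {A B : Type*}
    [Finite A] [TopologicalSpace A] [DiscreteTopology A] [MeasurableSpace A] [BorelSpace A]
    [Finite B] [TopologicalSpace B] [DiscreteTopology B] [MeasurableSpace B] [BorelSpace B]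
    (X : Subshift A ℕ) (Y : Subshift B ℕ)
    (π : X.carrier → Y.carrier) (b : A → B) (hπ : IsOneBlockFactorMap X Y π b)
    (a₁ a₂ : ℝ) (ha₁ : 0 < a₁) (ha₂ : 0 ≤ a₂)
    (p : ℕ) (φ : List A → ℝ) (hφ : MemDw X p φ) :
    ∃ μ : Measure X.carrier,
      -- `μ` is the unique weighted equilibrium state of the potential generated by `φ`
      IsWeightedEquilibriumState X Y π a₁ a₂ (generatedPotential X φ) μ ∧
      (∀ η : Measure X.carrier,
        IsWeightedEquilibriumState X Y π a₁ a₂ (generatedPotential X φ) η → η = μ) ∧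
      Ergodic (shiftMap X) μ ∧
      -- two-sided bound of `μ(I)` by `φ̃*(I)`, whose defining supremum is finite
      (∀ I ∈ language X, BddAbove (Set.range fun q : ℕ × ℕ =>
        extensionSum X (phiTilde X Y b a₁ a₂ φ) q.1 q.2 I)) ∧
      (∃ c : ℝ, 0 < c ∧ ∀ I ∈ language X,
        c⁻¹ * starSup X (phiTilde X Y b a₁ a₂ φ) I ≤ μ.real (cyl X I) ∧
        μ.real (cyl X I) ≤ c * starSup X (phiTilde X Y b a₁ a₂ φ) I) ∧
      (∃ c : ℝ, 0 < c ∧ ∀ I ∈ language X,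
        c * phiTilde X Y b a₁ a₂ φ I ≤ starSup X (phiTilde X Y b a₁ a₂ φ) I) ∧
      -- lower bound for sums of correlations
      (∃ c : ℝ≥0, 0 < c ∧ ∀ S T : Set X.carrier, MeasurableSet S → MeasurableSet T →
        (c : ℝ≥0∞) * μ S * μ T ≤
          liminf (fun n : ℕ => ∑ i ∈ Finset.range (p + 1),
            μ (S ∩ (shiftMap X)^[n + i] ⁻¹' T)) atTop) ∧
      -- the estimates up to `O(1)`; logarithms with a non-zero weight are taken at positive numbers
      (∀ I ∈ language X, 0 < μ.real (cyl X I) → 0 < φ I ∧ 0 < phiTilde X Y b a₁ a₂ φ I) ∧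
      (∃ C : ℝ, ∀ n : ℕ,
        |(∑ I ∈ words X n, μ.real (cyl X I) * Real.log (μ.real (cyl X I))) -
          ∑ I ∈ words X n, μ.real (cyl X I) * Real.log (phiTilde X Y b a₁ a₂ φ I)| ≤ C) ∧
      (∃ C : ℝ, ∀ n : ℕ,
        |(∑ I ∈ words X n, μ.real (cyl X I) * Real.log (phiTilde X Y b a₁ a₂ φ I)) -
          (-(n * entropy X μ))| ≤ C) ∧
      (∃ t : ℝ, potentialLimit X (generatedPotential X φ) μ = (t : EReal) ∧
        ∃ C : ℝ, ∀ n : ℕ,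
          |(∑ I ∈ words X n, μ.real (cyl X I) * Real.log (φ I)) - n * t| ≤ C) ∧
      -- lower bound for single correlations
      (MemD X p φ →
        ∃ c : ℝ≥0, 0 < c ∧ ∀ S T : Set X.carrier, MeasurableSet S → MeasurableSet T →
          (c : ℝ≥0∞) * μ S * μ T ≤
            liminf (fun n : ℕ => μ (S ∩ (shiftMap X)^[n] ⁻¹' T)) atTop) := by
  obtain ⟨hφ0, hφpos, -⟩ := id hφ
  obtain ⟨I₀, hI₀, hne₀, -⟩ := hφpos
  have hX := nonempty_carrier_of_mem hI₀ hne₀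
  obtain ⟨c, h⟩ := exists_gluingWeight_of_memDw ha₁ hφ
  obtain ⟨hκ0, hκ1, hβ, hκβ⟩ := kappa_facts ha₁ ha₂
  obtain ⟨P, C, hP⟩ := h.exists_log_partitionSum b hκ0 hκ1
  set f := wordProb b (a₁ / (a₁ + a₂)) (rootWeight X a₁ φ) with hf
  have hψcyl : ∀ I, 0 < rootWeight X a₁ φ I → (cyl X I).Nonempty := fun I hI =>
    (mem_language_iff X hX).1 ((rootWeight_pos_iff ha₁ hφ0).1 hI).1
  obtain ⟨μ, hμ, ⟨d, hd, hlow⟩, hup, henergy⟩ :=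
    h.exists_gibbs_measure b hκ0 hκ1 hβ hκβ hψcyl hP
  have hμp := hμ.1
  have hext := extensionSum_eq hπ h ha₁ ha₂ hX
  have htil : ∀ {I}, I ∈ language X → phiTilde X Y b a₁ a₂ φ I = f I := fun hI =>
    phiTilde_eq hπ h ha₁ ha₂ hI
  have hsuppμ : ∀ I, 0 < cylMeasure X μ I → 0 < rootWeight X a₁ φ I := by
    intro I hI
    by_contra hcon
    refine absurd hI (not_lt.2 (hup I 0 fun m n => ?_))
    by_contra! hpos
    exact hcon (h.pos_of_paddedSum_pos b hpos)
  have hbdd : ∀ I, BddAbove (Set.range fun q : ℕ × ℕ =>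
      extensionSum X (phiTilde X Y b a₁ a₂ φ) q.1 q.2 I) := fun I => ⟨1, by
    rintro _ ⟨q, rfl⟩
    simp only [hext]
    exact h.paddedSum_le_one b hκ0 _ _ _⟩
  -- the free energy of `μ` is maximal, and every measure of maximal free energy equals `μ`
  have hle : ∀ η ∈ invariantMeasures X, weightedFreeEnergy X Y π a₁ a₂
      (generatedPotential X φ) η ≤ (((a₁ + a₂) * P : ℝ) : EReal) := fun η hη =>
    weightedFreeEnergy_le hπ h ha₁ ha₂ hφ0 hP hη
  have hμeq : weightedFreeEnergy X Y π a₁ a₂ (generatedPotential X φ) μ =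
      (((a₁ + a₂) * P : ℝ) : EReal) :=
    le_antisymm (hle μ hμ) (le_weightedFreeEnergy hπ ha₁ hφ0 hμ hsuppμ henergy)
  have hsup : (⨆ η ∈ invariantMeasures X, weightedFreeEnergy X Y π a₁ a₂
      (generatedPotential X φ) η) = (((a₁ + a₂) * P : ℝ) : EReal) :=
    le_antisymm (iSup₂_le hle) (hμeq ▸ le_iSup₂ (f := fun η (_ : η ∈ invariantMeasures X) =>
      weightedFreeEnergy X Y π a₁ a₂ (generatedPotential X φ) η) μ hμ)
  obtain ⟨e, he, hcorr⟩ := h.correlation_cyl b hκ0 hκ1 hd hlow hup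
  have herg : Ergodic (shiftMap X) μ := ergodic_of_correlation hμ.2 he hcorr
  obtain ⟨t, ht, D, hD⟩ := bounds_of_weightedFreeEnergy_eq hπ h ha₁ ha₂ hφ0 hP hμ hμeq
  have hfμ : ∀ I, d * f I ≤ cylMeasure X μ I := fun I => by
    have := hlow 0 0 I
    rwa [paddedSum_zero_zero] at this
  have hlogf : ∀ n, ∑ I ∈ words X n, μ.real (cyl X I) * Real.log (phiTilde X Y b a₁ a₂ φ I) =
      -wordEntropy n (cylMeasure X μ) - relEntropy n (cylMeasure X μ) f := by
    intro n
    have e1 : ∀ I ∈ words X n, μ.real (cyl X I) * Real.log (phiTilde X Y b a₁ a₂ φ I) =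
        cylMeasure X μ I * Real.log (f I) := fun I hI => by
      rw [htil ((mem_words X).1 hI).1, cylMeasure]
    rw [Finset.sum_congr rfl e1, sum_words_eq X n _ fun I hI => by
      rw [cylMeasure_of_notMem X μ hI, zero_mul], wordEntropy, relEntropy,
      ← Finset.sum_neg_distrib, ← Finset.sum_sub_distrib]
    refine Finset.sum_congr rfl fun I _ => ?_
    rw [Real.negMulLog]
    ring
  have hrel0 : ∀ n, 0 ≤ relEntropy n (cylMeasure X μ) f := fun n =>
    relEntropy_nonneg (cylMeasure_nonneg X μ) (h.wordProb_nonneg b)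
      (fun I _ hI => (h.wordProb_pos_iff b I).2 (hsuppμ I hI)) (sum_cylMeasure X μ n)
      (h.sum_wordProb b hκ0 n)
  set D' := ((a₁ + a₂) * C - a₁ * Real.log c) / a₁ with hD'
  have hrel : ∀ n, relEntropy n (cylMeasure X μ) f ≤ D' := fun n => by
    rw [hD', le_div_iff₀ ha₁, mul_comm]
    exact relEntropy_wordProb_le hπ h ha₁ ha₂ hφ0 hP hμ hμeq n
  refine ⟨μ, ⟨hμ, hμeq.trans hsup.symm⟩, fun η hη => ?_, herg, fun I _ => hbdd I, ?_, ?_, ?_, ?_,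
    ?_, ?_, ?_, ?_⟩
  -- uniqueness: the relative entropy with respect to `f` bounds that with respect to `μ ≥ d f`
  · have hηeq := hη.2.trans hsup
    have hηp := hη.1.1
    have hηsupp := (of_weightedFreeEnergy_eq h ha₁ hφ0 hη.1 hηeq).1
    have hfpos : ∀ I, 0 < cylMeasure X η I → 0 < f I := fun I hI =>
      (h.wordProb_pos_iff b I).2 (hηsupp I hI)
    have hμpos : ∀ I, 0 < cylMeasure X η I → 0 < cylMeasure X μ I := fun I hI =>
      (mul_pos hd (hfpos I hI)).trans_le (hfμ I)
    refine herg.eq_of_absolutelyContinuous hη.1.2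
      (absolutelyContinuous_of_relEntropy_le (C := D' - Real.log d) hμpos fun n => ?_)
    have e1 : relEntropy n (cylMeasure X η) (cylMeasure X μ) ≤
        relEntropy n (cylMeasure X η) f - Real.log d := by
      have e2 : Real.log d = ∑ I ∈ allWords A n, cylMeasure X η I * Real.log d := by
        rw [← Finset.sum_mul, sum_cylMeasure, one_mul]
      rw [e2, relEntropy, relEntropy, ← Finset.sum_sub_distrib]
      refine Finset.sum_le_sum fun I _ => ?_
      rcases (cylMeasure_nonneg X η I).eq_or_lt with hz | hz
      · simp [← hz]
      · have e3 := Real.log_le_log (mul_pos hd (hfpos I hz)) (hfμ I)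
        rw [Real.log_mul hd.ne' (hfpos I hz).ne'] at e3
        rw [← mul_sub]
        exact mul_le_mul_of_nonneg_left (by linarith) hz.le
    have e4 : relEntropy n (cylMeasure X η) f ≤ D' := by
      rw [hD', le_div_iff₀ ha₁, mul_comm]
      exact relEntropy_wordProb_le hπ h ha₁ ha₂ hφ0 hP hη.1 hηeq n
    linarith
  · refine ⟨max 1 d⁻¹, lt_max_of_lt_left one_pos, fun I _ => ⟨?_, ?_⟩⟩
    · rw [inv_mul_le_iff₀ (lt_max_of_lt_left one_pos)]
      refine ciSup_le fun q => ?_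
      rw [hext]
      calc _ = d⁻¹ * (d * paddedSum f q.1 q.2 I) := by rw [inv_mul_cancel_left₀ hd.ne']
        _ ≤ d⁻¹ * cylMeasure X μ I := mul_le_mul_of_nonneg_left (hlow _ _ _) (inv_pos.2 hd).le
        _ ≤ _ := mul_le_mul_of_nonneg_right (le_max_right _ _) measureReal_nonneg
    · have e1 : cylMeasure X μ I ≤ starSup X (phiTilde X Y b a₁ a₂ φ) I :=
        hup I _ fun m n => (hext m n I).symm.le.trans (le_ciSup (hbdd I) (m, n))
      refine e1.trans (le_mul_of_one_le_left ?_ (le_max_left _ _))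
      exact (cylMeasure_nonneg X μ I).trans e1
  · refine ⟨1, one_pos, fun I hI => ?_⟩
    rw [one_mul, htil hI, ← paddedSum_zero_zero f I, ← hext]
    exact le_ciSup (hbdd I) (0, 0)
  · exact ⟨e.toNNReal, Real.toNNReal_pos.2 he, fun s u hs hu =>
      le_liminf_correlation hμ.2 he hcorr hs hu⟩
  · intro I hI hpos
    have hψ := hsuppμ I hpos
    refine ⟨((rootWeight_pos_iff ha₁ hφ0).1 hψ).2, ?_⟩
    rw [htil hI]
    exact (h.wordProb_pos_iff b I).2 hψ
  · refine ⟨D', fun n => ?_⟩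
    rw [sum_words_mul_log, hlogf, abs_of_nonneg (by linarith [hrel0 n])]
    linarith [hrel n]
  · refine ⟨D + D', fun n => ?_⟩
    rw [hlogf]
    have e1 := abs_le.1 (hD n).2
    have e2 := hrel0 n
    have e3 := hrel n
    rw [abs_le]
    constructor <;> linarith
  · refine ⟨t, ht, D, fun n => ?_⟩
    have e1 : ∑ I ∈ words X n, μ.real (cyl X I) * Real.log (φ I) =
        wordMean φ n (cylMeasure X μ) :=
      sum_words_eq X n _ fun I hI => by rw [cyl_eq_empty X hI]; simp
    rw [e1]
    exact (hD n).1
  · intro hD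
    obtain ⟨c', h'⟩ := exists_gluingWeight_of_memD ha₁ hD
    obtain ⟨e', he', hcorr'⟩ := h'.correlation_cyl b hκ0 hκ1 hd hlow hup
    refine ⟨e'.toNNReal, Real.toNNReal_pos.2 he', fun s u hs hu => ?_⟩
    have e1 := le_liminf_correlation hμ.2 he' hcorr' hs hu
    simp only [Finset.sum_singleton] at e1
    rwa [liminf_nat_add (fun n => μ (s ∩ (shiftMap X)^[n] ⁻¹' u)) p] at e1
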